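/- Let $M$ be a smooth manifold (Hausdorff, second countable, finite-dimensional, without boundary) and let $L\subset TM\oplus T^*M$ be a Dirac structure, i.e. a smooth maximal isotropic subbundle whose sections are closed under the Courant bracket. Assume that $E:=L\cap TM$ has constant rank $k$, and let $\pi\colon E^*\to M$ be the dual bundle of $E$. A splitting is a smooth distribution $V$ with $E\oplus V=TM$. It defines an embedding $i_V\colon E^*\to T^*M$ (extend a linear form on $E_x$ by zero on $V_x$) and the field of subspaces $$L_V:=\tau_{i_V^*\omega_{T^*M}}(\pi^*L)=\{(X,\ \pi^*\eta+\iota_X\, i_V^*\omega_{T^*M}) : (\pi_*X,\eta)\in L\}\subset T(E^*)\oplus T^*(E^*),$$ where $\omega_{T^*M}=d\alpha_{T^*M}$ is the exterior derivative of the canonical one-form. Identify $M$ with the zero section of $E^*$. Then: 1. Splittings exist. 2. For every splitting $V$ there are an open neighbourhood $U$ of $M$ in $E^*$ and a Poisson structure $\Pi$ on $U$ with $L_V|_U=\mathrm{graph}(\Pi)=\{(\sharp\xi,\xi)\}$. Moreover $M$ is coisotropically embedded in $(U,\Pi)$, i.e. it is a smoothly embedded coisotropic submanifold, and $\mathrm{graph}(\Pi)$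 pulls back to $L$ on $M$. 3. Different splittings give isomorphic Poisson structures near $M$: if $V_0,V_1$ are splittings and $U_0,U_1$ are open neighbourhoods of $M$ on which $L_{V_0}$, $L_{V_1}$ are the graphs of Poisson structures $\Pi_0,\Pi_1$, then there are open neighbourhoods $U_0'\subset U_0$ and $U_1'\subset U_1$ of $M$ and a diffeomorphism $\varphi\colon U_0'\to U_1'$ which fixes every point of $M$ and satisfies $\varphi_*\Pi_0=\Pi_1$. Hence a Dirac manifold $(M,L)$ for which $L\cap TM$ has constant rank determines, up to neighbourhood equivalence, a canonical Poisson manifold in which it embeds coisotropically. -/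

import Mathlib

open Bundle Set Manifold ContDiff Topology

set_option linter.unusedSectionVars false

noncomputable section

namespace DiracGeometry

section General

variable {E H : Type*} [NormedAddCommGroup E] [NormedSpace ℝ E] [TopologicalSpace H]
  (I : ModelWithCorners ℝ E H) {N : Type*} [TopologicalSpace N] [ChartedSpace H N]

instance (p : N) : T2Space (TangentSpace I p) := inferInstanceAs (T2Space E)

instance [FiniteDimensional ℝ E] (p : N) : FiniteDimensional ℝ (TangentSpace I p) :=
  inferInstanceAs (FiniteDimensional ℝ E)

/-- The cotangent space `T*_p N`. -/
abbrev Cotangent (p : N) : Type _ := TangentSpace I p →L[ℝ] ℝ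

/-- The generalized tangent space `T_p N ⊕ T*_p N`. -/
abbrev Pontryagin (p : N) : Type _ := TangentSpace I p × Cotangent I p

/-- The vector field `X` is smooth on `U`. -/
def SmoothVectorFieldOn [IsManifold I ∞ N] (X : ∀ p : N, TangentSpace I p) (U : Set N) : Prop :=
  ContMDiffOn I (I.prod 𝓘(ℝ, E)) ∞ (fun p => TotalSpace.mk' E p (X p)) U

/-- The one-form `ξ` is smooth on `U`. -/
def SmoothOneFormOn [IsManifold I ∞ N] (ξ : ∀ p : N, Cotangent I p) (U : Set N) : Prop :=
  ContMDiffOn I (I.prod 𝓘(ℝ, E →L[ℝ] ℝ)) ∞ (fun p => TotalSpace.mk' (E →L[ℝ] ℝ) p (ξ p)) U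

end General

section Distribution

variable {E H : Type*} [NormedAddCommGroup E] [NormedSpace ℝ E] [FiniteDimensional ℝ E]
  [TopologicalSpace H]
  {I : ModelWithCorners ℝ E H} {N : Type*} [TopologicalSpace N] [ChartedSpace H N]
  [IsManifold I ∞ N]

/-- A family of subspaces of the tangent spaces is smooth if each of its vectors extends to a
smooth local vector field with values in the family. (A smooth family of constant rank is the same
thing as a smooth subbundle of the tangent bundle.) -/
def IsSmoothDistribution (V : ∀ x : N, Submodule ℝ (TangentSpace I x)) : Prop :=
  ∀ x₀ : N, ∀ v ∈ V x₀, ∃ U : Set N, ∃ X : ∀ x : N, TangentSpace I x,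
    IsOpen U ∧ x₀ ∈ U ∧ SmoothVectorFieldOn I X U ∧ (∀ x ∈ U, X x ∈ V x) ∧ X x₀ = v

/-- The vector fields `s 0, …, s (k - 1)` form a smooth frame of the family of subspaces `D` over
the open set `U`. -/
structure IsFrameOn {k : ℕ} (D : ∀ x : N, Submodule ℝ (TangentSpace I x))
    (s : Fin k → ∀ x : N, TangentSpace I x) (U : Set N) : Prop where
  isOpen : IsOpen U
  smooth : ∀ i, SmoothVectorFieldOn I (s i) U
  linearIndependent : ∀ x ∈ U, LinearIndependent ℝ (fun i => s i x)
  span_eq : ∀ x ∈ U, Submodule.span ℝ (range fun i => s i x) = D x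

variable (I N) in
/-- A smooth subbundle of rank `k` of the tangent bundle. -/
structure Subbundle (k : ℕ) where
  /-- The fibres. -/
  space : ∀ x : N, Submodule ℝ (TangentSpace I x)
  exists_frame : ∀ x₀ : N, ∃ U : Set N, ∃ s : Fin k → ∀ x : N, TangentSpace I x,
    x₀ ∈ U ∧ IsFrameOn space s U

namespace IsFrameOn

variable {k : ℕ} {D : ∀ x : N, Submodule ℝ (TangentSpace I x)}
  {s t : Fin k → ∀ x : N, TangentSpace I x} {U W : Set N}

theorem mem (hs : IsFrameOn D s U) {x : N} (hx : x ∈ U) (i : Fin k) : s i x ∈ D x := by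
  rw [← hs.span_eq x hx]; exact Submodule.subset_span ⟨i, rfl⟩

/-- The basis of the fibre over `x` given by a frame. -/
def basis (hs : IsFrameOn D s U) {x : N} (hx : x ∈ U) : Module.Basis (Fin k) ℝ (D x) :=
  (Module.Basis.span (hs.linearIndependent x hx)).map (LinearEquiv.ofEq _ _ (hs.span_eq x hx))

theorem coe_basis (hs : IsFrameOn D s U) {x : N} (hx : x ∈ U) (i : Fin k) :
    (hs.basis hx i : TangentSpace I x) = s i x := by
  simp [basis, Module.Basis.span_apply]

/-- The coefficients of a smooth section with respect to a smooth frame are smooth. -/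
theorem contMDiffOn_coeff (hs : IsFrameOn D s U) (hW : IsOpen W)
    {X : ∀ x : N, TangentSpace I x} (hX : SmoothVectorFieldOn I X W)
    (c : N → Fin k → ℝ) (hc : ∀ x ∈ U ∩ W, ∑ i, c x i • s i x = X x) :
    ContMDiffOn I 𝓘(ℝ, Fin k → ℝ) ∞ c (U ∩ W) := by
  intro b hb
  apply ContMDiffAt.contMDiffWithinAt
  let e := trivializationAt E (TangentSpace I) b
  have hbe : b ∈ e.baseSet := mem_baseSet_trivializationAt E (TangentSpace I) b
  let σ : Fin k → N → E := fun i x => (e ⟨x, s i x⟩).2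
  let χ : N → E := fun x => (e ⟨x, X x⟩).2
  have hσ : ∀ i, ContMDiffAt I 𝓘(ℝ, E) ∞ (σ i) b := fun i =>
    (e.contMDiffAt_section_iff hbe).1 ((hs.smooth i b hb.1).contMDiffAt (hs.isOpen.mem_nhds hb.1))
  have hχ : ContMDiffAt I 𝓘(ℝ, E) ∞ χ b :=
    (e.contMDiffAt_section_iff hbe).1 ((hX b hb.2).contMDiffAt (hW.mem_nhds hb.2))
  let S : N → (Fin k → ℝ) →L[ℝ] E := fun x =>
    ∑ i, ContinuousLinearMap.smulRightL ℝ (Fin k → ℝ) E (ContinuousLinearMap.proj i) (σ i x)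
  have hS : ContMDiffAt I 𝓘(ℝ, (Fin k → ℝ) →L[ℝ] E) ∞ S b := by
    apply ContMDiffAt.sum
    intro i _
    exact (ContinuousLinearMap.contMDiff _).contMDiffAt.comp b (hσ i)
  have hSapp : ∀ x v, S x v = ∑ i, v i • σ i x := by
    intro x v; simp [S]
  have hinj : Function.Injective (S b) := by
    have hli : LinearIndependent ℝ (fun i => σ i b) := by
      exact (hs.linearIndependent b hb.1).map'
        (e.linearEquivAt ℝ b hbe : TangentSpace I b →ₗ[ℝ] E) (LinearEquiv.ker _)
    rw [Fintype.linearIndependent_iff] at hli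
    refine (injective_iff_map_eq_zero (S b)).2 fun v hv => ?_
    rw [hSapp] at hv
    exact funext (hli v hv)
  obtain ⟨T₀, hT₀⟩ : ∃ T₀ : E →L[ℝ] (Fin k → ℝ), T₀ ∘L S b = ContinuousLinearMap.id ℝ _ := by
    obtain ⟨T, hT⟩ := LinearMap.exists_leftInverse_of_injective
      (S b : (Fin k → ℝ) →ₗ[ℝ] E) (LinearMap.ker_eq_bot.2 hinj)
    exact ⟨LinearMap.toContinuousLinearMap T, ContinuousLinearMap.ext fun v =>
      LinearMap.congr_fun hT v⟩
  let Q : N → (Fin k → ℝ) →L[ℝ] (Fin k → ℝ) := fun x => T₀ ∘L S x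
  have hQ : ContMDiffAt I 𝓘(ℝ, (Fin k → ℝ) →L[ℝ] (Fin k → ℝ)) ∞ Q b :=
    contMDiffAt_const.clm_comp hS
  have hQb : Q b = 1 := hT₀
  have hQi : ContMDiffAt I 𝓘(ℝ, (Fin k → ℝ) →L[ℝ] (Fin k → ℝ)) ∞
      (fun x => Ring.inverse (Q x)) b := by
    have h : ContDiffAt ℝ ∞ Ring.inverse (Q b) := by
      rw [hQb]; exact contDiffAt_ringInverse ℝ (1 : ((Fin k → ℝ) →L[ℝ] (Fin k → ℝ))ˣ)
    exact h.contMDiffAt.comp b hQ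
  have hunit : ∀ᶠ x in 𝓝 b, IsUnit (Q x) := by
    have : {A : (Fin k → ℝ) →L[ℝ] (Fin k → ℝ) | IsUnit A} ∈ 𝓝 (Q b) := by
      rw [hQb]; exact Units.isOpen.mem_nhds isUnit_one
    exact hQ.continuousAt this
  have hfin : ContMDiffAt I 𝓘(ℝ, Fin k → ℝ) ∞ (fun x => Ring.inverse (Q x) (T₀ (χ x))) b :=
    hQi.clm_apply (contMDiffAt_const.clm_apply hχ)
  refine hfin.congr_of_eventuallyEq ?_
  filter_upwards [hunit, hs.isOpen.mem_nhds hb.1, hW.mem_nhds hb.2,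
    e.open_baseSet.mem_nhds hbe] with x hxQ hxU hxW hxe
  have h1 : S x (c x) = χ x := by
    rw [hSapp]
    have h := congrArg (e.linearEquivAt ℝ x hxe) (hc x ⟨hxU, hxW⟩)
    rw [map_sum] at h
    simp only [map_smul] at h
    exact h
  have h2 : Q x (c x) = T₀ (χ x) := by rw [← h1]; rfl
  rw [← h2]
  have h3 := Ring.inverse_mul_cancel (Q x) hxQ
  exact (DFunLike.congr_fun h3 (c x)).symm

end IsFrameOn

namespace Subbundle

variable {k : ℕ}

/-- The fibre at `x` of the dual bundle `D*`. -/
def Dual (D : Subbundle I N k) (x : N) : Type _ := D.space x →L[ℝ] ℝ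

variable (D : Subbundle I N k)

instance (x : N) : AddCommGroup (D.Dual x) := inferInstanceAs (AddCommGroup (D.space x →L[ℝ] ℝ))

instance (x : N) : Module ℝ (D.Dual x) := inferInstanceAs (Module ℝ (D.space x →L[ℝ] ℝ))

instance (x : N) : TopologicalSpace (D.Dual x) :=
  inferInstanceAs (TopologicalSpace (D.space x →L[ℝ] ℝ))

instance (x : N) : IsTopologicalAddGroup (D.Dual x) :=
  inferInstanceAs (IsTopologicalAddGroup (D.space x →L[ℝ] ℝ))

instance (x : N) : ContinuousSMul ℝ (D.Dual x) :=
  inferInstanceAs (ContinuousSMul ℝ (D.space x →L[ℝ] ℝ))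

instance (x : N) : T2Space (D.Dual x) := inferInstanceAs (T2Space (D.space x →L[ℝ] ℝ))

variable {D} in
/-- An element of the dual bundle as a linear form. -/
def Dual.form {x : N} (e : D.Dual x) : D.space x →L[ℝ] ℝ := e

end Subbundle

namespace IsFrameOn

variable {k : ℕ} {D : Subbundle I N k} {s t : Fin k → ∀ x : N, TangentSpace I x} {U W : Set N}

theorem finite (hs : IsFrameOn D.space s U) {x : N} (hx : x ∈ U) :
    FiniteDimensional ℝ (D.space x) := Module.Finite.of_basis (hs.basis hx)

/-- The linear coordinates `e ↦ (e (s i))ᵢ` on a fibre of the dual bundle. -/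
def coord (hs : IsFrameOn D.space s U) {x : N} (hx : x ∈ U) : D.Dual x ≃ₗ[ℝ] (Fin k → ℝ) :=
  haveI := hs.finite hx
  (LinearMap.toContinuousLinearMap (𝕜 := ℝ) (E := D.space x) (F' := ℝ)).symm.trans
    ((hs.basis hx).constr ℝ).symm

theorem coord_apply (hs : IsFrameOn D.space s U) {x : N} (hx : x ∈ U) (e : D.Dual x) (i : Fin k) :
    hs.coord hx e i = e.form (hs.basis hx i) := rfl

open Classical in
/-- The local trivialization `(x, e) ↦ (x, (e (s i x))ᵢ)` of the dual bundle given by a smooth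
frame. -/
def pretrivialization (hs : IsFrameOn D.space s U) :
    Pretrivialization (Fin k → ℝ) (π (Fin k → ℝ) D.Dual) where
  toFun p := (p.1, if h : p.1 ∈ U then hs.coord h p.2 else 0)
  invFun q := ⟨q.1, if h : q.1 ∈ U then (hs.coord h).symm q.2 else 0⟩
  source := π (Fin k → ℝ) D.Dual ⁻¹' U
  target := U ×ˢ univ
  map_source' p hp := ⟨hp, mem_univ _⟩
  map_target' q hq := hq.1
  left_inv' := by
    rintro ⟨x, e⟩ hx
    have hx' : x ∈ U := hx
    simp [hx']
  right_inv' := by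
    rintro ⟨x, v⟩ ⟨hx, -⟩
    have hx' : x ∈ U := hx
    simp [hx']
  open_target := hs.isOpen.prod isOpen_univ
  baseSet := U
  open_baseSet := hs.isOpen
  source_eq := rfl
  target_eq := rfl
  proj_toFun _ _ := rfl

theorem pretrivialization_apply (hs : IsFrameOn D.space s U) {x : N} (hx : x ∈ U) (e : D.Dual x) :
    hs.pretrivialization ⟨x, e⟩ = (x, hs.coord hx e) := by
  change (x, _) = (x, _)
  simp [hx]

theorem pretrivialization_linear (hs : IsFrameOn D.space s U) :
    hs.pretrivialization.IsLinear ℝ where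
  linear x hx := by
    have hx' : x ∈ U := hx
    simp only [hs.pretrivialization_apply hx']
    exact (hs.coord hx').toLinearMap.isLinear

theorem pretrivialization_symm (hs : IsFrameOn D.space s U) {x : N} (hx : x ∈ U)
    (v : Fin k → ℝ) : hs.pretrivialization.symm x v = (hs.coord hx).symm v := by
  apply (hs.coord hx).injective
  have h := hs.pretrivialization.apply_mk_symm (show x ∈ hs.pretrivialization.baseSet from hx) v
  rw [hs.pretrivialization_apply hx] at h
  rw [LinearEquiv.apply_symm_apply]
  exact (Prod.mk.inj h).2

/-- Change of coordinates between two local trivializations of the dual bundle. -/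
theorem exists_coordChange (hs : IsFrameOn D.space s U) (ht : IsFrameOn D.space t W) :
    ∃ f : N → (Fin k → ℝ) →L[ℝ] (Fin k → ℝ),
      ContMDiffOn I 𝓘(ℝ, (Fin k → ℝ) →L[ℝ] (Fin k → ℝ)) ∞ f (U ∩ W) ∧
      ∀ x ∈ U ∩ W, ∀ v,
        f x v = (ht.pretrivialization ⟨x, hs.pretrivialization.symm x v⟩).2 := by
  classical
  let c : Fin k → N → Fin k → ℝ := fun j x i =>
    if h : x ∈ U ∩ W then (hs.basis h.1).repr (ht.basis h.2 j) i else 0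
  have hc : ∀ j, ContMDiffOn I 𝓘(ℝ, Fin k → ℝ) ∞ (c j) (U ∩ W) := by
    intro j
    refine hs.contMDiffOn_coeff ht.isOpen (ht.smooth j) (c j) fun x hx => ?_
    have h := congrArg (Submodule.subtype _) ((hs.basis hx.1).sum_repr (ht.basis hx.2 j))
    rw [map_sum] at h
    simp only [map_smul, Submodule.subtype_apply, coe_basis] at h
    rw [← h]
    simp [c, hx.1, hx.2]
  refine ⟨fun x => ContinuousLinearMap.pi fun j => ∑ i, c j x i • ContinuousLinearMap.proj i,
    ?_, ?_⟩
  · let Φ : (Fin k → Fin k → ℝ) →ₗ[ℝ] ((Fin k → ℝ) →L[ℝ] (Fin k → ℝ)) :=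
      { toFun := fun a => ContinuousLinearMap.pi fun j =>
          ∑ i, a j i • (ContinuousLinearMap.proj i : (Fin k → ℝ) →L[ℝ] ℝ)
        map_add' := by
          intro a b; ext v j; simp [add_mul, Finset.sum_add_distrib]
        map_smul' := by
          intro a b; ext v j; simp [Finset.mul_sum, mul_assoc] }
    have h1 : ContMDiffOn I 𝓘(ℝ, Fin k → Fin k → ℝ) ∞ (fun x j => c j x) (U ∩ W) :=
      contMDiffOn_pi_space.2 hc
    exact (LinearMap.toContinuousLinearMap Φ).contMDiff.comp_contMDiffOn h1
  · intro x hx v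
    rw [ht.pretrivialization_apply hx.2, hs.pretrivialization_symm hx.1]
    ext j
    have hv : v = hs.coord hx.1 ((hs.coord hx.1).symm v) := (LinearEquiv.apply_symm_apply _ _).symm
    generalize (hs.coord hx.1).symm v = e at hv ⊢
    change _ = ht.coord hx.2 e j
    rw [coord_apply, ← (hs.basis hx.1).sum_repr (ht.basis hx.2 j), map_sum, hv]
    simp [c, hx.1, hx.2, coord_apply]

end IsFrameOn

namespace Subbundle

variable {k : ℕ} (D : Subbundle I N k)

/-- The local trivializations of the dual bundle, one for each smooth local frame of `D`. -/
def dualPrebundle : VectorPrebundle ℝ (Fin k → ℝ) D.Dual where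
  pretrivializationAtlas := {e | ∃ (U : Set N) (s : Fin k → ∀ x : N, TangentSpace I x)
    (hs : IsFrameOn D.space s U), e = hs.pretrivialization}
  pretrivialization_linear' := by
    rintro _ ⟨U, s, hs, rfl⟩
    exact hs.pretrivialization_linear
  pretrivializationAt x := (D.exists_frame x).choose_spec.choose_spec.2.pretrivialization
  mem_base_pretrivializationAt x := (D.exists_frame x).choose_spec.choose_spec.1
  pretrivialization_mem_atlas x := ⟨_, _, (D.exists_frame x).choose_spec.choose_spec.2, rfl⟩
  exists_coordChange := by
    rintro _ ⟨U, s, hs, rfl⟩ _ ⟨W, t, ht, rfl⟩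
    obtain ⟨f, hf, hf'⟩ := hs.exists_coordChange ht
    exact ⟨f, hf.continuousOn, hf'⟩
  totalSpaceMk_isInducing := by
    intro b
    have hb := (D.exists_frame b).choose_spec.choose_spec.1
    have hs := (D.exists_frame b).choose_spec.choose_spec.2
    have : (hs.pretrivialization ∘ TotalSpace.mk b) = fun e => (b, hs.coord hb e) :=
      funext fun e => hs.pretrivialization_apply hb e
    change IsInducing (hs.pretrivialization ∘ TotalSpace.mk b)
    rw [this]
    have : FiniteDimensional ℝ (D.Dual b) := Module.Finite.equiv (hs.coord hb).symm
    exact (isInducing_prodMkRight b).comp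
      (hs.coord hb).toContinuousLinearEquiv.toHomeomorph.isInducing

instance : D.dualPrebundle.IsContMDiff I ∞ where
  exists_contMDiffCoordChange := by
    rintro _ ⟨U, s, hs, rfl⟩ _ ⟨W, t, ht, rfl⟩
    exact hs.exists_coordChange ht

instance : TopologicalSpace (TotalSpace (Fin k → ℝ) D.Dual) := D.dualPrebundle.totalSpaceTopology

instance : FiberBundle (Fin k → ℝ) D.Dual := D.dualPrebundle.toFiberBundle

instance : VectorBundle ℝ (Fin k → ℝ) D.Dual := D.dualPrebundle.toVectorBundle

instance : ContMDiffVectorBundle ∞ (Fin k → ℝ) D.Dual I :=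
  D.dualPrebundle.contMDiffVectorBundle I

/-- The total space of the dual bundle `D*`, a manifold of dimension `dim N + k`. -/
abbrev DualTotal : Type _ := TotalSpace (Fin k → ℝ) D.Dual

end Subbundle

end Distribution

theorem surjective_pi_of_linearIndependent {m : ℕ} {V : Type*} [AddCommGroup V] [Module ℝ V]
    (g : Fin m → V →ₗ[ℝ] ℝ) (hg : LinearIndependent ℝ g) :
    Function.Surjective fun v j => g j v := by
  change Function.Surjective (LinearMap.pi g)
  rw [← LinearMap.range_eq_top]
  by_contra hne
  obtain ⟨f, hf0, hf⟩ := Submodule.exists_le_ker_of_lt_top _ (lt_top_iff_ne_top.2 hne)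
  apply hf0
  have h0 := Fintype.linearIndependent_iff.1 hg (fun j => f (Pi.single j 1)) (by
    ext v
    have h1 : f (LinearMap.pi g v) = 0 := hf ⟨v, rfl⟩
    rw [pi_eq_sum_univ' (LinearMap.pi g v), map_sum] at h1
    simpa [mul_comm, Pi.single_apply, ← Pi.single_apply] using h1)
  ext j
  simpa using h0 j

theorem exists_linearIndependent_mem {V : Type*} [AddCommGroup V] [Module ℝ V]
    (A : Submodule ℝ V) [FiniteDimensional ℝ A] :
    ∃ a : Fin (Module.finrank ℝ A) → V, LinearIndependent ℝ a ∧ ∀ j, a j ∈ A :=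
  ⟨fun j => Module.finBasis ℝ A j, (Module.finBasis ℝ A).linearIndependent.map' A.subtype
    (Submodule.ker_subtype _), fun j => (Module.finBasis ℝ A j).2⟩

section Dirac

variable {E H : Type*} [NormedAddCommGroup E] [NormedSpace ℝ E] [TopologicalSpace H]
  {I : ModelWithCorners ℝ E H} {N : Type*} [TopologicalSpace N] [ChartedSpace H N]

/-- The exterior derivative of a one-form on a manifold without boundary, computed in the preferred
chart at each point: `(dα)_p (X, Y) = X(α(Y)) - Y(α(X))` for the coordinate vector fields extending
`X` and `Y`. The two-form `dα` is given as the map `X ↦ dα(X, ·)`. -/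
def extDerivOneForm (α : ∀ p : N, Cotangent I p) (p : N) : TangentSpace I p →L[ℝ] Cotangent I p :=
  let φ := extChartAt I p
  let a : E → E →L[ℝ] ℝ := fun u => α (φ.symm u) ∘L mfderiv 𝓘(ℝ, E) I φ.symm u
  let A : E →L[ℝ] E →L[ℝ] ℝ := fderiv ℝ a (φ p)
  let dφ : TangentSpace I p →L[ℝ] E := mfderiv I 𝓘(ℝ, E) φ p
  ContinuousLinearMap.precomp ℝ dφ ∘L (A - A.flip) ∘L dφ

/-- The vector part of the Courant bracket of `X + ξ` and `Y + η`. -/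
def courantVector (X Y : ∀ p : N, TangentSpace I p) (p : N) : TangentSpace I p :=
  VectorField.mlieBracket I X Y p

/-- The covector part of the Courant bracket of `X + ξ` and `Y + η`, that is
`L_X η - L_Y ξ - ½ d(η(X) - ξ(Y))`, rewritten with Cartan's formula `L_X = ι_X d + d ι_X`. -/
def courantCovector (X : ∀ p : N, TangentSpace I p) (ξ : ∀ p : N, Cotangent I p)
    (Y : ∀ p : N, TangentSpace I p) (η : ∀ p : N, Cotangent I p) (p : N) : Cotangent I p :=
  extDerivOneForm η p (X p) - extDerivOneForm ξ p (Y p) +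
    (1 / 2 : ℝ) • (show Cotangent I p from mfderiv I 𝓘(ℝ, ℝ) (fun q => η q (X q) - ξ q (Y q)) p)

variable (I N) in
/-- A Dirac structure: a smooth maximal isotropic subbundle of `TN ⊕ T*N` (smooth means that every
element extends to a smooth local section) whose sections are closed under the Courant bracket. -/
structure DiracStructure [IsManifold I ∞ N] where
  /-- The fibres. -/
  fiber : ∀ p : N, Submodule ℝ (Pontryagin I p)
  isotropic : ∀ p, ∀ u ∈ fiber p, ∀ v ∈ fiber p, u.2 v.1 + v.2 u.1 = 0
  finrank_eq : ∀ p, Module.finrank ℝ (fiber p) = Module.finrank ℝ E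
  smooth : ∀ p₀, ∀ u ∈ fiber p₀, ∃ (U : Set N) (X : ∀ p : N, TangentSpace I p)
    (ξ : ∀ p : N, Cotangent I p), IsOpen U ∧ p₀ ∈ U ∧ SmoothVectorFieldOn I X U ∧
      SmoothOneFormOn I ξ U ∧ (∀ p ∈ U, (X p, ξ p) ∈ fiber p) ∧ (X p₀, ξ p₀) = u
  integrable : ∀ (U : Set N) (X : ∀ p : N, TangentSpace I p) (ξ : ∀ p : N, Cotangent I p)
    (Y : ∀ p : N, TangentSpace I p) (η : ∀ p : N, Cotangent I p), IsOpen U →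
      SmoothVectorFieldOn I X U → SmoothOneFormOn I ξ U → (∀ p ∈ U, (X p, ξ p) ∈ fiber p) →
      SmoothVectorFieldOn I Y U → SmoothOneFormOn I η U → (∀ p ∈ U, (Y p, η p) ∈ fiber p) →
      ∀ p ∈ U, (courantVector X Y p, courantCovector X ξ Y η p) ∈ fiber p

/-- The fibre at `x` of the characteristic distribution `L ∩ TN`. -/
def DiracStructure.char [IsManifold I ∞ N] (L : DiracStructure I N) (x : N) :
    Submodule ℝ (TangentSpace I x) :=
  (L.fiber x).comap (LinearMap.inl ℝ (TangentSpace I x) (Cotangent I x))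

section Frame

variable [IsManifold I ∞ N] [FiniteDimensional ℝ E]

set_option maxHeartbeats 1000000 in
/-- A family of subspaces of constant dimension `k` which is annihilated by `dim N - k` independent
smooth one-forms has smooth local frames. -/
theorem exists_isFrameOn_of_forms {D : ∀ x : N, Submodule ℝ (TangentSpace I x)} {k m : ℕ}
    (hk : ∀ x, Module.finrank ℝ (D x) = k) (hkm : m + k = Module.finrank ℝ E) (b : N)
    {U : Set N} (hUo : IsOpen U) (hbU : b ∈ U) (ξ : Fin m → ∀ p : N, Cotangent I p)
    (hξ : ∀ j, SmoothOneFormOn I (ξ j) U) (hvan : ∀ j, ∀ x ∈ U, ∀ v ∈ D x, ξ j x v = 0)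
    (hli : LinearIndependent ℝ fun j => ξ j b) :
    ∃ W : Set N, ∃ s : Fin k → ∀ x : N, TangentSpace I x, b ∈ W ∧ IsFrameOn D s W := by
  classical
  let e := trivializationAt E (TangentSpace I) b
  have hbe : b ∈ e.baseSet := mem_baseSet_trivializationAt E (TangentSpace I) b
  let W : Set N := e.baseSet ∩ U
  have hWo : IsOpen W := e.open_baseSet.inter hUo
  have hbW : b ∈ W := ⟨hbe, hbU⟩
  let ζ : Fin m → N → E →L[ℝ] ℝ := fun j x =>
    (trivializationAt (E →L[ℝ] ℝ) (fun x : N => TangentSpace I x →L[ℝ] ℝ) b ⟨x, ξ j x⟩).2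
  have hζ : ∀ j, ContMDiffOn I 𝓘(ℝ, E →L[ℝ] ℝ) ∞ (ζ j) W := by
    intro j
    refine (Trivialization.contMDiffOn_section_iff (IB := I) (n := ∞)
      (trivializationAt (E →L[ℝ] ℝ) (fun x : N => TangentSpace I x →L[ℝ] ℝ) b) hWo ?_).1
      ((hξ j).mono inter_subset_right)
    intro x hx
    exact ⟨hx.1, mem_univ _⟩
  have hζapp : ∀ j, ∀ x (hx : x ∈ e.baseSet) (v : E),
      ζ j x v = ξ j x ((e.linearEquivAt ℝ x hx).symm v) := by
    intro j x hx v
    change ContinuousLinearMap.inCoordinates E (TangentSpace I) ℝ (Bundle.Trivial N ℝ) b x b x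
      (ξ j x) v = _
    simp only [ContinuousLinearMap.inCoordinates, ContinuousLinearMap.comp_apply]
    have h : e.symmL ℝ x v = (e.linearEquivAt ℝ x hx).symm v := by
      rw [e.symmL_apply hx]; rfl
    change (Trivialization.continuousLinearMapAt ℝ (trivializationAt ℝ (Bundle.Trivial N ℝ) b) x)
      (ξ j x (e.symmL ℝ x v)) = _
    rw [h]
    simp
  let Φ : (Fin m → E →L[ℝ] ℝ) →ₗ[ℝ] (E →L[ℝ] (Fin m → ℝ)) :=
    { toFun := fun g => ContinuousLinearMap.pi g
      map_add' := fun _ _ => rfl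
      map_smul' := fun _ _ => rfl }
  let Ξ : N → E →L[ℝ] (Fin m → ℝ) := fun x => LinearMap.toContinuousLinearMap Φ fun j => ζ j x
  have hΞ : ContMDiffOn I 𝓘(ℝ, E →L[ℝ] (Fin m → ℝ)) ∞ Ξ W :=
    (ContinuousLinearMap.contMDiff _).comp_contMDiffOn (contMDiffOn_pi_space.2 hζ)
  have hΞapp : ∀ x v j, Ξ x v j = ζ j x v := fun _ _ _ => rfl
  have hker : ∀ x (hx : x ∈ e.baseSet), x ∈ W → ∀ v ∈ D x,
      Ξ x (e.linearEquivAt ℝ x hx v) = 0 := by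
    intro x hx hxW v hv
    ext j
    rw [hΞapp, hζapp j x hx, LinearEquiv.symm_apply_apply]
    exact hvan j x hxW.2 v hv
  have hsurj : Function.Surjective (Ξ b) := by
    refine surjective_pi_of_linearIndependent (fun j => (ζ j b : E →ₗ[ℝ] ℝ)) ?_
    rw [Fintype.linearIndependent_iff]
    intro c hc
    refine Fintype.linearIndependent_iff.1 hli c (ContinuousLinearMap.ext fun v => ?_)
    have h1 := LinearMap.congr_fun hc (e.linearEquivAt ℝ b hbe v)
    have h2 : ∀ j, ζ j b (e.linearEquivAt ℝ b hbe v) = ξ j b v := by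
      intro j; rw [hζapp j b hbe, LinearEquiv.symm_apply_apply]
    rw [LinearMap.sum_apply] at h1
    rw [sum_apply]
    refine Eq.trans (Finset.sum_congr rfl fun j _ => ?_) h1
    change c j * ξ j b v = c j * ζ j b _
    rw [h2]
  obtain ⟨R₀, hR₀⟩ := LinearMap.exists_rightInverse_of_surjective
    (Ξ b : E →ₗ[ℝ] (Fin m → ℝ)) (LinearMap.range_eq_top.2 hsurj)
  let R : (Fin m → ℝ) →L[ℝ] E := LinearMap.toContinuousLinearMap R₀
  let Q : N → (Fin m → ℝ) →L[ℝ] (Fin m → ℝ) := fun x => Ξ x ∘L R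
  have hQ : ContMDiffOn I 𝓘(ℝ, (Fin m → ℝ) →L[ℝ] (Fin m → ℝ)) ∞ Q W :=
    hΞ.clm_comp contMDiffOn_const
  have hQb : Q b = 1 := ContinuousLinearMap.ext fun v => LinearMap.congr_fun hR₀ v
  have hkerdim : ∀ x, Function.Surjective (Ξ x) →
      Module.finrank ℝ (LinearMap.ker (Ξ x : E →ₗ[ℝ] (Fin m → ℝ))) = k := by
    intro x hx
    have h1 := LinearMap.finrank_range_add_finrank_ker (Ξ x : E →ₗ[ℝ] (Fin m → ℝ))
    rw [LinearMap.range_eq_top.2 hx, finrank_top, Module.finrank_fin_fun] at h1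
    omega
  let u : Module.Basis (Fin k) ℝ (LinearMap.ker (Ξ b : E →ₗ[ℝ] (Fin m → ℝ))) :=
    Module.finBasisOfFinrankEq ℝ _ (hkerdim b hsurj)
  let σ : Fin k → N → E := fun i x => (u i : E) - R (Ring.inverse (Q x) (Ξ x (u i)))
  let W₁ : Set N := W ∩ Q ⁻¹' {A | IsUnit A}
  have hW₁o : IsOpen W₁ := hQ.continuousOn.isOpen_inter_preimage hWo Units.isOpen
  have hbW₁ : b ∈ W₁ := ⟨hbW, by change IsUnit (Q b); rw [hQb]; exact isUnit_one⟩
  have hσ : ∀ i, ContMDiffOn I 𝓘(ℝ, E) ∞ (σ i) W₁ := by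
    intro i x hx
    have hinv : ContMDiffWithinAt I 𝓘(ℝ, (Fin m → ℝ) →L[ℝ] (Fin m → ℝ)) ∞
        (fun x => Ring.inverse (Q x)) W₁ x := by
      obtain ⟨q, hq⟩ := hx.2
      have h : ContDiffAt ℝ ∞ Ring.inverse (Q x) := by
        rw [← hq]; exact contDiffAt_ringInverse ℝ q
      exact h.contMDiffAt.comp_contMDiffWithinAt x ((hQ x hx.1).mono inter_subset_left)
    exact contMDiffWithinAt_const.sub (contMDiffWithinAt_const.clm_apply
      (hinv.clm_apply (((hΞ x hx.1).mono inter_subset_left).clm_apply contMDiffWithinAt_const)))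
  have hσker : ∀ i, ∀ x ∈ W₁, Ξ x (σ i x) = 0 := by
    intro i x hx
    have h := DFunLike.congr_fun (Ring.mul_inverse_cancel (Q x) hx.2) (Ξ x (u i))
    have h' : Ξ x (R (Ring.inverse (Q x) (Ξ x (u i)))) = Ξ x (u i) := h
    simp only [σ, map_sub, h', sub_self]
  have hσb : ∀ i, σ i b = u i := by
    intro i
    have : Ξ b (u i) = 0 := (u i).2
    simp [σ, this]
  let W₂ : Set N := W₁ ∩ (fun x i => σ i x) ⁻¹' {f : Fin k → E | LinearIndependent ℝ f}
  have hW₂o : IsOpen W₂ :=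
    (continuousOn_pi.2 fun i => (hσ i).continuousOn).isOpen_inter_preimage hW₁o
      isOpen_setOfPred_linearIndependent
  have hbW₂ : b ∈ W₂ := by
    refine ⟨hbW₁, ?_⟩
    change LinearIndependent ℝ fun i => σ i b
    simp only [hσb]
    exact u.linearIndependent.map' (Submodule.subtype _) (Submodule.ker_subtype _)
  refine ⟨W₂, fun i x => if hx : x ∈ e.baseSet then (e.linearEquivAt ℝ x hx).symm (σ i x) else 0,
    hbW₂, hW₂o, ?_, ?_, ?_⟩
  · intro i
    refine (Trivialization.contMDiffOn_section_iff (IB := I) (n := ∞) e hW₂o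
      fun x hx => hx.1.1.1).2 (((hσ i).mono inter_subset_left).congr ?_)
    intro x hx
    simp only [dif_pos (show x ∈ e.baseSet from hx.1.1.1)]
    exact (e.linearEquivAt ℝ x hx.1.1.1).apply_symm_apply (σ i x)
  · intro x hx
    have hxe : x ∈ e.baseSet := hx.1.1.1
    simp only [dif_pos hxe]
    exact hx.2.map' ((e.linearEquivAt ℝ x hxe).symm : E →ₗ[ℝ] TangentSpace I x)
      (LinearEquiv.ker _)
  · intro x hx
    have hxe : x ∈ e.baseSet := hx.1.1.1
    simp only [dif_pos hxe]
    have hxsurj : Function.Surjective (Ξ x) := by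
      intro y
      have h := DFunLike.congr_fun (Ring.mul_inverse_cancel (Q x) hx.1.2) y
      exact ⟨R (Ring.inverse (Q x) y), h⟩
    let K := LinearMap.ker (Ξ x : E →ₗ[ℝ] (Fin m → ℝ))
    have h1 : (D x).map ((e.linearEquivAt ℝ x hxe : TangentSpace I x ≃ₗ[ℝ] E) :
        TangentSpace I x →ₗ[ℝ] E) = K := by
      apply Submodule.eq_of_le_of_finrank_eq
      · rintro _ ⟨v, hv, rfl⟩
        exact hker x hxe hx.1.1 v hv
      · rw [LinearEquiv.finrank_map_eq, hk x, hkerdim x hxsurj]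
    have h2 : Submodule.span ℝ (range fun i => σ i x) = K := by
      apply Submodule.eq_of_le_of_finrank_eq
      · rw [Submodule.span_le]
        rintro _ ⟨i, rfl⟩
        exact hσker i x hx.1
      · rw [finrank_span_eq_card hx.2, hkerdim x hxsurj, Fintype.card_fin]
    rw [← h2] at h1
    have h3 : (D x) = (Submodule.span ℝ (range fun i => σ i x)).map
        ((e.linearEquivAt ℝ x hxe).symm : E →ₗ[ℝ] TangentSpace I x) := by
      rw [← h1, ← Submodule.map_comp]
      ext v
      simp
    rw [h3, Submodule.map_span, ← range_comp]
    rfl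

/-- If `L ∩ TN` has constant rank `k`, then it has smooth local frames. -/
theorem DiracStructure.exists_frame (L : DiracStructure I N) {k : ℕ}
    (hk : ∀ x, Module.finrank ℝ (L.char x) = k) (x₀ : N) :
    ∃ U : Set N, ∃ s : Fin k → ∀ x : N, TangentSpace I x, x₀ ∈ U ∧ IsFrameOn L.char s U := by
  classical
  let b := x₀
  -- covectors spanning the projection of `L` to the cotangent space at `b`
  let A : Submodule ℝ (Cotangent I b) := (L.fiber b).map (LinearMap.snd ℝ _ _)
  let m := Module.finrank ℝ A
  have hkm : m + k = Module.finrank ℝ E := by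
    let f : L.fiber b →ₗ[ℝ] Cotangent I b := (LinearMap.snd ℝ _ _).domRestrict (L.fiber b)
    have h1 := LinearMap.finrank_range_add_finrank_ker (K := ℝ) (V := L.fiber b) f
    have h2 : LinearMap.range f = A := LinearMap.range_domRestrict _ _
    have h3 : Module.finrank ℝ (LinearMap.ker f) = k := by
      rw [← hk b]
      refine (LinearEquiv.finrank_eq (LinearEquiv.ofBijective
        (LinearMap.codRestrict (LinearMap.ker f)
          (LinearMap.codRestrict (L.fiber b)
            (LinearMap.inl ℝ (TangentSpace I b) (Cotangent I b) ∘ₗ (L.char b).subtype)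
            (fun v => v.2)) (fun v => rfl)) ⟨?_, ?_⟩)).symm
      · intro v w h
        have := congrArg (fun z => (z.1.1.1 : TangentSpace I b)) h
        exact Subtype.ext this
      · rintro ⟨⟨⟨X, ξ⟩, hX⟩, h0⟩
        have h0' : ξ = 0 := h0
        subst h0'
        exact ⟨⟨X, hX⟩, rfl⟩
    rw [h2, h3, L.finrank_eq] at h1
    exact h1
  obtain ⟨a, hali, haA⟩ := exists_linearIndependent_mem A
  have hlift : ∀ j, ∃ (U : Set N) (X : ∀ p : N, TangentSpace I p)
      (ξ : ∀ p : N, Cotangent I p), IsOpen U ∧ b ∈ U ∧ SmoothVectorFieldOn I X U ∧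
      SmoothOneFormOn I ξ U ∧ (∀ p ∈ U, (X p, ξ p) ∈ L.fiber p) ∧ ξ b = a j := by
    intro j
    obtain ⟨u, hu, huj⟩ := haA j
    obtain ⟨U, X, ξ, h1, h2, h3, h4, h5, h6⟩ := L.smooth b u hu
    refine ⟨U, X, ξ, h1, h2, h3, h4, h5, ?_⟩
    rw [← huj, ← h6]; rfl
  choose U X ξ hUo hbU hX hξ hmem hξa using hlift
  refine exists_isFrameOn_of_forms hk hkm b (U := ⋂ j, U j) (isOpen_iInter_of_finite hUo)
    (mem_iInter.2 hbU) ξ (fun j => (hξ j).mono (iInter_subset U j)) ?_ ?_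
  · intro j x hx v hv
    have h := L.isotropic x (v, 0) hv _ (hmem j x (mem_iInter.1 hx j))
    simpa using h
  · rw [funext hξa]
    exact hali

end Frame

end Dirac

section Poisson

variable {E H : Type*} [NormedAddCommGroup E] [NormedSpace ℝ E] [TopologicalSpace H]
  {I : ModelWithCorners ℝ E H} {N : Type*} [TopologicalSpace N] [ChartedSpace H N]
  {E' H' : Type*} [NormedAddCommGroup E'] [NormedSpace ℝ E'] [TopologicalSpace H']
  {I' : ModelWithCorners ℝ E' H'} {N' : Type*} [TopologicalSpace N'] [ChartedSpace H' N']

/-- The differential of a real function, as a one-form. -/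
def differential (f : N → ℝ) (p : N) : Cotangent I p := mfderiv I 𝓘(ℝ, ℝ) f p

/-- The bracket `{f, g} = Π(df, dg) = dg(♯ df)`, where the bivector field `Π` is given by its sharp
map `♯ : T*N → TN`. -/
def poissonBracket (P : ∀ p : N, Cotangent I p →L[ℝ] TangentSpace I p) (f g : N → ℝ) (p : N) : ℝ :=
  differential (I := I) g p (P p (differential f p))

/-- `P`, the sharp map of a bivector field, is a Poisson structure on the open set `U`: it is
skew-symmetric and smooth, and its bracket of functions satisfies the Jacobi identity. -/
structure IsPoissonOn [IsManifold I ∞ N] (P : ∀ p : N, Cotangent I p →L[ℝ] TangentSpace I p)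
    (U : Set N) : Prop where
  isOpen : IsOpen U
  skew : ∀ p ∈ U, ∀ ξ η : Cotangent I p, η (P p ξ) = -ξ (P p η)
  smooth : ContMDiffOn I (I.prod 𝓘(ℝ, (E →L[ℝ] ℝ) →L[ℝ] E)) ∞
    (fun p => TotalSpace.mk' ((E →L[ℝ] ℝ) →L[ℝ] E) p (P p)) U
  jacobi : ∀ f g h : N → ℝ, ContMDiffOn I 𝓘(ℝ, ℝ) ∞ f U → ContMDiffOn I 𝓘(ℝ, ℝ) ∞ g U →
    ContMDiffOn I 𝓘(ℝ, ℝ) ∞ h U → ∀ p ∈ U,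
      poissonBracket P f (poissonBracket P g h) p + poissonBracket P g (poissonBracket P h f) p +
        poissonBracket P h (poissonBracket P f g) p = 0

/-- The graph `{(♯ξ, ξ)}` of a bivector. -/
def bivectorGraph (P : ∀ p : N, Cotangent I p →L[ℝ] TangentSpace I p) (p : N) :
    Submodule ℝ (Pontryagin I p) :=
  LinearMap.range ((P p : Cotangent I p →ₗ[ℝ] TangentSpace I p).prod LinearMap.id)

/-- The pullback `f^*L = {(X, f^*η) : (f_* X, η) ∈ L}` of a field of subspaces of `TN' ⊕ T*N'`. -/
def pullbackDirac (f : N → N') (L : ∀ q : N', Submodule ℝ (Pontryagin I' q)) (p : N) :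
    Submodule ℝ (Pontryagin I p) where
  carrier := {u | ∃ η : Cotangent I' (f p),
    (mfderiv I I' f p u.1, η) ∈ L (f p) ∧ u.2 = η ∘L mfderiv I I' f p}
  zero_mem' := by
    refine ⟨0, ?_, ?_⟩
    · rw [Prod.fst_zero, map_zero]; exact (L (f p)).zero_mem
    · rw [ContinuousLinearMap.zero_comp]; rfl
  add_mem' := by
    rintro u v ⟨η, hη, hu⟩ ⟨ζ, hζ, hv⟩
    refine ⟨η + ζ, ?_, ?_⟩
    · simpa using (L (f p)).add_mem hη hζ
    · rw [ContinuousLinearMap.add_comp, ← hu, ← hv]; rfl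
  smul_mem' := by
    rintro c u ⟨η, hη, hu⟩
    refine ⟨c • η, ?_, ?_⟩
    · simpa using (L (f p)).smul_mem c hη
    · rw [ContinuousLinearMap.smul_comp, ← hu]; rfl

/-- The pullback of a two-form, where a two-form `B` is given as the map `X ↦ B(X, ·)`. -/
def pullbackTwoForm (f : N → N') (B : ∀ q : N', TangentSpace I' q →L[ℝ] Cotangent I' q) (p : N) :
    TangentSpace I p →L[ℝ] Cotangent I p :=
  ContinuousLinearMap.precomp ℝ (mfderiv I I' f p) ∘L B (f p) ∘L mfderiv I I' f p

/-- The gauge transformation `τ_B L = {(X, ξ + B(X, ·)) : (X, ξ) ∈ L}`. -/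
def gaugeTransform (B : ∀ p : N, TangentSpace I p →L[ℝ] Cotangent I p)
    (L : ∀ p : N, Submodule ℝ (Pontryagin I p)) (p : N) : Submodule ℝ (Pontryagin I p) :=
  (L p).map ((LinearMap.fst ℝ (TangentSpace I p) (Cotangent I p)).prod
    (LinearMap.snd ℝ (TangentSpace I p) (Cotangent I p) +
      (B p : TangentSpace I p →ₗ[ℝ] Cotangent I p) ∘ₗ LinearMap.fst ℝ _ _))

/-- The map `i` embeds the manifold `N`, equipped with the field of subspaces `L` of `TN ⊕ T*N`,
coisotropically in the Poisson manifold `(U, P)`: it is a smooth embedding into `U`, its image is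
coisotropic, and `L` is the pullback of the graph of `P`. -/
structure IsCoisotropicEmbedding (i : N → N') (L : ∀ p : N, Submodule ℝ (Pontryagin I p))
    (P : ∀ q : N', Cotangent I' q →L[ℝ] TangentSpace I' q) (U : Set N') : Prop where
  isSmoothEmbedding : IsSmoothEmbedding I I' ∞ i
  mapsTo : ∀ x, i x ∈ U
  coisotropic : ∀ x, ∀ ξ : Cotangent I' (i x), (∀ v, ξ (mfderiv I I' i x v) = 0) →
    ∃ w, mfderiv I I' i x w = P (i x) ξ
  pullback_eq : ∀ x, pullbackDirac (I := I) i (bivectorGraph P) x = L x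

variable (I N) in
/-- The cotangent bundle `T*N`. -/
abbrev CotangentBundle : Type _ :=
  TotalSpace (E →L[ℝ] ℝ) fun x : N => TangentSpace I x →L[ℝ] ℝ

/-- The canonical one-form of `T*N`: its value on `w ∈ T_η(T*N)` is `η(π_* w)`. -/
def canonicalOneForm [IsManifold I ∞ N] (η : CotangentBundle I N) :
    Cotangent (I.prod 𝓘(ℝ, E →L[ℝ] ℝ)) η :=
  η.2 ∘L mfderiv (I.prod 𝓘(ℝ, E →L[ℝ] ℝ)) I (fun ζ : CotangentBundle I N => ζ.proj) η

/-- The canonical symplectic form of `T*N`. -/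
def canonicalTwoForm [IsManifold I ∞ N] (η : CotangentBundle I N) :
    TangentSpace (I.prod 𝓘(ℝ, E →L[ℝ] ℝ)) η →L[ℝ] Cotangent (I.prod 𝓘(ℝ, E →L[ℝ] ℝ)) η :=
  extDerivOneForm (fun ζ : CotangentBundle I N => canonicalOneForm ζ) η

end Poisson

section Construction

variable {E H : Type*} [NormedAddCommGroup E] [NormedSpace ℝ E] [FiniteDimensional ℝ E]
  [TopologicalSpace H] {I : ModelWithCorners ℝ E H} {N : Type*} [TopologicalSpace N]
  [ChartedSpace H N] [IsManifold I ∞ N] {k : ℕ}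

/-- A splitting `TN = D ⊕ V`: a smooth distribution `V` complementary to `D`. -/
structure Splitting (D : Subbundle I N k) where
  /-- The fibres of `V`. -/
  space : ∀ x : N, Submodule ℝ (TangentSpace I x)
  isCompl : ∀ x, IsCompl (D.space x) (space x)
  smooth : IsSmoothDistribution space

/-- The projection `TN → D` along `V`. -/
def Splitting.proj {D : Subbundle I N k} (V : Splitting D) (x : N) :
    TangentSpace I x →L[ℝ] D.space x :=
  LinearMap.toContinuousLinearMap ((D.space x).projectionOnto (V.space x) (V.isCompl x))

/-- The embedding `D* → T*N` which extends a linear form on `D` by zero on `V`. -/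
def Splitting.embed {D : Subbundle I N k} (V : Splitting D) (e : D.DualTotal) :
    CotangentBundle I N :=
  ⟨e.proj, e.2.form ∘L V.proj e.proj⟩

/-- The characteristic distribution `L ∩ TN` of a Dirac structure, when it has constant rank. -/
def DiracStructure.charBundle (L : DiracStructure I N)
    (hk : ∀ x, Module.finrank ℝ (L.char x) = k) : Subbundle I N k where
  space := L.char
  exists_frame := L.exists_frame hk

/-- The Dirac structure `τ_B (π^*L)` on the total space of `π : E* → N`, where `E = L ∩ TN` and
`B` is the pullback of the canonical symplectic form under the embedding `E* → T*N` given by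
`V`. -/
def Splitting.dirac {L : DiracStructure I N} {hk : ∀ x, Module.finrank ℝ (L.char x) = k}
    (V : Splitting (L.charBundle hk)) (e : (L.charBundle hk).DualTotal) :
    Submodule ℝ (Pontryagin (I.prod 𝓘(ℝ, Fin k → ℝ)) e) :=
  gaugeTransform (pullbackTwoForm V.embed fun η : CotangentBundle I N => canonicalTwoForm η)
    (pullbackDirac (fun e : (L.charBundle hk).DualTotal => e.proj) L.fiber) e

/-- `U` is an open neighbourhood of the zero section of `E*` on which the Dirac structure given by
`V` is the graph of the Poisson structure `P`. -/
structure Splitting.IsPoissonNeighborhood {L : DiracStructure I N}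
    {hk : ∀ x, Module.finrank ℝ (L.char x) = k} (V : Splitting (L.charBundle hk))
    (U : Set (L.charBundle hk).DualTotal)
    (P : ∀ e : (L.charBundle hk).DualTotal, Cotangent (I.prod 𝓘(ℝ, Fin k → ℝ)) e →L[ℝ]
      TangentSpace (I.prod 𝓘(ℝ, Fin k → ℝ)) e) : Prop where
  zero_mem : ∀ x, zeroSection (Fin k → ℝ) (L.charBundle hk).Dual x ∈ U
  isPoissonOn : IsPoissonOn P U
  graph_eq : ∀ e ∈ U, bivectorGraph P e = V.dirac e

end Construction

end DiracGeometry

end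

open DiracGeometry

set_option synthInstance.maxHeartbeats 200000
set_option maxHeartbeats 1000000

noncomputable section

/-! Splittings exist because the linear projections of a tangent space onto the characteristic
subspace form a convex set. Local smooth projections therefore glue by a partition of unity, and the
kernel of the glued projection is a complement (`Subbundle.exists_splitting`).

The Poisson structure is found in a bundle chart `E × ℝ^k`. There the pullback of the canonical
one-form is `θ(x,y)(X) = Θ x y X.1`, where `Θ x y` extends the linear form with coordinates `y` by
zero on the splitting (`Splitting.exists_isThetaOn`,
`Splitting.IsThetaOn.pullback_canonicalTwoForm`). The field of subspaces becomes the relation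
`LiftRel`: `(X, ζ)` belongs to it when `(X.1, η) ∈ L` and `ζ = η ∘ fst + dθ(X, ·)`. At `y = 0` the
form `dθ` is the pairing of fibre directions with base directions, and this pairing is perfect
between the fibre and `L ∩ TM`. Hence the relation contains no nonzero `(X, 0)` there
(`IsPerfect.transverse`). Transversality is an open condition, and a maximal isotropic family
transverse to the tangent spaces is the graph of a smooth bivector (`exists_smooth_sharp`). Its
Jacobi identity is the sum of two facts: the integrability of `L` and `d(dθ) = 0`
(`jacobi_of_liftRel`). The same pairing shows that the zero section is coisotropic and that the
graph pulls back to `L` (`IsPerfect.snd_eq_zero`, `LiftRel.zero_iff`).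

Two splittings are compared by Moser's method. Their primitives differ by `b = θ₁ - θ₀`, which
vanishes on the zero section. The structures gauged by `d(θ₀ + t b)` stay transverse along the zero
section because `Θ₀` and `Θ₁` agree on `L ∩ TM`. If `P_t` is the resulting bivector, then the flow
of `-P_t b` carries `P_0` to `P_1` (`moser_identity`, `eq_of_transport`, `exists_local_moser`).
Points of the zero section are stationary, so the flow reaches time one near each of them. Its
smoothness and variational equation come from the inverse function theorem on the Banach space of
paths (`exists_local_flow`).

The local time-one maps are globalized through their integral curves, which have a chart-free
description (`IsMoserCurve`). Uniqueness of these curves glues the maps (`exists_neighborhood_map`).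
Reversing a curve exchanges the splittings, so the glued map for the exchanged pair is the inverse
(`exists_partialDiffeomorph`). -/

namespace DiracGeometry

/-! ### Smoothness of superposition operators on the Banach space of paths. -/

section Superposition

universe u

variable {F G : Type u} [NormedAddCommGroup F] [NormedSpace ℝ F]
  [NormedAddCommGroup G] [NormedSpace ℝ G]

/-- The superposition operator `γ ↦ (s ↦ f (s, γ s))`. -/
def superposition (f : C(ℝ × F, G)) (γ : C(unitInterval, F)) : C(unitInterval, G) :=
  f.comp ⟨fun s => ((s : ℝ), γ s), by fun_prop⟩

theorem superposition_apply (f : C(ℝ × F, G)) (γ : C(unitInterval, F)) (s : unitInterval) :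
    superposition f γ s = f (s, γ s) := rfl

theorem continuous_superposition (f : C(ℝ × F, G)) : Continuous (superposition f) := by
  refine ContinuousMap.continuous_of_continuous_uncurry _ ?_
  change Continuous fun p : C(unitInterval, F) × unitInterval => f ((p.2 : ℝ), p.1 p.2)
  fun_prop

instance : NormedAddCommGroup C(unitInterval, F →L[ℝ] G) :=
  ContinuousMap.instNormedAddCommGroup

instance : NormedSpace ℝ C(unitInterval, F →L[ℝ] G) :=
  ContinuousMap.normedSpace

variable (F G) in
/-- Pointwise application of a path of operators to a path, as a bilinear map. -/
def applyPathₗ : C(unitInterval, F →L[ℝ] G) →ₗ[ℝ] C(unitInterval, F) →ₗ[ℝ] C(unitInterval, G) :=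
  LinearMap.mk₂ ℝ (fun A h => ⟨fun s => A s (h s), by fun_prop⟩)
    (by intros; ext s; simp) (by intros; ext s; simp) (by intros; ext s; simp)
    (by intros; ext s; simp)

variable (F G) in
/-- Pointwise application of a path of operators to a path. -/
def applyPath : C(unitInterval, F →L[ℝ] G) →L[ℝ] C(unitInterval, F) →L[ℝ] C(unitInterval, G) :=
  LinearMap.mkContinuous₂ (applyPathₗ F G) 1 (by
    intro A h
    rw [one_mul, ContinuousMap.norm_le _ (by positivity)]
    intro s
    exact ((A s).le_opNorm _).trans
      (mul_le_mul (A.norm_coe_le_norm s) (h.norm_coe_le_norm s) (norm_nonneg _) (norm_nonneg _)))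

@[simp] theorem applyPath_apply (A : C(unitInterval, F →L[ℝ] G)) (h : C(unitInterval, F))
    (s : unitInterval) : applyPath F G A h s = A s (h s) := rfl

/-- The derivative in the second variable. -/
def sndDeriv (f : C(ℝ × F, G)) (hf : ContDiff ℝ ∞ f) : C(ℝ × F, F →L[ℝ] G) :=
  ⟨fun p => (fderiv ℝ f p).comp (.inr ℝ ℝ F),
    (hf.continuous_fderiv (by simp)).clm_comp continuous_const⟩

theorem sndDeriv_apply (f : C(ℝ × F, G)) (hf : ContDiff ℝ ∞ f) (p : ℝ × F) :
    sndDeriv f hf p = (fderiv ℝ f p).comp (.inr ℝ ℝ F) := rfl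

theorem contDiff_sndDeriv (f : C(ℝ × F, G)) (hf : ContDiff ℝ ∞ f) :
    ContDiff ℝ ∞ (sndDeriv f hf) :=
  (hf.fderiv_right (m := ∞) (by simp)).clm_comp contDiff_const

theorem hasFDerivAt_sndDeriv (f : C(ℝ × F, G)) (hf : ContDiff ℝ ∞ f) (t : ℝ) (x : F) :
    HasFDerivAt (fun y => f (t, y)) (sndDeriv f hf (t, x)) x :=
  ((hf.differentiable (by simp)) (t, x)).hasFDerivAt.comp x (hasFDerivAt_prodMk_right t x)

/-- The mean value inequality is applied at each time `s`. The radius on which the derivative varies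
by less than `ε` is uniform in `s`, because superposition with `sndDeriv` is continuous for the sup
norm. -/
theorem hasFDerivAt_superposition (f : C(ℝ × F, G)) (hf : ContDiff ℝ ∞ f)
    (γ : C(unitInterval, F)) :
    HasFDerivAt (superposition f) (applyPath F G (superposition (sndDeriv f hf) γ)) γ := by
  rw [hasFDerivAt_iff_isLittleO_nhds_zero, Asymptotics.isLittleO_iff]
  intro ε hε
  have hc := (continuous_superposition (sndDeriv f hf)).continuousAt (x := γ)
  rw [Metric.continuousAt_iff] at hc
  obtain ⟨δ, hδ, hc⟩ := hc ε hε
  filter_upwards [Metric.ball_mem_nhds (0 : C(unitInterval, F)) hδ] with h hh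
  rw [mem_ball_zero_iff] at hh
  rw [ContinuousMap.norm_le _ (by positivity)]
  intro s
  have hs : ‖h s‖ < δ := (h.norm_coe_le_norm s).trans_lt hh
  have key := (convex_ball (γ s) δ).norm_image_sub_le_of_norm_hasFDerivWithin_le'
    (f := fun y => f ((s : ℝ), y)) (f' := fun y => sndDeriv f hf (s, y))
    (φ := sndDeriv f hf (s, γ s)) (C := ε)
    (fun y _ => (hasFDerivAt_sndDeriv f hf s y).hasFDerivWithinAt) (by
      intro y hy
      -- Shifting the whole path by the constant `y - γ s` turns the pointwise condition at `s` into
      -- a sup-norm condition on paths.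
      have h1 := @hc (γ + ContinuousMap.const _ (y - γ s)) (by
        rw [dist_eq_norm, add_sub_cancel_left]
        refine lt_of_le_of_lt ?_ (mem_ball_iff_norm.1 hy)
        rw [ContinuousMap.norm_le _ (by positivity)]
        intro _; exact le_rfl)
      have h2 := (ContinuousMap.dist_apply_le_dist (f := superposition (sndDeriv f hf)
        (γ + ContinuousMap.const _ (y - γ s))) (g := superposition (sndDeriv f hf) γ) s).trans h1.le
      rw [dist_eq_norm] at h2
      simpa [superposition_apply] using h2)
    (x := γ s) (y := γ s + h s) (Metric.mem_ball_self hδ) (by simpa using hs)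
  simp only [add_sub_cancel_left] at key
  refine le_trans (le_of_eq ?_) (key.trans (by gcongr; exact h.norm_coe_le_norm s))
  rfl

theorem contDiff_clm {A B C : Type*} [NormedAddCommGroup A] [NormedSpace ℝ A]
    [NormedAddCommGroup B] [NormedSpace ℝ B] [NormedAddCommGroup C] [NormedSpace ℝ C]
    (f : A →L[ℝ] B →L[ℝ] C) {n : WithTop ℕ∞} : ContDiff ℝ n fun a => f a := f.contDiff

/-- The derivative is again a superposition operator, followed by the bounded linear map
`applyPath`, so induction applies. The target must be general, since the step passes from `G` to `F
→L[ℝ] G`; this is why both spaces share a universe. -/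
theorem contDiff_superposition (n : ℕ) : ∀ {G : Type u} [NormedAddCommGroup G] [NormedSpace ℝ G]
    (f : C(ℝ × F, G)), ContDiff ℝ ∞ f → ContDiff ℝ n (superposition f) := by
  induction n with
  | zero => intro G _ _ f _; exact contDiff_zero.2 (continuous_superposition f)
  | succ n ih =>
    intro G _ _ f hf
    have h := (contDiff_clm (applyPath F G)).comp (ih (sndDeriv f hf) (contDiff_sndDeriv f hf))
    rw [Nat.cast_add, Nat.cast_one, contDiff_succ_iff_hasFDerivAt]
    exact ⟨_, h, hasFDerivAt_superposition f hf⟩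

end Superposition

/-! ### Volterra operators and their invertibility. -/

section Volterra

variable {F : Type*} [NormedAddCommGroup F] [NormedSpace ℝ F] [CompleteSpace F]

theorem continuous_extend (γ : C(unitInterval, F)) :
    Continuous (IccExtend (zero_le_one' ℝ) γ) := γ.continuous.Icc_extend'

variable (F) in
/-- The primitive of a path. -/
def primitive : C(unitInterval, F) →L[ℝ] C(unitInterval, F) :=
  LinearMap.mkContinuous
    { toFun := fun γ => ⟨fun t => ∫ s in (0 : ℝ)..t, IccExtend (zero_le_one' ℝ) γ s,
        (intervalIntegral.continuous_primitive
          (fun a b => (continuous_extend γ).intervalIntegrable a b) 0).comp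
          continuous_subtype_val⟩
      map_add' := by
        intro γ δ; ext t
        exact intervalIntegral.integral_add ((continuous_extend γ).intervalIntegrable _ _)
          ((continuous_extend δ).intervalIntegrable _ _)
      map_smul' := by
        intro c γ; ext t
        exact intervalIntegral.integral_smul _ _ } 1 (by
    intro γ
    rw [ContinuousMap.norm_le _ (by positivity)]
    intro t
    refine (intervalIntegral.norm_integral_le_of_norm_le_const (C := ‖γ‖)
      fun s _ => γ.norm_coe_le_norm _).trans ?_
    rw [sub_zero, abs_of_nonneg t.2.1, one_mul]
    exact mul_le_of_le_one_right (norm_nonneg _) t.2.2)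

theorem primitive_apply (γ : C(unitInterval, F)) (t : unitInterval) :
    primitive F γ t = ∫ s in (0 : ℝ)..t, IccExtend (zero_le_one' ℝ) γ s := rfl

theorem hasDerivWithinAt_primitive (γ : C(unitInterval, F)) (t : unitInterval) :
    HasDerivWithinAt (IccExtend (zero_le_one' ℝ) (primitive F γ)) (γ t) (Icc 0 1) t := by
  have h := (intervalIntegral.integral_hasDerivAt_right
    ((continuous_extend γ).intervalIntegrable 0 t)
    ((continuous_extend γ).stronglyMeasurableAtFilter _ _)
    (continuous_extend γ).continuousAt).hasDerivWithinAt (s := Icc (0 : ℝ) 1)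
  rw [IccExtend_val] at h
  refine h.congr (fun s hs => ?_) ?_
  · rw [IccExtend_of_mem _ _ hs]; rfl
  · rw [IccExtend_val]; rfl

/-- Each application integrates the previous bound, so the iterated integrals of a constant produce
`t ^ n / n!`. -/
theorem norm_volterra_pow_apply_le (A : C(unitInterval, F →L[ℝ] F)) (γ : C(unitInterval, F)) (n : ℕ)
    (t : unitInterval) :
    ‖((primitive F ∘L applyPath F F A) ^ n) γ t‖ ≤ ‖γ‖ * (‖A‖ ^ n * (t : ℝ) ^ n / n.factorial) := by
  induction n generalizing t with
  | zero => simpa using γ.norm_coe_le_norm t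
  | succ n ih =>
    rw [pow_succ', mul_apply_eq_comp, ContinuousLinearMap.comp_apply, primitive_apply]
    have h1 : ∀ s ∈ uIoc (0 : ℝ) t, ‖IccExtend (zero_le_one' ℝ)
        (applyPath F F A (((primitive F ∘L applyPath F F A) ^ n) γ)) s‖ ≤
        ‖A‖ * (‖γ‖ * (‖A‖ ^ n * s ^ n / n.factorial)) := by
      intro s hs
      rw [uIoc_of_le t.2.1] at hs
      have hs' : s ∈ Icc (0 : ℝ) 1 := ⟨hs.1.le, hs.2.trans t.2.2⟩
      rw [IccExtend_of_mem _ _ hs', applyPath_apply]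
      exact ((A ⟨s, hs'⟩).le_opNorm _).trans
        (mul_le_mul (A.norm_coe_le_norm _) (ih ⟨s, hs'⟩) (norm_nonneg _) (norm_nonneg _))
    have h2 := intervalIntegral.norm_integral_le_of_norm_le
      (μ := MeasureTheory.volume) t.2.1
      (MeasureTheory.ae_of_all _ fun s hs => h1 s (by rwa [uIoc_of_le t.2.1]))
      (Continuous.intervalIntegrable (by fun_prop) _ _)
    refine h2.trans (le_of_eq ?_)
    have h3 : (fun s : ℝ => ‖A‖ * (‖γ‖ * (‖A‖ ^ n * s ^ n / n.factorial))) =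
        fun s => (‖A‖ * ‖γ‖ * ‖A‖ ^ n / n.factorial) * s ^ n := by
      ext s; ring
    rw [h3, intervalIntegral.integral_const_mul, integral_pow, Nat.factorial_succ]
    have : (n.factorial : ℝ) ≠ 0 := by positivity
    have : (n : ℝ) + 1 ≠ 0 := by positivity
    push_cast
    field_simp
    ring

/-- Some power `T ^ n` has norm less than one, although `T` itself need not. Then `1 - T ^ n` is
invertible, and `1 - T` divides it with a commuting cofactor, the geometric sum. -/
theorem isUnit_one_sub_volterra (A : C(unitInterval, F →L[ℝ] F)) :
    IsUnit (1 - primitive F ∘L applyPath F F A) := by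
  set T := primitive F ∘L applyPath F F A
  obtain ⟨n, hn⟩ : ∃ n : ℕ, ‖A‖ ^ n / n.factorial < 1 :=
    ((FloorSemiring.tendsto_pow_div_factorial_atTop ‖A‖).eventually_lt_const one_pos).exists
  have hT : ‖T ^ n‖ < 1 := by
    refine lt_of_le_of_lt (ContinuousLinearMap.opNorm_le_bound _ (by positivity) fun γ => ?_) hn
    rw [ContinuousMap.norm_le _ (by positivity)]
    intro t
    refine (norm_volterra_pow_apply_le A γ n t).trans ?_
    rw [mul_comm]
    gcongr
    exact mul_le_of_le_one_right (by positivity) (pow_le_one₀ t.2.1 t.2.2)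
  have h1 : IsUnit (1 - T ^ n) := (Units.oneSub (T ^ n) hT).isUnit
  rw [← mul_neg_geom_sum T n] at h1
  refine ((Commute.isUnit_mul_iff ?_).1 h1).1
  exact (mul_neg_geom_sum T n).trans (geom_sum_mul_neg T n).symm

end Volterra

/-! ### Smooth flows of time-dependent fields by the inverse function theorem. -/

section Flow

/-- In finite dimension an operator is a fixed linear expression in its values on a basis, so
pointwise differentiability gives differentiability in operator norm. -/
theorem hasDerivWithinAt_clm_of_apply {F G : Type*} [NormedAddCommGroup F] [NormedSpace ℝ F]
    [FiniteDimensional ℝ F] [NormedAddCommGroup G] [NormedSpace ℝ G] {A : ℝ → F →L[ℝ] G}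
    {A' : F →L[ℝ] G} {S : Set ℝ} {t : ℝ}
    (h : ∀ v, HasDerivWithinAt (fun s => A s v) (A' v) S t) : HasDerivWithinAt A A' S t := by
  let b := Module.finBasis ℝ F
  have hA : ∀ B : F →L[ℝ] G, B = ∑ i, ContinuousLinearMap.smulRightL ℝ F G
      (LinearMap.toContinuousLinearMap (b.coord i)) (B (b i)) := by
    intro B
    ext v
    conv_lhs => rw [← b.sum_repr v, map_sum]
    simp
  have h1 : HasDerivWithinAt (fun s => ∑ i, ContinuousLinearMap.smulRightL ℝ F G
      (LinearMap.toContinuousLinearMap (b.coord i)) (A s (b i)))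
      (∑ i, ContinuousLinearMap.smulRightL ℝ F G
      (LinearMap.toContinuousLinearMap (b.coord i)) (A' (b i))) S t :=
    HasDerivWithinAt.fun_sum fun i _ =>
      (ContinuousLinearMap.hasFDerivAt _).comp_hasDerivWithinAt t (h (b i))
  rw [hA A', funext fun s => hA (A s)]
  exact h1

universe u

variable {F : Type u} [NormedAddCommGroup F] [NormedSpace ℝ F] [CompleteSpace F]

theorem hasDerivWithinAt_of_eq_primitive {γ δ : C(unitInterval, F)} {x : F}
    (h : γ = ContinuousMap.const _ x + primitive F δ) {t : ℝ} (ht : t ∈ Icc (0 : ℝ) 1) :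
    HasDerivWithinAt (IccExtend (zero_le_one' ℝ) γ) (δ ⟨t, ht⟩) (Icc 0 1) t := by
  have h1 : IccExtend (zero_le_one' ℝ) γ =
      fun s => x + IccExtend (zero_le_one' ℝ) (primitive F δ) s := by
    rw [h]; rfl
  rw [h1]
  exact (hasDerivWithinAt_primitive δ ⟨t, ht⟩).const_add x

/-- The fixed points of `γ ↦ x + ∫ f (s, γ s) ds` are the solutions of `flowOperator f γ = x`. -/
def flowOperator (f : C(ℝ × F, F)) (γ : C(unitInterval, F)) : C(unitInterval, F) :=
  γ - primitive F (superposition f γ)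

theorem contDiff_flowOperator (f : C(ℝ × F, F)) (hf : ContDiff ℝ ∞ f) :
    ContDiff ℝ ∞ (flowOperator f) :=
  contDiff_id.sub ((primitive F).contDiff.comp
    (contDiff_infty.2 fun n => contDiff_superposition n f hf))

theorem hasFDerivAt_flowOperator (f : C(ℝ × F, F)) (hf : ContDiff ℝ ∞ f)
    (γ : C(unitInterval, F)) :
    HasFDerivAt (flowOperator f)
      (1 - primitive F ∘L applyPath F F (superposition (sndDeriv f hf) γ)) γ :=
  (hasFDerivAt_id γ).sub ((primitive F).hasFDerivAt.comp γ (hasFDerivAt_superposition f hf γ))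

theorem exists_equiv_flowOperator (f : C(ℝ × F, F)) (hf : ContDiff ℝ ∞ f)
    (γ : C(unitInterval, F)) :
    ∃ e : C(unitInterval, F) ≃L[ℝ] C(unitInterval, F),
      HasFDerivAt (flowOperator f) (e : C(unitInterval, F) →L[ℝ] C(unitInterval, F)) γ := by
  obtain ⟨u, hu⟩ := isUnit_one_sub_volterra (superposition (sndDeriv f hf) γ)
  refine ⟨ContinuousLinearEquiv.unitsEquiv ℝ _ u, ?_⟩
  have h := hasFDerivAt_flowOperator f hf γ
  rw [← hu] at h
  exact h

/-- `flowOperator f` has an invertible derivative, and the stationary path at `u₀` solves the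
equation. So the local inverse, applied to the constant path at `x`, is the trajectory from `x`. -/
theorem exists_smooth_paths (f : C(ℝ × F, F)) (hf : ContDiff ℝ ∞ f) {u₀ : F}
    (h0 : ∀ t ∈ Icc (0 : ℝ) 1, f (t, u₀) = 0) :
    ∃ Γ : F → C(unitInterval, F), Γ u₀ = ContinuousMap.const _ u₀ ∧ ∀ᶠ x in 𝓝 u₀,
      ContDiffAt ℝ ∞ Γ x ∧ flowOperator f (Γ x) = ContinuousMap.const _ x := by
  let γ₀ : C(unitInterval, F) := ContinuousMap.const _ u₀
  have hγ₀ : flowOperator f γ₀ = γ₀ := by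
    have : superposition f γ₀ = 0 := by
      ext s; exact h0 s s.2
    rw [flowOperator, this, map_zero, sub_zero]
  obtain ⟨e₀, he₀⟩ := exists_equiv_flowOperator f hf γ₀
  have hc := contDiff_flowOperator f hf
  let e := hc.contDiffAt.toOpenPartialHomeomorph (flowOperator f) he₀ (by simp)
  have hγs : γ₀ ∈ e.source := ContDiffAt.mem_toOpenPartialHomeomorph_source hc.contDiffAt he₀ _
  have hee : ∀ γ, e γ = flowOperator f γ := fun _ => rfl
  let c : F →L[ℝ] C(unitInterval, F) := ContinuousLinearMap.const ℝ unitInterval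
  have hc0 : c u₀ = e γ₀ := hγ₀.symm
  refine ⟨fun x => e.symm (c x), ?_, ?_⟩
  · change e.symm (c u₀) = γ₀
    rw [hc0, e.left_inv hγs]
  · have hmem : ∀ᶠ x in 𝓝 u₀, c x ∈ e.target := by
      refine c.continuous.continuousAt.eventually_mem (e.open_target.mem_nhds ?_)
      rw [hc0]; exact e.map_source hγs
    filter_upwards [hmem] with x hx
    refine ⟨?_, e.right_inv hx⟩
    -- The derivative is invertible at every path, not only at the stationary one, so the inverse is
    -- smooth at each point of its domain.
    obtain ⟨e₁, he₁⟩ := exists_equiv_flowOperator f hf (e.symm (c x))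
    exact (e.contDiffAt_symm hx he₁ hc.contDiffAt).comp x c.contDiff.contDiffAt

theorem exists_flow_of_contDiff [FiniteDimensional ℝ F] (f : C(ℝ × F, F)) (hf : ContDiff ℝ ∞ f)
    {u₀ : F} (h0 : ∀ t ∈ Icc (0 : ℝ) 1, f (t, u₀) = 0) {W : Set (ℝ × F)} (hW : IsOpen W)
    (hu : ∀ t ∈ Icc (0 : ℝ) 1, (t, u₀) ∈ W) :
    ∃ (N : Set F) (Φ : ℝ → F → F) (A : ℝ → F → F →L[ℝ] F), IsOpen N ∧ u₀ ∈ N ∧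
      ContDiffOn ℝ ∞ (Φ 1) N ∧ ∀ x ∈ N, Φ 0 x = x ∧ A 0 x = .id ℝ F ∧
        HasFDerivAt (Φ 1) (A 1 x) x ∧ ∀ t ∈ Icc (0 : ℝ) 1, (t, Φ t x) ∈ W ∧
          HasDerivWithinAt (fun s => Φ s x) (f (t, Φ t x)) (Icc 0 1) t ∧
          HasDerivWithinAt (fun s => A s x)
            (((fderiv ℝ f (t, Φ t x)).comp (.inr ℝ ℝ F)).comp (A t x)) (Icc 0 1) t := by
  obtain ⟨Γ, hΓ₀, hΓ⟩ := exists_smooth_paths f hf h0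
  -- A tube around the compact segment `[0, 1] × {u₀}` lies in `W`. Trajectories uniformly close to
  -- the stationary one stay in the tube.
  obtain ⟨S, B, -, hB, hSI, huB, hSB⟩ := generalized_tube_lemma (isCompact_Icc (a := (0 : ℝ)) (b := 1))
    (isCompact_singleton (x := u₀)) hW (by rintro ⟨t, x⟩ ⟨ht, rfl⟩; exact hu t ht)
  obtain ⟨r, hr, hrB⟩ := Metric.isOpen_iff.1 hB u₀ (huB rfl)
  have hclose : ∀ᶠ x in 𝓝 u₀, dist (Γ x) (Γ u₀) < r :=
    Metric.continuousAt_iff'.1 hΓ.self_of_nhds.1.continuousAt r hr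
  obtain ⟨N, hN, hNo, hu₀⟩ := eventually_nhds_iff.1 (hΓ.and hclose)
  let p : ℝ → unitInterval := projIcc 0 1 zero_le_one
  have hp : ∀ t (ht : t ∈ Icc (0 : ℝ) 1), p t = ⟨t, ht⟩ := fun t ht => projIcc_of_mem _ ht
  have h00 : (0 : ℝ) ∈ Icc (0 : ℝ) 1 := ⟨le_rfl, zero_le_one⟩
  refine ⟨N, fun t x => Γ x (p t),
    fun t x => (ContinuousMap.evalCLM ℝ (p t)).comp (fderiv ℝ Γ x), hNo, hu₀, ?_, ?_⟩
  · intro x hx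
    exact ((ContinuousMap.evalCLM ℝ (p 1)).contDiff.contDiffAt.comp x (hN x hx).1.1).contDiffWithinAt
  · intro x hx
    have heq : Γ x = ContinuousMap.const _ x + primitive F (superposition f (Γ x)) := by
      rw [← (hN x hx).1.2, flowOperator, sub_add_cancel]
    have hdiff : HasFDerivAt Γ (fderiv ℝ Γ x) x :=
      ((hN x hx).1.1.differentiableAt (by simp)).hasFDerivAt
    -- Differentiating the fixed point equation in the initial value gives the variational equation
    -- in integral form.
    have heq' : ∀ v, fderiv ℝ Γ x v = ContinuousMap.const _ v + primitive F
        (applyPath F F (superposition (sndDeriv f hf) (Γ x)) (fderiv ℝ Γ x v)) := by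
      intro v
      have h1 : HasFDerivAt (fun y => flowOperator f (Γ y))
          (ContinuousLinearMap.const ℝ unitInterval : F →L[ℝ] C(unitInterval, F)) x := by
        refine (ContinuousLinearMap.hasFDerivAt
          (ContinuousLinearMap.const ℝ unitInterval : F →L[ℝ] C(unitInterval, F))).congr_of_eventuallyEq ?_
        filter_upwards [hNo.mem_nhds hx] with y hy
        exact (hN y hy).1.2
      have h2 := ((hasFDerivAt_flowOperator f hf (Γ x)).comp x hdiff).unique h1
      have h3 := DFunLike.congr_fun h2 v
      exact sub_eq_iff_eq_add.1 h3
    refine ⟨?_, ?_, ?_, fun t ht => ⟨?_, ?_, ?_⟩⟩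
    · change Γ x (p 0) = x
      rw [heq, hp 0 h00]
      simp [primitive_apply]
    · ext v
      change fderiv ℝ Γ x v (p 0) = v
      rw [heq', hp 0 h00]
      simp [primitive_apply]
    · exact (ContinuousMap.evalCLM ℝ (p 1)).hasFDerivAt.comp x hdiff
    · refine hSB ⟨hSI ht, hrB ?_⟩
      refine lt_of_le_of_lt ?_ (hN x hx).2
      refine le_trans (le_of_eq ?_) (ContinuousMap.dist_apply_le_dist (p t))
      rw [hΓ₀]; rfl
    · have h1 := hasDerivWithinAt_of_eq_primitive heq ht
      change HasDerivWithinAt (fun s => Γ x (p s)) _ _ _ at h1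
      rw [superposition_apply, ← hp t ht, show ((p t : unitInterval) : ℝ) = t by rw [hp t ht]] at h1
      exact h1
    · refine hasDerivWithinAt_clm_of_apply fun v => ?_
      have h1 := hasDerivWithinAt_of_eq_primitive (heq' v) ht
      rw [applyPath_apply, superposition_apply] at h1
      change HasDerivWithinAt (fun s => fderiv ℝ Γ x v (p s)) _ _ _
      rw [← hp t ht, sndDeriv_apply, show ((p t : unitInterval) : ℝ) = t by rw [hp t ht]] at h1
      exact h1

/-- Multiplication by a bump function extends a locally defined field by zero. This supplies the
globally defined field that superposition operators need. -/
theorem exists_smooth_cutoff [FiniteDimensional ℝ F] {f : ℝ × F → F} {O K : Set (ℝ × F)}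
    (hO : IsOpen O) (hf : ContDiffOn ℝ ∞ f O) (hK : IsCompact K) (hKO : K ⊆ O) :
    ∃ g : C(ℝ × F, F), ContDiff ℝ ∞ g ∧ ∃ W ⊆ O, IsOpen W ∧ K ⊆ W ∧ EqOn g f W := by
  obtain ⟨T, hT, hKT, hTO⟩ := exists_compact_between hK hO hKO
  obtain ⟨χ, hχ1, hχ0, -⟩ := exists_contMDiffMap_one_nhds_of_subset_interior (n := ⊤)
    𝓘(ℝ, ℝ × F) hK.isClosed hKT
  have hχ : ContDiff ℝ ∞ χ := χ.contMDiff.contDiff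
  obtain ⟨W, hWo, hKW, hW⟩ := eventually_nhdsSet_iff_exists.1 hχ1
  have hg : ContDiff ℝ ∞ fun p => χ p • f p := by
    rw [contDiff_iff_contDiffAt]
    intro p
    by_cases hp : p ∈ O
    · exact hχ.contDiffAt.smul (hf.contDiffAt (hO.mem_nhds hp))
    · refine (contDiffAt_const (c := (0 : F))).congr_of_eventuallyEq ?_
      filter_upwards [hT.isClosed.isOpen_compl.mem_nhds fun h => hp (hTO h)] with q hq
      rw [hχ0 q hq, zero_smul]
  refine ⟨⟨_, hg.continuous⟩, hg, W ∩ O, inter_subset_right, hWo.inter hO,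
    subset_inter hKW hKO, fun p hp => ?_⟩
  change χ p • f p = f p
  rw [hW p hp.1, one_smul]

/-- Near a stationary point, the flow of a smooth time-dependent vector field is defined and
smooth up to time one, and its derivative solves the variational equation. -/
theorem exists_local_flow [FiniteDimensional ℝ F] {f : ℝ × F → F} {O : Set (ℝ × F)}
    (hO : IsOpen O) (hf : ContDiffOn ℝ ∞ f O) {u₀ : F} (hu : ∀ t ∈ Icc (0 : ℝ) 1, (t, u₀) ∈ O)
    (h0 : ∀ t ∈ Icc (0 : ℝ) 1, f (t, u₀) = 0) :
    ∃ (N : Set F) (Φ : ℝ → F → F) (A : ℝ → F → F →L[ℝ] F), IsOpen N ∧ u₀ ∈ N ∧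
      ContDiffOn ℝ ∞ (Φ 1) N ∧ ∀ x ∈ N, Φ 0 x = x ∧ A 0 x = .id ℝ F ∧
        HasFDerivAt (Φ 1) (A 1 x) x ∧ ∀ t ∈ Icc (0 : ℝ) 1, (t, Φ t x) ∈ O ∧
          HasDerivWithinAt (fun s => Φ s x) (f (t, Φ t x)) (Icc 0 1) t ∧
          HasDerivWithinAt (fun s => A s x)
            (((fderiv ℝ f (t, Φ t x)).comp (.inr ℝ ℝ F)).comp (A t x)) (Icc 0 1) t := by
  obtain ⟨g, hg, W, hWO, hW, hKW, hgf⟩ := exists_smooth_cutoff hO hf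
    ((isCompact_Icc (a := (0 : ℝ)) (b := 1)).prod (isCompact_singleton (x := u₀)))
    (by rintro ⟨t, x⟩ ⟨ht, rfl⟩; exact hu t ht)
  have hKW' : ∀ t ∈ Icc (0 : ℝ) 1, (t, u₀) ∈ W := fun t ht => hKW ⟨ht, rfl⟩
  obtain ⟨N, Φ, A, hN, hu₀, hΦ, h⟩ := exists_flow_of_contDiff g hg
    (fun t ht => by rw [hgf (hKW' t ht), h0 t ht]) hW hKW'
  refine ⟨N, Φ, A, hN, hu₀, hΦ, fun x hx => ?_⟩
  obtain ⟨h1, h2, h3, h4⟩ := h x hx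
  refine ⟨h1, h2, h3, fun t ht => ?_⟩
  obtain ⟨h5, h6, h7⟩ := h4 t ht
  rw [hgf h5] at h6
  rw [(hgf.eventuallyEq_of_mem (hW.mem_nhds h5)).fderiv_eq] at h7
  exact ⟨hWO h5, h6, h7⟩

end Flow

/-! ### Gauged pullbacks of linear Dirac structures, and the Jacobi identity. -/

section LocalModel

theorem eq_of_forall_clm {F : Type*} [NormedAddCommGroup F] [NormedSpace ℝ F] {v w : F}
    (h : ∀ ξ : F →L[ℝ] ℝ, ξ v = ξ w) : v = w :=
  (SeparatingDual.eq_iff_forall_dual_eq (R := ℝ)).2 h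

variable {E K : Type*} [NormedAddCommGroup E] [NormedSpace ℝ E] [NormedAddCommGroup K]
  [NormedSpace ℝ K]

/-- The relation `(X, ζ) ∈ τ_B (π^*Λ)` for the projection `π : E × K → E`. -/
def LiftRel (Λ : Submodule ℝ (E × (E →L[ℝ] ℝ))) (B : E × K →L[ℝ] E × K →L[ℝ] ℝ) (X : E × K)
    (ζ : E × K →L[ℝ] ℝ) : Prop :=
  ∃ η : E →L[ℝ] ℝ, (X.1, η) ∈ Λ ∧ ζ = η ∘L .fst ℝ E K + B X

/-- The exterior derivative of a one-form on a vector space. -/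
def twoForm {F : Type*} [NormedAddCommGroup F] [NormedSpace ℝ F] (a : F → F →L[ℝ] ℝ) (u : F) :
    F →L[ℝ] F →L[ℝ] ℝ := fderiv ℝ a u - (fderiv ℝ a u).flip

theorem twoForm_apply {F : Type*} [NormedAddCommGroup F] [NormedSpace ℝ F] (a : F → F →L[ℝ] ℝ)
    (u X Y : F) : twoForm a u X Y = fderiv ℝ a u X Y - fderiv ℝ a u Y X := rfl

theorem twoForm_skew {F : Type*} [NormedAddCommGroup F] [NormedSpace ℝ F] (a : F → F →L[ℝ] ℝ)
    (u X Y : F) : twoForm a u X Y = -twoForm a u Y X := by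
  simp [twoForm_apply]

theorem contDiffAt_flip {F : Type*} [NormedAddCommGroup F] [NormedSpace ℝ F]
    {A : F → F →L[ℝ] F →L[ℝ] ℝ} {u : F} (h : ContDiffAt ℝ ∞ A u) :
    ContDiffAt ℝ ∞ (fun w => (A w).flip) u := by
  have h1 := LinearIsometryEquiv.contDiff (𝕜 := ℝ) (E := F →L[ℝ] F →L[ℝ] ℝ)
    (F := F →L[ℝ] F →L[ℝ] ℝ) (n := ∞) (ContinuousLinearMap.flipₗᵢ ℝ F F ℝ)
  exact h1.contDiffAt.comp u h

theorem contDiffAt_twoForm {F : Type*} [NormedAddCommGroup F] [NormedSpace ℝ F]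
    {a : F → F →L[ℝ] ℝ} {u : F} (ha : ContDiffAt ℝ ∞ a u) : ContDiffAt ℝ ∞ (twoForm a) u := by
  have h := ha.fderiv_right (m := ∞) (by simp)
  exact h.sub (contDiffAt_flip h)

theorem hasFDerivAt_clm_apply₂ {F G₁ G₂ : Type*} [NormedAddCommGroup F] [NormedSpace ℝ F]
    [NormedAddCommGroup G₁] [NormedSpace ℝ G₁] [NormedAddCommGroup G₂] [NormedSpace ℝ G₂]
    {A : F → G₁ →L[ℝ] G₂ →L[ℝ] ℝ} {A' : F →L[ℝ] G₁ →L[ℝ] G₂ →L[ℝ] ℝ} {u : F}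
    (h : HasFDerivAt A A' u) (Y : G₁) (Z : G₂) :
    HasFDerivAt (fun w => A w Y Z) ((A'.flip Y).flip Z) u := by
  have h1 := (h.clm_apply (hasFDerivAt_const Y u)).clm_apply (hasFDerivAt_const Z u)
  refine h1.congr_fderiv ?_
  ext X
  simp

/-- The exterior derivative of an exact two-form vanishes. -/
theorem twoForm_closed {F : Type*} [NormedAddCommGroup F] [NormedSpace ℝ F]
    {a : F → F →L[ℝ] ℝ} {u : F} (ha : ContDiffAt ℝ ∞ a u) (X Y Z : F) :
    fderiv ℝ (twoForm a) u X Y Z + fderiv ℝ (twoForm a) u Y Z X +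
      fderiv ℝ (twoForm a) u Z X Y = 0 := by
  have h : DifferentiableAt ℝ (fderiv ℝ a) u :=
    (ha.fderiv_right (m := ∞) (by simp)).differentiableAt (by simp)
  have h1 : ∀ X Y Z, fderiv ℝ (twoForm a) u X Y Z =
      fderiv ℝ (fderiv ℝ a) u X Y Z - fderiv ℝ (fderiv ℝ a) u X Z Y := by
    intro X Y Z
    have h2 := hasFDerivAt_clm_apply₂
      ((contDiffAt_twoForm ha).differentiableAt (by simp)).hasFDerivAt Y Z
    have h3 := h2.unique ((hasFDerivAt_clm_apply₂ h.hasFDerivAt Y Z).sub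
      (hasFDerivAt_clm_apply₂ h.hasFDerivAt Z Y))
    exact DFunLike.congr_fun h3 X
  have hs : ∀ X Y, fderiv ℝ (fderiv ℝ a) u X Y = fderiv ℝ (fderiv ℝ a) u Y X := fun X Y =>
    (ha.isSymmSndFDerivAt (by rw [minSmoothness_of_isRCLikeNormedField]; exact WithTop.coe_le_coe.2 (le_top : (2 : ℕ∞) ≤ ⊤))).eq X Y
  rw [h1, h1, h1, hs X Y, hs Z X, hs Z Y]
  ring

/-- A subspace of `E ⊕ E*` is isotropic for the symmetric pairing. -/
def IsIsotropic (Λ : Submodule ℝ (E × (E →L[ℝ] ℝ))) : Prop :=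
  ∀ a ∈ Λ, ∀ b ∈ Λ, a.2 b.1 + b.2 a.1 = 0

section Pointwise

variable {Λ : Submodule ℝ (E × (E →L[ℝ] ℝ))} {B : E × K →L[ℝ] E × K →L[ℝ] ℝ}
  {P : (E × K →L[ℝ] ℝ) →L[ℝ] E × K}

/-- The contributions of a skew `B` cancel in the symmetric pairing, which leaves the pairing of the
two elements of `Λ`. -/
theorem LiftRel.isotropic (hΛ : IsIsotropic Λ) (hB : ∀ X Y, B X Y = -B Y X) {X Y : E × K}
    {ζ θ : E × K →L[ℝ] ℝ} (hX : LiftRel Λ B X ζ) (hY : LiftRel Λ B Y θ) : ζ Y + θ X = 0 := by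
  obtain ⟨η, hη, rfl⟩ := hX
  obtain ⟨κ, hκ, rfl⟩ := hY
  have h := hΛ _ hη _ hκ
  have hB' := hB X Y
  simp only [add_apply, ContinuousLinearMap.comp_apply,
    ContinuousLinearMap.coe_fst'] at h ⊢
  linarith

theorem LiftRel.skew (hΛ : IsIsotropic Λ) (hB : ∀ X Y, B X Y = -B Y X)
    (hP : ∀ ξ, LiftRel Λ B (P ξ) ξ) (ξ η : E × K →L[ℝ] ℝ) : η (P ξ) = -ξ (P η) :=
  eq_neg_of_add_eq_zero_left ((hP η).isotropic hΛ hB (hP ξ))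

/-- A graph over all covectors is already maximal isotropic. Any `(X, ζ)` in the relation pairs to
zero with the graph of `P`, so every covector kills `X - P ζ`. This uniqueness is what later
identifies bivectors and velocities. -/
theorem LiftRel.eq_sharp (hΛ : IsIsotropic Λ) (hB : ∀ X Y, B X Y = -B Y X)
    (hP : ∀ ξ, LiftRel Λ B (P ξ) ξ) {X : E × K} {ζ : E × K →L[ℝ] ℝ} (hX : LiftRel Λ B X ζ) :
    X = P ζ := by
  refine eq_of_forall_clm fun ξ => ?_
  have h1 := hX.isotropic hΛ hB (hP ξ)
  have h2 := LiftRel.skew hΛ hB hP ξ ζ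
  linarith

theorem LiftRel.gauge {X : E × K} {ζ : E × K →L[ℝ] ℝ} (h : LiftRel Λ B X ζ)
    (B' : E × K →L[ℝ] E × K →L[ℝ] ℝ) : LiftRel Λ (B + B') X (ζ + B' X) := by
  obtain ⟨η, hη, rfl⟩ := h
  exact ⟨η, hη, by rw [add_apply, add_assoc]⟩

end Pointwise

variable [FiniteDimensional ℝ E] [FiniteDimensional ℝ K]

theorem finrank_strongDual (V : Type*) [NormedAddCommGroup V] [NormedSpace ℝ V]
    [FiniteDimensional ℝ V] : Module.finrank ℝ (V →L[ℝ] ℝ) = Module.finrank ℝ V := by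
  rw [(LinearMap.toContinuousLinearMap (𝕜 := ℝ) (E := V) (F' := ℝ)).symm.finrank_eq,
    Module.finrank_linearMap, Module.finrank_self, mul_one]

theorem exists_equiv_of_injective {V W : Type*} [NormedAddCommGroup V] [NormedSpace ℝ V]
    [FiniteDimensional ℝ V] [NormedAddCommGroup W] [NormedSpace ℝ W] [FiniteDimensional ℝ W]
    (S : V →L[ℝ] W) (hS : Function.Injective S)
    (hd : Module.finrank ℝ V = Module.finrank ℝ W) : ∃ e : V ≃L[ℝ] W, (e : V →L[ℝ] W) = S :=
  ⟨(LinearEquiv.ofInjectiveOfFinrankEq (S : V →ₗ[ℝ] W) hS hd).toContinuousLinearEquiv, by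
    ext v : 1; rfl⟩

/-- Coefficients of a local frame of `Λ` together with a vertical vector parametrize the lifted
structure, with vector part `S₁` and covector part `S₂`. Where `S₂` is invertible, the structure is
the graph of `S₁ ∘ S₂⁻¹`, which is smooth because inversion is. The parameter space `G` is kept
apart from `E × K` so that it may contain a time variable. -/
theorem exists_smooth_sharp {G : Type*} [NormedAddCommGroup G] [NormedSpace ℝ G]
    {Λ : E → Submodule ℝ (E × (E →L[ℝ] ℝ))} {x₀ : E}
    (hfin : Module.finrank ℝ (Λ x₀) = Module.finrank ℝ E)
    (hsec : ∀ a ∈ Λ x₀, ∃ σ : E → E × (E →L[ℝ] ℝ), σ x₀ = a ∧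
      ∀ᶠ y in 𝓝 x₀, ContDiffAt ℝ ∞ σ y ∧ σ y ∈ Λ y)
    {q : G → E} {g₀ : G} (hq₀ : q g₀ = x₀) (hq : ∀ᶠ g in 𝓝 g₀, ContDiffAt ℝ ∞ q g)
    {B : G → E × K →L[ℝ] E × K →L[ℝ] ℝ} (hB : ∀ᶠ g in 𝓝 g₀, ContDiffAt ℝ ∞ B g)
    (htr : ∀ X, LiftRel (Λ x₀) (B g₀) X 0 → X = 0) :
    ∃ P : G → (E × K →L[ℝ] ℝ) →L[ℝ] E × K,
      ∀ᶠ g in 𝓝 g₀, ContDiffAt ℝ ∞ P g ∧ ∀ ξ, LiftRel (Λ (q g)) (B g) (P g ξ) ξ := by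
  obtain ⟨m, hm, b, hb, hbΛ⟩ : ∃ m, m = Module.finrank ℝ E ∧ ∃ b : Fin m → E × (E →L[ℝ] ℝ),
      LinearIndependent ℝ b ∧ ∀ j, b j ∈ Λ x₀ :=
    ⟨_, hfin, exists_linearIndependent_mem (Λ x₀)⟩
  rw [Fintype.linearIndependent_iff] at hb
  choose σ hσ₀ hσ using fun j => hsec (b j) (hbΛ j)
  let pr : Fin m → (Fin m → ℝ) × K →L[ℝ] ℝ := fun j =>
    (ContinuousLinearMap.proj j).comp (.fst ℝ (Fin m → ℝ) K)
  let S₁ : G → (Fin m → ℝ) × K →L[ℝ] E × K := fun g =>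
    ∑ j, ContinuousLinearMap.smulRightL ℝ _ _ (pr j) ((σ j (q g)).1, (0 : K)) +
      (ContinuousLinearMap.inr ℝ E K).comp (.snd ℝ _ _)
  let S₂ : G → (Fin m → ℝ) × K →L[ℝ] E × K →L[ℝ] ℝ := fun g =>
    ∑ j, ContinuousLinearMap.smulRightL ℝ _ _ (pr j) ((σ j (q g)).2.comp (.fst ℝ E K)) +
      (B g).comp (S₁ g)
  have hS₁ : ∀ g v, S₁ g v = (∑ j, v.1 j • (σ j (q g)).1, v.2) := by
    intro g v
    ext <;> simp [S₁, pr, Prod.fst_sum, Prod.snd_sum]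
  have hS₂ : ∀ g v, S₂ g v = (∑ j, v.1 j • (σ j (q g)).2).comp (.fst ℝ E K) + B g (S₁ g v) := by
    intro g v
    ext <;> simp [S₂, pr]
  have hlift : ∀ g, (∀ j, σ j (q g) ∈ Λ (q g)) → ∀ v,
      LiftRel (Λ (q g)) (B g) (S₁ g v) (S₂ g v) := by
    intro g hg v
    refine ⟨∑ j, v.1 j • (σ j (q g)).2, ?_, hS₂ g v⟩
    rw [hS₁]
    have : ((∑ j, v.1 j • (σ j (q g)).1, ∑ j, v.1 j • (σ j (q g)).2) : E × (E →L[ℝ] ℝ)) =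
        ∑ j, v.1 j • σ j (q g) := by
      ext <;> simp [Prod.fst_sum, Prod.snd_sum]
    rw [this]
    exact Submodule.sum_mem _ fun j _ => Submodule.smul_mem _ _ (hg j)
  -- If the covector part vanishes, transversality kills the vector part. Then both components of
  -- the combination of the `b j` vanish, and so does the vertical vector.
  have hinj : Function.Injective (S₂ g₀) := by
    refine (injective_iff_map_eq_zero _).2 fun v hv => ?_
    have h1 := hlift g₀ (fun j => by rw [hq₀, hσ₀]; exact hbΛ j) v
    rw [hv, hq₀] at h1
    have h2 := htr _ h1
    rw [hS₂, h2, map_zero, add_zero] at hv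
    rw [hS₁] at h2
    have h3 : ∑ j, v.1 j • b j = 0 := by
      refine Prod.ext ?_ (ContinuousLinearMap.ext fun x => ?_)
      · have := congrArg Prod.fst h2
        simpa [Prod.fst_sum, hq₀, hσ₀] using this
      · have := DFunLike.congr_fun hv (x, (0 : K))
        simpa [Prod.snd_sum, hq₀, hσ₀] using this
    refine Prod.ext (funext fun j => hb v.1 h3 j) ?_
    have h4 := congrArg Prod.snd h2
    exact h4
  obtain ⟨e₀, he₀⟩ := exists_equiv_of_injective (S₂ g₀) hinj (by
    rw [finrank_strongDual, Module.finrank_prod, Module.finrank_fin_fun, Module.finrank_prod,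
      hm])
  have hσ' : ∀ᶠ g in 𝓝 g₀, ∀ j, ContDiffAt ℝ ∞ (σ j) (q g) ∧ σ j (q g) ∈ Λ (q g) := by
    rw [Filter.eventually_all]
    intro j
    have h := hσ j
    rw [← hq₀] at h
    exact hq.self_of_nhds.continuousAt.eventually h
  have hS₁s : ∀ᶠ g in 𝓝 g₀, ContDiffAt ℝ ∞ S₁ g := by
    filter_upwards [hσ', hq] with g hg hqg
    refine ContDiffAt.add (ContDiffAt.sum fun j _ => ?_) contDiffAt_const
    have h1 := (hg j).1.comp g hqg
    exact (ContinuousLinearMap.contDiff _).contDiffAt.comp g (h1.fst.prodMk contDiffAt_const)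
  have hS₂s : ∀ᶠ g in 𝓝 g₀, ContDiffAt ℝ ∞ S₂ g := by
    filter_upwards [hσ', hq, hS₁s, hB] with g hg hqg hS hBg
    refine ContDiffAt.add (ContDiffAt.sum fun j _ => ?_) (hBg.clm_comp hS)
    have h1 := (hg j).1.comp g hqg
    exact (ContinuousLinearMap.contDiff _).contDiffAt.comp g (h1.snd.clm_comp contDiffAt_const)
  have hunit : ∀ᶠ g in 𝓝 g₀, S₂ g ∈ range ((↑) :
      (((Fin m → ℝ) × K) ≃L[ℝ] (E × K →L[ℝ] ℝ)) → _ →L[ℝ] _) := by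
    refine hS₂s.self_of_nhds.continuousAt.eventually_mem ?_
    rw [← he₀]
    exact ContinuousLinearEquiv.nhds e₀
  refine ⟨fun g => (S₁ g).comp (S₂ g).inverse, ?_⟩
  filter_upwards [hS₁s, hS₂s, hunit, hσ'] with g h1 h2 ⟨e, he⟩ h4
  refine ⟨h1.clm_comp ?_, fun ξ => ?_⟩
  · have h5 := contDiffAt_map_inverse (𝕜 := ℝ) (n := ∞) e
    rw [he] at h5
    exact h5.comp g h2
  · have h5 := hlift g (fun j => (h4 j).2) ((S₂ g).inverse ξ)
    have h6 : S₂ g ((S₂ g).inverse ξ) = ξ := by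
      rw [← he, ContinuousLinearMap.inverse_equiv]
      exact e.apply_symm_apply ξ
    rw [h6] at h5
    exact h5

/-- The Courant tensor `Σ ⟨D_{X₁} σ₂, σ₃⟩` of three sections of an isotropic subbundle, evaluated
in coordinates. -/
def courantTerm {F : Type*} [NormedAddCommGroup F] [NormedSpace ℝ F]
    (σ τ ρ : F → F × (F →L[ℝ] ℝ)) (x : F) : ℝ :=
  (fderiv ℝ τ x (σ x).1).2 (ρ x).1 + (ρ x).2 (fderiv ℝ τ x (σ x).1).1

/-- The Jacobi identity for the bivector field with graph `τ_{da} (π^*Λ)`. -/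
theorem jacobi_of_liftRel {Λ : E → Submodule ℝ (E × (E →L[ℝ] ℝ))} {u : E × K}
    (hiso : ∀ᶠ y in 𝓝 u.1, IsIsotropic (Λ y))
    (hint : ∃ σ : E × (E →L[ℝ] ℝ) → E → E × (E →L[ℝ] ℝ),
      (∀ a ∈ Λ u.1, σ a u.1 = a ∧ ∀ᶠ y in 𝓝 u.1, ContDiffAt ℝ ∞ (σ a) y ∧ σ a y ∈ Λ y) ∧
      ∀ a ∈ Λ u.1, ∀ b ∈ Λ u.1, ∀ c ∈ Λ u.1, courantTerm (σ a) (σ b) (σ c) u.1 +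
        courantTerm (σ b) (σ c) (σ a) u.1 + courantTerm (σ c) (σ a) (σ b) u.1 = 0)
    {a : E × K → E × K →L[ℝ] ℝ} (ha : ContDiffAt ℝ ∞ a u)
    {P : E × K → (E × K →L[ℝ] ℝ) →L[ℝ] E × K} (hP : DifferentiableAt ℝ P u)
    (hgr : ∀ᶠ w in 𝓝 u, ∀ ξ, LiftRel (Λ w.1) (twoForm a w) (P w ξ) ξ)
    (ξ₁ ξ₂ ξ₃ : E × K →L[ℝ] ℝ) :
    ξ₃ (fderiv ℝ P u (P u ξ₁) ξ₂) + ξ₁ (fderiv ℝ P u (P u ξ₂) ξ₃) +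
      ξ₂ (fderiv ℝ P u (P u ξ₃) ξ₁) = 0 := by
  obtain ⟨σ, hσ, hσint⟩ := hint
  have hfst : ContinuousAt (Prod.fst : E × K → E) u := continuousAt_fst
  have key : ∀ ξ : E × K →L[ℝ] ℝ, ∃ η, ((P u ξ).1, η) ∈ Λ u.1 ∧
      ξ = η ∘L .fst ℝ E K + twoForm a u (P u ξ) := fun ξ => hgr.self_of_nhds ξ
  -- One cyclic term splits into a Courant term of `Λ` and a derivative of the two-form. The former
  -- sum to zero by integrability, the latter by closedness.
  have main : ∀ ξ₁ ξ₂ ξ₃ η₁ η₂ η₃, ((P u ξ₁).1, η₁) ∈ Λ u.1 → ((P u ξ₂).1, η₂) ∈ Λ u.1 →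
      ((P u ξ₃).1, η₃) ∈ Λ u.1 → ξ₂ = η₂ ∘L .fst ℝ E K + twoForm a u (P u ξ₂) →
      ξ₃ = η₃ ∘L .fst ℝ E K + twoForm a u (P u ξ₃) →
      ξ₃ (fderiv ℝ P u (P u ξ₁) ξ₂) =
        courantTerm (σ ((P u ξ₁).1, η₁)) (σ ((P u ξ₂).1, η₂)) (σ ((P u ξ₃).1, η₃)) u.1 +
          fderiv ℝ (twoForm a) u (P u ξ₁) (P u ξ₂) (P u ξ₃) := by
    intro ξ₁ ξ₂ ξ₃ η₁ η₂ η₃ h₁ h₂ h₃ e₂ e₃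
    set s := σ ((P u ξ₂).1, η₂)
    have hs₀ : s u.1 = ((P u ξ₂).1, η₂) := (hσ _ h₂).1
    have hsd : HasFDerivAt s (fderiv ℝ s u.1) u.1 :=
      ((hσ _ h₂).2.self_of_nhds.1.differentiableAt (by simp)).hasFDerivAt
    -- The section `s` of `Λ` is lifted with constant vertical part, so that `(Y, ζ)` is a local
    -- section of the lifted structure through `(P u ξ₂, ξ₂)`.
    let Y : E × K → E × K := fun w => ((s w.1).1, (P u ξ₂).2)
    let ζ : E × K → E × K →L[ℝ] ℝ := fun w => (s w.1).2 ∘L .fst ℝ E K + twoForm a w (Y w)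
    have hY₀ : Y u = P u ξ₂ := by simp only [Y, hs₀]
    have hζ₀ : ζ u = ξ₂ := by
      simp only [ζ, hY₀]; rw [hs₀]; exact e₂.symm
    have hsf : HasFDerivAt (fun w : E × K => s w.1) ((fderiv ℝ s u.1).comp (.fst ℝ E K)) u :=
      hsd.comp u hasFDerivAt_fst
    have hYd : HasFDerivAt Y
        ((((ContinuousLinearMap.fst ℝ _ _).comp ((fderiv ℝ s u.1).comp (.fst ℝ E K)))).prod 0) u :=
      (hsf.fst).prodMk (hasFDerivAt_const _ _)
    have hωd : HasFDerivAt (twoForm a) (fderiv ℝ (twoForm a) u) u :=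
      ((contDiffAt_twoForm ha).differentiableAt (by simp)).hasFDerivAt
    set D := fderiv ℝ s u.1 (P u ξ₁).1
    obtain ⟨ζ', hζd, hζv⟩ : ∃ ζ', HasFDerivAt ζ ζ' u ∧ ζ' (P u ξ₁) = D.2 ∘L .fst ℝ E K +
        (twoForm a u (D.1, 0) + fderiv ℝ (twoForm a) u (P u ξ₁) (P u ξ₂)) := by
      refine ⟨_, ((hsf.snd).clm_comp (hasFDerivAt_const (ContinuousLinearMap.fst ℝ E K) u)).add
        (hωd.clm_apply hYd), ContinuousLinearMap.ext fun w => ?_⟩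
      simp [hY₀, D]
    have hPd : HasFDerivAt P (fderiv ℝ P u) u := hP.hasFDerivAt
    have hYP : Y =ᶠ[𝓝 u] fun w => P w (ζ w) := by
      filter_upwards [hgr, hfst.eventually hiso, hfst.eventually (hσ _ h₂).2] with w hw1 hw2 hw3
      exact LiftRel.eq_sharp hw2 (twoForm_skew a w) hw1 ⟨(s w.1).2, hw3.2, rfl⟩
    -- The identity `Y = P ζ` holds near `u`. Its derivative along `P u ξ₁` expresses the derivative
    -- of `P` through those of `s` and of the two-form.
    have hd := (hYd.congr_of_eventuallyEq hYP.symm).unique (hPd.clm_apply hζd)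
    have hd1 := DFunLike.congr_fun hd (P u ξ₁)
    have hsk := LiftRel.skew hiso.self_of_nhds (twoForm_skew a u) hgr.self_of_nhds
    have hd2 : ((D.1, 0) : E × K) = P u (D.2 ∘L .fst ℝ E K + (twoForm a u (D.1, 0) +
        fderiv ℝ (twoForm a) u (P u ξ₁) (P u ξ₂))) + fderiv ℝ P u (P u ξ₁) ξ₂ := by
      rw [← hζv, ← hζ₀]
      exact hd1
    have hd3 := congrArg ξ₃ hd2
    have hsk2 := hsk (D.2 ∘L .fst ℝ E K + (twoForm a u (D.1, 0) +
        fderiv ℝ (twoForm a) u (P u ξ₁) (P u ξ₂))) ξ₃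
    have e₃' := DFunLike.congr_fun e₃ ((D.1, 0) : E × K)
    have h4 := twoForm_skew a u (D.1, 0) (P u ξ₃)
    simp only [map_add, add_apply, ContinuousLinearMap.comp_apply,
      ContinuousLinearMap.coe_fst'] at hd3 hsk2 e₃'
    simp only [courantTerm, (hσ _ h₁).1, (hσ _ h₃).1]
    change _ = D.2 (P u ξ₃).1 + η₃ D.1 + _
    linarith
  obtain ⟨η₁, h₁, e₁⟩ := key ξ₁
  obtain ⟨η₂, h₂, e₂⟩ := key ξ₂
  obtain ⟨η₃, h₃, e₃⟩ := key ξ₃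
  rw [main ξ₁ ξ₂ ξ₃ η₁ η₂ η₃ h₁ h₂ h₃ e₂ e₃, main ξ₂ ξ₃ ξ₁ η₂ η₃ η₁ h₂ h₃ h₁ e₃ e₁,
    main ξ₃ ξ₁ ξ₂ η₃ η₁ η₂ h₃ h₁ h₂ e₁ e₂]
  have h1 := hσint _ h₁ _ h₂ _ h₃
  have h2 := twoForm_closed ha (P u ξ₁) (P u ξ₂) (P u ξ₃)
  linarith

end LocalModel

/-! ### The infinitesimal Moser identity and smooth families of bivectors. -/

section LocalModel

variable {F : Type*} [NormedAddCommGroup F] [NormedSpace ℝ F]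

theorem skew_fderiv {G : Type*} [NormedAddCommGroup G] [NormedSpace ℝ G]
    {P : G → (F →L[ℝ] ℝ) →L[ℝ] F} {p : G} {D : G →L[ℝ] (F →L[ℝ] ℝ) →L[ℝ] F}
    (hP : HasFDerivAt P D p) (hsk : ∀ᶠ q in 𝓝 p, ∀ ξ η : F →L[ℝ] ℝ, η (P q ξ) = -ξ (P q η))
    (v : G) (ξ η : F →L[ℝ] ℝ) : η (D v ξ) = -ξ (D v η) := by
  have h1 : ∀ ξ η : F →L[ℝ] ℝ, HasFDerivAt (fun q => η (P q ξ)) (η ∘L D.flip ξ) p := fun ξ η => by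
    refine (η.hasFDerivAt.comp p (hP.clm_apply (hasFDerivAt_const ξ p))).congr_fderiv ?_
    ext w
    simp
  have h2 : (fun q => η (P q ξ)) =ᶠ[𝓝 p] fun q => -ξ (P q η) := hsk.mono fun q h => h ξ η
  have h3 := ((h1 ξ η).congr_of_eventuallyEq h2.symm).unique (h1 η ξ).neg
  exact DFunLike.congr_fun h3 v

/-- The infinitesimal form of Moser's argument: if the graph of the bivector field `P_t` is moved by
the gauge transformations generated by `db`, then the flow of `-P_t b` preserves `P_t`. -/
theorem moser_identity {P : ℝ × F → (F →L[ℝ] ℝ) →L[ℝ] F} {p : ℝ × F}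
    {D : ℝ × F →L[ℝ] (F →L[ℝ] ℝ) →L[ℝ] F} (hP : HasFDerivAt P D p)
    (hsk : ∀ᶠ q in 𝓝 p, ∀ ξ η : F →L[ℝ] ℝ, η (P q ξ) = -ξ (P q η))
    (hjac : ∀ ξ₁ ξ₂ ξ₃ : F →L[ℝ] ℝ, ξ₃ (D (0, P p ξ₁) ξ₂) + ξ₁ (D (0, P p ξ₂) ξ₃) +
      ξ₂ (D (0, P p ξ₃) ξ₁) = 0)
    {b : F → F →L[ℝ] ℝ} (hb : DifferentiableAt ℝ b p.2)
    (htime : ∀ ξ, D (1, 0) ξ = -P p (twoForm b p.2 (P p ξ))) (ξ : F →L[ℝ] ℝ) :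
    D (1, -P p (b p.2)) ξ =
      ((fderiv ℝ (fun q : ℝ × F => -P q (b q.2)) p).comp (.inr ℝ ℝ F)) (P p ξ) +
      P p (ξ ∘L ((fderiv ℝ (fun q : ℝ × F => -P q (b q.2)) p).comp (.inr ℝ ℝ F))) := by
  have hb' : HasFDerivAt (fun q : ℝ × F => b q.2) ((fderiv ℝ b p.2).comp (.snd ℝ ℝ F)) p :=
    hb.hasFDerivAt.comp p hasFDerivAt_snd
  have hX := ((hP.clm_apply hb').fun_neg).fderiv
  have hX' : ∀ v, ((fderiv ℝ (fun q : ℝ × F => -P q (b q.2)) p).comp (.inr ℝ ℝ F)) v =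
      -(P p (fderiv ℝ b p.2 v) + D (0, v) (b p.2)) := by
    intro v
    have := DFunLike.congr_fun hX ((0, v) : ℝ × F)
    exact this
  set C := (fderiv ℝ (fun q : ℝ × F => -P q (b q.2)) p).comp (.inr ℝ ℝ F)
  have hs := hsk.self_of_nhds
  -- After pairing with `η`, skewness brings all terms to a common form. What remains is the Jacobi
  -- identity for the three covectors `b p.2`, `ξ`, `η`.
  refine eq_of_forall_clm fun η => ?_
  have h1 : D (1, -P p (b p.2)) = D (1, 0) - D (0, P p (b p.2)) := by
    rw [show ((1, -P p (b p.2)) : ℝ × F) = (1, 0) - (0, P p (b p.2)) by simp]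
    exact map_sub D _ _
  have h2 := hs (ξ ∘L C) η
  have h3 := hX' (P p η)
  have h3' := congrArg ξ h3
  have h4 := hs (twoForm b p.2 (P p ξ)) η
  have h5 := hs (fderiv ℝ b p.2 (P p ξ)) η
  have h6 := hs (fderiv ℝ b p.2 (P p η)) ξ
  have h7 := skew_fderiv hP hsk (0, P p ξ) η (b p.2)
  have h8 := hjac (b p.2) ξ η
  rw [h1, hX', sub_apply, htime]
  rw [twoForm_apply] at h4
  simp only [ContinuousLinearMap.comp_apply, map_neg, map_add, map_sub] at *
  linarith

theorem hasDerivAt_slice {G V : Type*} [NormedAddCommGroup G] [NormedSpace ℝ G]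
    [NormedAddCommGroup V] [NormedSpace ℝ V] {P : ℝ × G → V} {D : ℝ × G →L[ℝ] V} {t : ℝ} {u : G}
    (hP : HasFDerivAt P D (t, u)) : HasDerivAt (fun s => P (s, u)) (D (1, 0)) t :=
  HasFDerivAt.comp_hasDerivAt (f := fun s : ℝ => ((s, u) : ℝ × G)) t hP
    ((hasDerivAt_id t).prodMk (hasDerivAt_const t u))

/-- The gauge relation reads `P_s ξ = P_t ξ - (s - t) P_s (C (P_t ξ))`. At `s = t` the product rule
leaves only the derivative of the factor `s - t`. -/
theorem fderiv_time {G : Type*} [NormedAddCommGroup G] [NormedSpace ℝ G]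
    {P : ℝ × G → (F →L[ℝ] ℝ) →L[ℝ] F} {C : F →L[ℝ] F →L[ℝ] ℝ} {t : ℝ} {u : G}
    {D : ℝ × G →L[ℝ] (F →L[ℝ] ℝ) →L[ℝ] F} (hP : HasFDerivAt P D (t, u)) (ξ : F →L[ℝ] ℝ)
    (hgauge : ∀ᶠ s in 𝓝 t, P (t, u) ξ = P (s, u) (ξ + (s - t) • C (P (t, u) ξ))) :
    D (1, 0) ξ = -P (t, u) (C (P (t, u) ξ)) := by
  have h1 : HasDerivAt (fun s => P (s, u)) (D (1, 0)) t :=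
    hasDerivAt_slice (V := (F →L[ℝ] ℝ) →L[ℝ] F) hP
  have hev : (fun s => P (s, u) ξ) =ᶠ[𝓝 t]
      fun s => P (t, u) ξ - (s - t) • P (s, u) (C (P (t, u) ξ)) := by
    filter_upwards [hgauge] with s hs
    have h4 := hs
    rw [map_add, map_smul] at h4
    exact eq_sub_of_add_eq h4.symm
  have h5 : HasDerivAt (fun s => P (s, u) ξ) (D (1, 0) ξ) t := by
    have := h1.clm_apply (hasDerivAt_const t ξ)
    simpa using this
  have h6 : HasDerivAt (fun s => P (t, u) ξ - (s - t) • P (s, u) (C (P (t, u) ξ)))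
      (-P (t, u) (C (P (t, u) ξ))) t := by
    have h7 := ((hasDerivAt_id t).sub_const t).fun_smul
      (h1.clm_apply (hasDerivAt_const t (C (P (t, u) ξ))))
    have h8 := (hasDerivAt_const t (P (t, u) ξ)).fun_sub h7
    simpa using h8
  exact (h5.congr_of_eventuallyEq hev.symm).unique h6

variable {E K : Type*} [NormedAddCommGroup E] [NormedSpace ℝ E] [NormedAddCommGroup K]
  [NormedSpace ℝ K]

/-- Gauge transformations compose additively, so adding `(s - t) • C` moves the structure at time
`t` to the one at time `s`. There the vector part is determined by the covector. -/
theorem LiftRel.eq_sharp_gauge {Λ : Submodule ℝ (E × (E →L[ℝ] ℝ))} (hΛ : IsIsotropic Λ)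
    {B C : E × K →L[ℝ] E × K →L[ℝ] ℝ} (hB : ∀ X Y, B X Y = -B Y X)
    (hC : ∀ X Y, C X Y = -C Y X) {P Q : (E × K →L[ℝ] ℝ) →L[ℝ] E × K} {t s : ℝ}
    (hP : ∀ ξ, LiftRel Λ (B + t • C) (P ξ) ξ) (hQ : ∀ ξ, LiftRel Λ (B + s • C) (Q ξ) ξ)
    (ξ : E × K →L[ℝ] ℝ) : P ξ = Q (ξ + (s - t) • C (P ξ)) := by
  have h2 := (hP ξ).gauge ((s - t) • C)
  have h3 : B + t • C + (s - t) • C = B + s • C := by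
    module
  rw [h3] at h2
  exact LiftRel.eq_sharp hΛ (fun X Y => by
    have h4 : ∀ X Y, (B + s • C) X Y = B X Y + s * C X Y := fun _ _ => rfl
    rw [h4, h4, hB X Y, hC X Y]; ring) hQ h2

/-- A Dirac structure on an open subset of a vector space. -/
structure IsDiracOn (Λ : E → Submodule ℝ (E × (E →L[ℝ] ℝ))) (O : Set E) : Prop where
  isOpen : IsOpen O
  isotropic : ∀ y ∈ O, IsIsotropic (Λ y)
  finrank_eq : ∀ y ∈ O, Module.finrank ℝ (Λ y) = Module.finrank ℝ E
  exists_sections : ∀ x ∈ O, ∃ σ : E × (E →L[ℝ] ℝ) → E → E × (E →L[ℝ] ℝ),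
      (∀ a ∈ Λ x, σ a x = a ∧ ∀ᶠ y in 𝓝 x, ContDiffAt ℝ ∞ (σ a) y ∧ σ a y ∈ Λ y) ∧
      ∀ a ∈ Λ x, ∀ b ∈ Λ x, ∀ c ∈ Λ x, courantTerm (σ a) (σ b) (σ c) x +
        courantTerm (σ b) (σ c) (σ a) x + courantTerm (σ c) (σ a) (σ b) x = 0

theorem IsDiracOn.mono {Λ : E → Submodule ℝ (E × (E →L[ℝ] ℝ))} {O O' : Set E}
    (h : IsDiracOn Λ O) (hO' : IsOpen O') (hs : O' ⊆ O) : IsDiracOn Λ O' :=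
  ⟨hO', fun y hy => h.isotropic y (hs hy), fun y hy => h.finrank_eq y (hs hy),
    fun y hy => h.exists_sections y (hs hy)⟩

/-- The bivector with graph `τ_B (π^*Λ)`, if there is one. -/
def liftSharp (Λ : Submodule ℝ (E × (E →L[ℝ] ℝ))) (B : E × K →L[ℝ] E × K →L[ℝ] ℝ) :
    (E × K →L[ℝ] ℝ) →L[ℝ] E × K :=
  open Classical in
  if h : ∃ P : (E × K →L[ℝ] ℝ) →L[ℝ] E × K, ∀ ξ, LiftRel Λ B (P ξ) ξ then h.choose else 0

theorem liftSharp_eq {Λ : Submodule ℝ (E × (E →L[ℝ] ℝ))} {B : E × K →L[ℝ] E × K →L[ℝ] ℝ}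
    (hΛ : IsIsotropic Λ) (hB : ∀ X Y, B X Y = -B Y X)
    {P : (E × K →L[ℝ] ℝ) →L[ℝ] E × K} (hP : ∀ ξ, LiftRel Λ B (P ξ) ξ) :
    liftSharp Λ B = P := by
  have h : ∃ P : (E × K →L[ℝ] ℝ) →L[ℝ] E × K, ∀ ξ, LiftRel Λ B (P ξ) ξ := ⟨P, hP⟩
  rw [liftSharp, dif_pos h]
  ext1 ξ
  exact LiftRel.eq_sharp hΛ hB hP (h.choose_spec ξ)

variable [FiniteDimensional ℝ E] [FiniteDimensional ℝ K]

/-- The bivector is a smooth function of parameters near a point of transversality. -/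
theorem IsDiracOn.eventually_liftSharp {G : Type*} [NormedAddCommGroup G] [NormedSpace ℝ G]
    {Λ : E → Submodule ℝ (E × (E →L[ℝ] ℝ))} {O : Set E} (hΛ : IsDiracOn Λ O)
    {q : G → E} {g₀ : G} (hq₀ : q g₀ ∈ O) (hq : ∀ᶠ g in 𝓝 g₀, ContDiffAt ℝ ∞ q g)
    {B : G → E × K →L[ℝ] E × K →L[ℝ] ℝ} (hB : ∀ᶠ g in 𝓝 g₀, ContDiffAt ℝ ∞ B g)
    (hsk : ∀ g X Y, B g X Y = -B g Y X)
    (htr : ∀ X, LiftRel (Λ (q g₀)) (B g₀) X 0 → X = 0) :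
    ∀ᶠ g in 𝓝 g₀, ContDiffAt ℝ ∞ (fun g => liftSharp (Λ (q g)) (B g)) g ∧
      ∀ ξ, LiftRel (Λ (q g)) (B g) (liftSharp (Λ (q g)) (B g) ξ) ξ := by
  obtain ⟨σ, hσ, -⟩ := hΛ.exists_sections _ hq₀
  obtain ⟨P, hP⟩ := exists_smooth_sharp (hΛ.finrank_eq _ hq₀)
    (fun a ha => ⟨σ a, hσ a ha⟩) rfl hq hB htr
  have hO : ∀ᶠ g in 𝓝 g₀, q g ∈ O :=
    hq.self_of_nhds.continuousAt (hΛ.isOpen.mem_nhds hq₀)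
  have hev : ∀ᶠ g in 𝓝 g₀, liftSharp (Λ (q g)) (B g) = P g := by
    filter_upwards [hP, hO] with g hg hgO
    exact liftSharp_eq (hΛ.isotropic _ hgO) (hsk g) hg.2
  filter_upwards [hev.eventually_nhds, hP] with g hg hPg
  refine ⟨hPg.1.congr_of_eventuallyEq hg, fun ξ => ?_⟩
  rw [hg.self_of_nhds]
  exact hPg.2 ξ

end LocalModel

/-! ### Uniqueness for differential equations and transport of bivectors along a flow. -/

section LocalModel

theorem linear_ode_unique {V : Type*} [NormedAddCommGroup V] [NormedSpace ℝ V]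
    {L : ℝ → V →L[ℝ] V} (hL : ContinuousOn L (Icc 0 1)) {f g : ℝ → V}
    (hf : ∀ t ∈ Icc (0 : ℝ) 1, HasDerivWithinAt f (L t (f t)) (Icc 0 1) t)
    (hg : ∀ t ∈ Icc (0 : ℝ) 1, HasDerivWithinAt g (L t (g t)) (Icc 0 1) t) (h0 : f 0 = g 0) :
    f 1 = g 1 := by
  obtain ⟨C, hC⟩ := isCompact_Icc.exists_bound_of_continuousOn hL
  have hlip : ∀ t ∈ Ico (0 : ℝ) 1, LipschitzOnWith (Real.toNNReal C) (fun v => L t v) univ := by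
    intro t ht
    refine LipschitzOnWith.of_dist_le_mul fun v _ w _ => ?_
    rw [dist_eq_norm, dist_eq_norm, ← map_sub]
    refine (L t).le_of_opNorm_le ((hC t (Ico_subset_Icc_self ht)).trans ?_) _
    exact Real.le_coe_toNNReal C
  have hder : ∀ {f : ℝ → V} {v : V} {t : ℝ}, t ∈ Ico (0 : ℝ) 1 →
      HasDerivWithinAt f v (Icc 0 1) t → HasDerivWithinAt f v (Ici t) t := by
    intro f v t ht h
    refine h.mono_of_mem_nhdsWithin ?_
    exact Filter.mem_of_superset (Icc_mem_nhdsGE ht.2) (Icc_subset_Icc_left ht.1)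
  exact ODE_solution_unique_of_mem_Icc_right (s := fun _ => univ) hlip
    (fun t ht => (hf t ht).continuousWithinAt)
    (fun t ht => hder ht (hf t (Ico_subset_Icc_self ht))) (fun _ _ => mem_univ _)
    (fun t ht => (hg t ht).continuousWithinAt)
    (fun t ht => hder ht (hg t (Ico_subset_Icc_self ht))) (fun _ _ => mem_univ _) h0
    ⟨zero_le_one, le_rfl⟩

/-- Both `A_t R_0 tr(A_t)` and `R_t` solve the linear equation `R' = C R + R tr(C)` with the same
initial value. The space `F'` stands for the dual of `F`, and `tr` for transposition. -/
theorem eq_of_transport_aux {F F' : Type*} [NormedAddCommGroup F] [NormedSpace ℝ F]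
    [FiniteDimensional ℝ F] [NormedAddCommGroup F'] [NormedSpace ℝ F'] [FiniteDimensional ℝ F']
    (tr : (F →L[ℝ] F) →L[ℝ] (F' →L[ℝ] F')) (htr : tr (.id ℝ F) = .id ℝ F')
    {C A : ℝ → F →L[ℝ] F} (hC : ContinuousOn C (Icc 0 1)) (hA₀ : A 0 = .id ℝ F)
    (hA : ∀ t ∈ Icc (0 : ℝ) 1, HasDerivWithinAt A ((C t).comp (A t)) (Icc 0 1) t)
    (hmul : ∀ S T, tr (S.comp T) = (tr T).comp (tr S)) {R : ℝ → F' →L[ℝ] F}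
    (hR : ∀ t ∈ Icc (0 : ℝ) 1, ∀ ξ,
      HasDerivWithinAt (fun s => R s ξ) (C t (R t ξ) + R t (tr (C t) ξ)) (Icc 0 1) t)
    (ξ : F') : A 1 (R 0 (tr (A 1) ξ)) = R 1 ξ := by
  let M₁ := ContinuousLinearMap.compL ℝ F' F F
  let M₂ := (ContinuousLinearMap.compL ℝ F' F' F).flip
  let L : ℝ → (F' →L[ℝ] F) →L[ℝ] (F' →L[ℝ] F) := fun t => M₁ (C t) + M₂ (tr (C t))
  have hL : ContinuousOn L (Icc 0 1) := by
    refine ContinuousOn.add ?_ ?_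
    · exact M₁.continuous.comp_continuousOn hC
    · exact (M₂.continuous.comp tr.continuous).comp_continuousOn hC
  have h := linear_ode_unique (V := F' →L[ℝ] F) (L := L) hL
    (f := fun t => (A t).comp ((R 0).comp (tr (A t)))) (g := R) ?_ ?_ ?_
  · exact DFunLike.congr_fun h ξ
  · intro t ht
    refine hasDerivWithinAt_clm_of_apply (F := F') (G := F) fun ζ => ?_
    have h0 : HasDerivWithinAt (fun s => tr (A s)) (tr ((C t).comp (A t))) (Icc 0 1) t :=
      tr.hasFDerivAt.comp_hasDerivWithinAt t (hA t ht)
    have h1 : HasDerivWithinAt (fun s => tr (A s) ζ) (tr ((C t).comp (A t)) ζ) (Icc 0 1) t := by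
      have := h0.clm_apply (hasDerivWithinAt_const t (Icc 0 1) ζ)
      simpa using this
    have h2 : HasDerivWithinAt (fun s => R 0 (tr (A s) ζ)) (R 0 (tr ((C t).comp (A t)) ζ))
        (Icc 0 1) t := by
      have := (hasDerivWithinAt_const t (Icc 0 1) (R 0)).clm_apply h1
      simpa using this
    rw [hmul] at h2
    exact (hA t ht).clm_apply h2
  · intro t ht
    exact hasDerivWithinAt_clm_of_apply (F := F') (G := F) fun ζ => hR t ht ζ
  · change (A 0).comp ((R 0).comp (tr (A 0))) = R 0
    rw [hA₀, htr]
    ext1 ζ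
    rfl

/-- A bivector which satisfies the transport equation of a flow is moved by the flow. -/
theorem eq_of_transport {F : Type*} [NormedAddCommGroup F] [NormedSpace ℝ F]
    [FiniteDimensional ℝ F] {C A : ℝ → F →L[ℝ] F} (hC : ContinuousOn C (Icc 0 1))
    (hA₀ : A 0 = .id ℝ F)
    (hA : ∀ t ∈ Icc (0 : ℝ) 1, HasDerivWithinAt A ((C t).comp (A t)) (Icc 0 1) t)
    {R : ℝ → (F →L[ℝ] ℝ) →L[ℝ] F}
    (hR : ∀ t ∈ Icc (0 : ℝ) 1, ∀ ξ,
      HasDerivWithinAt (fun s => R s ξ) (C t (R t ξ) + R t (ξ ∘L C t)) (Icc 0 1) t)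
    (ξ : F →L[ℝ] ℝ) : A 1 (R 0 (ξ ∘L A 1)) = R 1 ξ :=
  eq_of_transport_aux (F := F) (F' := F →L[ℝ] ℝ) ((ContinuousLinearMap.compL ℝ F F ℝ).flip)
    (by ext1 ζ; rfl) hC hA₀ hA (fun S T => by ext1 ζ; rfl) hR ξ

/-- A smooth field is locally Lipschitz, so solutions agree on a short interval to the right. Only
right-hand data are used, which suits curves defined on `[0, 1]`. -/
theorem eventually_eq_of_ode {F : Type*} [NormedAddCommGroup F] [NormedSpace ℝ F]
    {f : ℝ × F → F} {t₀ : ℝ} {u w : ℝ → F} (hf : ContDiffAt ℝ ∞ f (t₀, u t₀))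
    (hu : ∀ᶠ t in 𝓝[≥] t₀, HasDerivWithinAt u (f (t, u t)) (Ici t) t)
    (hw : ∀ᶠ t in 𝓝[≥] t₀, HasDerivWithinAt w (f (t, w t)) (Ici t) t) (h₀ : u t₀ = w t₀)
    (huc : ∀ᶠ t in 𝓝[≥] t₀, ContinuousWithinAt u (Ici t₀) t)
    (hwc : ∀ᶠ t in 𝓝[≥] t₀, ContinuousWithinAt w (Ici t₀) t) :
    ∀ᶠ t in 𝓝[>] t₀, u t = w t := by
  obtain ⟨K, s, hs, hK⟩ := (hf.of_le (m := 1) (by simp)).exists_lipschitzOnWith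
  obtain ⟨S, hS, T, hT, hST⟩ := mem_nhds_prod_iff.1 hs
  have hu' : ∀ᶠ t in 𝓝[≥] t₀, u t ∈ T := huc.self_of_nhdsWithin self_mem_Ici hT
  have hw' : ∀ᶠ t in 𝓝[≥] t₀, w t ∈ T :=
    hwc.self_of_nhdsWithin self_mem_Ici (by rw [← h₀]; exact hT)
  have hS' : ∀ᶠ t in 𝓝[≥] t₀, t ∈ S := mem_nhdsWithin_of_mem_nhds hS
  obtain ⟨t₁, ht₁, h⟩ := mem_nhdsGE_iff_exists_Icc_subset.1
    (hu.and (hw.and (huc.and (hwc.and (hu'.and (hw'.and hS'))))))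
  have key : EqOn u w (Icc t₀ t₁) := by
    refine ODE_solution_unique_of_mem_Icc_right (v := fun t x => f (t, x)) (s := fun _ => T)
      (K := K) ?_ ?_ ?_ ?_ ?_ ?_ ?_ h₀
    · intro t ht x hx y hy
      have := hK (x := (t, x)) (hST ⟨(h (Ico_subset_Icc_self ht)).2.2.2.2.2.2, hx⟩)
        (y := (t, y)) (hST ⟨(h (Ico_subset_Icc_self ht)).2.2.2.2.2.2, hy⟩)
      simpa [Prod.edist_eq] using this
    · exact fun t ht => (h ht).2.2.1.mono Icc_subset_Ici_self
    · exact fun t ht => (h (Ico_subset_Icc_self ht)).1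
    · exact fun t ht => (h (Ico_subset_Icc_self ht)).2.2.2.2.1
    · exact fun t ht => (h ht).2.2.2.1.mono Icc_subset_Ici_self
    · exact fun t ht => (h (Ico_subset_Icc_self ht)).2.1
    · exact fun t ht => (h (Ico_subset_Icc_self ht)).2.2.2.2.2.1
  filter_upwards [Ioo_mem_nhdsGT ht₁] with t ht
  exact key (Ioo_subset_Icc_self ht)

end LocalModel

/-! ### The linear family of exact two-forms. -/

section Moser

variable {F : Type*} [NormedAddCommGroup F] [NormedSpace ℝ F]

theorem contDiffAt_add_fst_smul {W : Type*} [NormedAddCommGroup W] [NormedSpace ℝ W]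
    {A B : F → W} {g : ℝ × F} (hA : ContDiffAt ℝ ∞ A g.2) (hB : ContDiffAt ℝ ∞ B g.2) :
    ContDiffAt ℝ ∞ (fun g : ℝ × F => A g.2 + g.1 • B g.2) g :=
  (hA.comp g contDiffAt_snd).add (contDiffAt_fst.smul (hB.comp g contDiffAt_snd))

/-- The two-forms `d(a + t b)`. -/
def gaugeFamily (a b : F → F →L[ℝ] ℝ) (g : ℝ × F) : F →L[ℝ] F →L[ℝ] ℝ :=
  twoForm a g.2 + g.1 • twoForm b g.2

theorem gaugeFamily_apply (a b : F → F →L[ℝ] ℝ) (g : ℝ × F) (X Y : F) :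
    gaugeFamily a b g X Y = twoForm a g.2 X Y + g.1 * twoForm b g.2 X Y := rfl

theorem gaugeFamily_skew (a b : F → F →L[ℝ] ℝ) (g : ℝ × F) (X Y : F) :
    gaugeFamily a b g X Y = -gaugeFamily a b g Y X := by
  rw [gaugeFamily_apply, gaugeFamily_apply, twoForm_skew a, twoForm_skew b]
  ring

theorem contDiffAt_gaugeFamily {a b : F → F →L[ℝ] ℝ} {g : ℝ × F}
    (ha : ContDiffAt ℝ ∞ a g.2) (hb : ContDiffAt ℝ ∞ b g.2) :
    ContDiffAt ℝ ∞ (gaugeFamily a b) g := by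
  exact contDiffAt_add_fst_smul (W := F →L[ℝ] F →L[ℝ] ℝ) (contDiffAt_twoForm ha)
    (contDiffAt_twoForm hb)

/-- At each fixed time the gauging form is exact, so `jacobi_of_liftRel` applies to every member of
the family. -/
theorem gaugeFamily_eq_twoForm {a b : F → F →L[ℝ] ℝ} {u : F}
    (ha : ContDiffAt ℝ ∞ a u) (hb : ContDiffAt ℝ ∞ b u) (t : ℝ) :
    gaugeFamily a b (t, u) = twoForm (a + t • b) u := by
  have h : fderiv ℝ (a + t • b) u = fderiv ℝ a u + t • fderiv ℝ b u := by
    have h1 := (ha.differentiableAt (by simp)).hasFDerivAt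
    have h2 := (hb.differentiableAt (by simp)).hasFDerivAt
    exact (h1.add (h2.const_smul t)).fderiv
  ext1 X
  ext1 Y
  rw [gaugeFamily_apply, twoForm_apply, twoForm_apply, twoForm_apply, h]
  simp only [add_apply, smul_apply, smul_eq_mul]
  ring

end Moser

/-! ### Moser's argument in a vector space. -/

section Moser

theorem hasFDerivAt_slice {G V : Type*} [NormedAddCommGroup G] [NormedSpace ℝ G]
    [NormedAddCommGroup V] [NormedSpace ℝ V] {P : ℝ × G → V} {D : ℝ × G →L[ℝ] V} {t : ℝ} {u : G}
    (hP : HasFDerivAt P D (t, u)) :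
    HasFDerivAt (fun w => P (t, w)) (D.comp (.inr ℝ ℝ G)) u :=
  HasFDerivAt.comp (f := fun w : G => ((t, w) : ℝ × G)) u hP
    ((hasFDerivAt_const t u).prodMk (hasFDerivAt_id u))

theorem contDiffAt_add_const_smul {F V : Type*} [NormedAddCommGroup F] [NormedSpace ℝ F]
    [NormedAddCommGroup V] [NormedSpace ℝ V] {a b : F → V} {u : F}
    (ha : ContDiffAt ℝ ∞ a u) (hb : ContDiffAt ℝ ∞ b u) (t : ℝ) :
    ContDiffAt ℝ ∞ (a + t • b) u :=
  ha.add (contDiffAt_const.smul hb)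

variable {E : Type u} {K : Type u} [NormedAddCommGroup E] [NormedSpace ℝ E] [NormedAddCommGroup K]
  [NormedSpace ℝ K] [FiniteDimensional ℝ E] [FiniteDimensional ℝ K]

theorem hasDerivWithinAt_apply_along {G F V : Type*} [NormedAddCommGroup G] [NormedSpace ℝ G]
    [NormedAddCommGroup F] [NormedSpace ℝ F] [NormedAddCommGroup V] [NormedSpace ℝ V]
    {P : G → V →L[ℝ] F} {D : G →L[ℝ] V →L[ℝ] F} {c : ℝ → G} {c' : G} {S : Set ℝ} {t : ℝ}
    (hP : HasFDerivAt P D (c t)) (hc : HasDerivWithinAt c c' S t) (ξ : V) :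
    HasDerivWithinAt (fun s => P (c s) ξ) (D c' ξ) S t := by
  have h := (hP.comp_hasDerivWithinAt t hc).clm_apply (hasDerivWithinAt_const t S ξ)
  simpa using h

/-- The bivector with graph `τ_{d(a + t b)} (π^*Λ)`. -/
def moserSharp (Λ : E → Submodule ℝ (E × (E →L[ℝ] ℝ))) (a b : E × K → E × K →L[ℝ] ℝ)
    (g : ℝ × (E × K)) : (E × K →L[ℝ] ℝ) →L[ℝ] E × K :=
  liftSharp (Λ g.2.1) (gaugeFamily a b g)

/-- Near `g`, the bivector field with graph `τ_{d(a + t b)} (π^*Λ)` exists and is smooth. -/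
def MoserGood (Λ : E → Submodule ℝ (E × (E →L[ℝ] ℝ))) (a b : E × K → E × K →L[ℝ] ℝ)
    (g : ℝ × (E × K)) : Prop :=
  ∀ᶠ h in 𝓝 g, ContDiffAt ℝ ∞ (moserSharp Λ a b) h ∧
    ∀ ξ, LiftRel (Λ h.2.1) (gaugeFamily a b h) (moserSharp Λ a b h ξ) ξ

variable {Λ : E → Submodule ℝ (E × (E →L[ℝ] ℝ))} {a b : E × K → E × K →L[ℝ] ℝ} {O : Set E}

theorem isOpen_moserGood : IsOpen {g | MoserGood Λ a b g} :=
  isOpen_iff_mem_nhds.2 fun _ hg => hg.eventually_nhds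

theorem IsDiracOn.moserGood (hΛ : IsDiracOn Λ O) (ha : ∀ u, u.1 ∈ O → ContDiffAt ℝ ∞ a u)
    (hb : ∀ u, u.1 ∈ O → ContDiffAt ℝ ∞ b u) {g : ℝ × (E × K)} (hg : g.2.1 ∈ O)
    (htr : ∀ X, LiftRel (Λ g.2.1) (gaugeFamily a b g) X 0 → X = 0) : MoserGood Λ a b g := by
  have hO : ∀ᶠ h : ℝ × (E × K) in 𝓝 g, h.2.1 ∈ O :=
    (continuous_fst.comp continuous_snd).continuousAt (hΛ.isOpen.mem_nhds hg)
  exact hΛ.eventually_liftSharp (q := fun g : ℝ × (E × K) => g.2.1) hg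
    (Filter.Eventually.of_forall fun h => contDiffAt_fst.comp h contDiffAt_snd)
    (hO.mono fun h hh => contDiffAt_gaugeFamily (ha _ hh) (hb _ hh)) (gaugeFamily_skew a b) htr

theorem MoserGood.eq_sharp (hΛ : IsDiracOn Λ O) {g : ℝ × (E × K)} (h : MoserGood Λ a b g)
    (hg : g.2.1 ∈ O) {X : E × K} {ζ : E × K →L[ℝ] ℝ}
    (hX : LiftRel (Λ g.2.1) (gaugeFamily a b g) X ζ) : X = moserSharp Λ a b g ζ :=
  LiftRel.eq_sharp (hΛ.isotropic _ hg) (gaugeFamily_skew a b g) h.self_of_nhds.2 hX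

/-- This is `moser_identity` for the actual family: the Jacobi identity comes from exactness on each
time slice, and the time derivative from the gauge relation between neighbouring times. -/
theorem MoserGood.identity (hΛ : IsDiracOn Λ O) (ha : ∀ u, u.1 ∈ O → ContDiffAt ℝ ∞ a u)
    (hb : ∀ u, u.1 ∈ O → ContDiffAt ℝ ∞ b u) {g : ℝ × (E × K)} (h : MoserGood Λ a b g)
    (hg : g.2.1 ∈ O) (ξ : E × K →L[ℝ] ℝ) :
    fderiv ℝ (moserSharp Λ a b) g (1, -moserSharp Λ a b g (b g.2)) ξ =
      ((fderiv ℝ (fun q : ℝ × (E × K) => -moserSharp Λ a b q (b q.2)) g).comp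
        (.inr ℝ ℝ (E × K))) (moserSharp Λ a b g ξ) +
      moserSharp Λ a b g (ξ ∘L ((fderiv ℝ (fun q : ℝ × (E × K) =>
        -moserSharp Λ a b q (b q.2)) g).comp (.inr ℝ ℝ (E × K)))) := by
  have hO : ∀ᶠ h : ℝ × (E × K) in 𝓝 g, h.2.1 ∈ O :=
    (continuous_fst.comp continuous_snd).continuousAt (hΛ.isOpen.mem_nhds hg)
  have hP : HasFDerivAt (moserSharp Λ a b) (fderiv ℝ (moserSharp Λ a b) g) g :=
    (h.self_of_nhds.1.differentiableAt (by simp)).hasFDerivAt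
  obtain ⟨t, u⟩ := g
  refine moser_identity (F := E × K) hP ?_ ?_ ((hb _ hg).differentiableAt (by simp)) ?_ ξ
  · filter_upwards [h, hO] with q hq hqO
    exact LiftRel.skew (hΛ.isotropic _ hqO) (gaugeFamily_skew a b q) hq.2
  · have hslice : ContinuousAt (fun w : E × K => ((t, w) : ℝ × (E × K))) u :=
      (Continuous.prodMk_right t).continuousAt
    have hPu : HasFDerivAt (fun w => moserSharp Λ a b (t, w))
        ((fderiv ℝ (moserSharp Λ a b) (t, u)).comp (.inr ℝ ℝ (E × K))) u :=
      hasFDerivAt_slice (V := (E × K →L[ℝ] ℝ) →L[ℝ] E × K) hP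
    have hj := jacobi_of_liftRel (Λ := Λ) (u := u) (a := a + t • b)
      (P := fun w => moserSharp Λ a b (t, w))
      ((hΛ.isOpen.eventually_mem hg).mono fun w hw => hΛ.isotropic _ hw)
      (hΛ.exists_sections _ hg)
      (contDiffAt_add_const_smul (V := E × K →L[ℝ] ℝ) (ha _ hg) (hb _ hg) t) hPu.differentiableAt ?_
    · intro ξ₁ ξ₂ ξ₃
      have := hj ξ₁ ξ₂ ξ₃
      rw [hPu.fderiv] at this
      exact this
    · filter_upwards [hslice.eventually h, hslice.eventually hO] with w hw hwO
      rw [← gaugeFamily_eq_twoForm (ha _ hwO) (hb _ hwO)]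
      exact hw.2
  · intro ξ
    refine fderiv_time (F := E × K) hP ξ ?_
    have hline : ContinuousAt (fun s : ℝ => ((s, u) : ℝ × (E × K))) t :=
      (Continuous.prodMk_left u).continuousAt
    filter_upwards [hline.eventually h] with s hs
    exact LiftRel.eq_sharp_gauge (hΛ.isotropic _ hg) (twoForm_skew a u) (twoForm_skew b u)
      h.self_of_nhds.2 hs.2 ξ

theorem MoserGood.contDiffAt_field
    (hb : ∀ u, u.1 ∈ O → ContDiffAt ℝ ∞ b u) {g : ℝ × (E × K)} (h : MoserGood Λ a b g)
    (hg : g.2.1 ∈ O) :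
    ContDiffAt ℝ ∞ (fun q : ℝ × (E × K) => -moserSharp Λ a b q (b q.2)) g := by
  have h1 := h.self_of_nhds.1
  have h2 : ContDiffAt ℝ ∞ (fun q : ℝ × (E × K) => b q.2) g := (hb _ hg).comp g contDiffAt_snd
  exact (h1.clm_apply h2).neg

/-- Moser's argument: the Dirac structures `τ_{da} (π^*Λ)` and `τ_{d(a + b)} (π^*Λ)` are isomorphic
near a point where `b` vanishes. -/
theorem exists_local_moser (hΛ : IsDiracOn Λ O) (ha : ∀ u, u.1 ∈ O → ContDiffAt ℝ ∞ a u)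
    (hb : ∀ u, u.1 ∈ O → ContDiffAt ℝ ∞ b u) {u₀ : E × K} (hu₀ : u₀.1 ∈ O) (hb₀ : b u₀ = 0)
    (htr : ∀ t ∈ Icc (0 : ℝ) 1, ∀ X, LiftRel (Λ u₀.1) (gaugeFamily a b (t, u₀)) X 0 → X = 0)
    {G : Set (E × K)} (hG : IsOpen G) (hu₀G : u₀ ∈ G) :
    ∃ (N : Set (E × K)) (Φ : ℝ → E × K → E × K) (A : E × K → E × K →L[ℝ] E × K),
      IsOpen N ∧ u₀ ∈ N ∧ ContDiffOn ℝ ∞ (Φ 1) N ∧ ∀ x ∈ N, Φ 0 x = x ∧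
      HasFDerivAt (Φ 1) (A x) x ∧
      (∀ t ∈ Icc (0 : ℝ) 1, (Φ t x).1 ∈ O ∧ Φ t x ∈ G ∧
        (∀ X, LiftRel (Λ (Φ t x).1) (gaugeFamily a b (t, Φ t x)) X 0 → X = 0) ∧
        ∃ v, HasDerivWithinAt (fun s => Φ s x) v (Icc 0 1) t ∧
          LiftRel (Λ (Φ t x).1) (gaugeFamily a b (t, Φ t x)) v (-b (Φ t x))) ∧
      ∀ P₀ P₁ : (E × K →L[ℝ] ℝ) →L[ℝ] E × K,
        (∀ ξ, LiftRel (Λ x.1) (gaugeFamily a b (0, x)) (P₀ ξ) ξ) →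
        (∀ ξ, LiftRel (Λ (Φ 1 x).1) (gaugeFamily a b (1, Φ 1 x)) (P₁ ξ) ξ) →
        ∀ ξ, A x (P₀ (ξ ∘L A x)) = P₁ ξ := by
  -- Trajectories have to remain where the bivectors exist and are smooth, over `O`, and in the
  -- prescribed set `G`.
  let U : Set (ℝ × (E × K)) := {g | MoserGood Λ a b g} ∩ {g | g.2.1 ∈ O} ∩ {g | g.2 ∈ G}
  have hU : IsOpen U := (isOpen_moserGood.inter
    (hΛ.isOpen.preimage (continuous_fst.comp continuous_snd))).inter (hG.preimage continuous_snd)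
  let f : ℝ × (E × K) → E × K := fun q => -moserSharp Λ a b q (b q.2)
  have hf : ∀ g ∈ U, ContDiffAt ℝ ∞ f g := fun g hg => hg.1.1.contDiffAt_field hb hg.1.2
  -- Since `b` vanishes at `u₀`, this point is stationary. Transversality for all `t` keeps the
  -- whole segment above it in `U`.
  obtain ⟨N, Φ, A, hN, huN, hΦ, h⟩ := exists_local_flow (F := E × K) (f := f) hU
    (fun g hg => (hf g hg).contDiffWithinAt) (u₀ := u₀)
    (fun t ht => ⟨⟨hΛ.moserGood ha hb hu₀ (htr t ht), hu₀⟩, hu₀G⟩)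
    (fun t ht => by simp only [f, hb₀, map_zero, neg_zero])
  refine ⟨N, Φ, A 1, hN, huN, hΦ, fun x hx => ?_⟩
  obtain ⟨h1, h2, h3, h4⟩ := h x hx
  have h5 : ∀ t ∈ Icc (0 : ℝ) 1, ∀ ξ, LiftRel (Λ (Φ t x).1) (gaugeFamily a b (t, Φ t x))
      (moserSharp Λ a b (t, Φ t x) ξ) ξ := fun t ht => ((h4 t ht).1.1.1).self_of_nhds.2
  refine ⟨h1, h3, fun t ht => ?_, fun P₀ P₁ hP₀ hP₁ => ?_⟩
  · obtain ⟨h6, h7, h8⟩ := h4 t ht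
    refine ⟨h6.1.2, h6.2, fun X hX => ?_, f (t, Φ t x), h7, ?_⟩
    · rw [h6.1.1.eq_sharp hΛ h6.1.2 hX, map_zero]
    · have h9 := h5 t ht (-b (Φ t x))
      rw [map_neg] at h9
      exact h9
  · have hi : ∀ t ∈ Icc (0 : ℝ) 1, IsIsotropic (Λ (Φ t x).1) := fun t ht =>
      hΛ.isotropic _ (h4 t ht).1.1.2
    have e₀ : moserSharp Λ a b (0, Φ 0 x) = P₀ := by
      have := hi 0 ⟨le_rfl, zero_le_one⟩
      rw [h1] at this ⊢
      exact liftSharp_eq this (gaugeFamily_skew a b _) hP₀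
    have e₁ : moserSharp Λ a b (1, Φ 1 x) = P₁ :=
      liftSharp_eq (hi 1 ⟨zero_le_one, le_rfl⟩) (gaugeFamily_skew a b _) hP₁
    have hcurve : ContinuousOn (fun t => ((t, Φ t x) : ℝ × (E × K))) (Icc 0 1) :=
      continuousOn_id.prodMk fun t ht => (h4 t ht).2.1.continuousWithinAt
    -- Along a trajectory, the total derivative of the bivector is its derivative in the direction
    -- `(1, f)`. `MoserGood.identity` turns it into the transport equation for the linearized flow.
    have key := eq_of_transport (F := E × K)
      (C := fun t => (fderiv ℝ f (t, Φ t x)).comp (.inr ℝ ℝ (E × K))) (A := fun t => A t x)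
      (R := fun t => moserSharp Λ a b (t, Φ t x)) ?_ h2 (fun t ht => (h4 t ht).2.2) ?_
    · intro ξ
      have := key ξ
      rw [e₀, e₁] at this
      exact this
    · intro t ht
      have hc : ContinuousAt (fun g => (fderiv ℝ f g).comp (.inr ℝ ℝ (E × K))) (t, Φ t x) := by
        have := ((hf _ (h4 t ht).1).fderiv_right (m := ∞) (by simp)).continuousAt
        exact this.clm_comp continuousAt_const
      exact hc.comp_continuousWithinAt (f := fun t => ((t, Φ t x) : ℝ × (E × K))) (hcurve t ht)
    · intro t ht ξ
      have hg := (h4 t ht).1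
      have hid := hg.1.1.identity hΛ ha hb hg.1.2 ξ
      have hPd : HasFDerivAt (moserSharp Λ a b) (fderiv ℝ (moserSharp Λ a b) (t, Φ t x))
          (t, Φ t x) := (hg.1.1.self_of_nhds.1.differentiableAt (by simp)).hasFDerivAt
      have hcd : HasDerivWithinAt (fun s => ((s, Φ s x) : ℝ × (E × K))) (1, f (t, Φ t x))
          (Icc 0 1) t := (hasDerivWithinAt_id t _).prodMk (h4 t ht).2.1
      have h10 := hasDerivWithinAt_apply_along (F := E × K) (V := (E × K →L[ℝ] ℝ)) hPd hcd ξ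
      rw [← hid]
      exact h10

/-- Near a transverse point the relation determines the velocity. Curves given only by the relation
are then solutions of one smooth differential equation. -/
theorem eventually_eq_of_moser (hΛ : IsDiracOn Λ O) (ha : ∀ u, u.1 ∈ O → ContDiffAt ℝ ∞ a u)
    (hb : ∀ u, u.1 ∈ O → ContDiffAt ℝ ∞ b u) {t₀ : ℝ} {u w : ℝ → E × K} (ht₀ : (u t₀).1 ∈ O)
    (htr : ∀ X, LiftRel (Λ (u t₀).1) (gaugeFamily a b (t₀, u t₀)) X 0 → X = 0)
    (hu : ∀ᶠ t in 𝓝[≥] t₀, ∃ v, HasDerivWithinAt u v (Ici t) t ∧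
      LiftRel (Λ (u t).1) (gaugeFamily a b (t, u t)) v (-b (u t)))
    (hw : ∀ᶠ t in 𝓝[≥] t₀, ∃ v, HasDerivWithinAt w v (Ici t) t ∧
      LiftRel (Λ (w t).1) (gaugeFamily a b (t, w t)) v (-b (w t))) (h₀ : u t₀ = w t₀)
    (huc : ∀ᶠ t in 𝓝[≥] t₀, ContinuousWithinAt u (Ici t₀) t)
    (hwc : ∀ᶠ t in 𝓝[≥] t₀, ContinuousWithinAt w (Ici t₀) t) :
    ∀ᶠ t in 𝓝[>] t₀, u t = w t := by
  have hgood : MoserGood Λ a b (t₀, u t₀) := hΛ.moserGood ha hb ht₀ htr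
  have hev : ∀ᶠ g : ℝ × (E × K) in 𝓝 (t₀, u t₀), MoserGood Λ a b g ∧ g.2.1 ∈ O :=
    (isOpen_moserGood.eventually_mem hgood).and
      ((continuous_fst.comp continuous_snd).continuousAt.eventually
        (hΛ.isOpen.eventually_mem ht₀))
  have main : ∀ {u : ℝ → E × K}, (∀ᶠ g : ℝ × (E × K) in 𝓝 (t₀, u t₀),
      MoserGood Λ a b g ∧ g.2.1 ∈ O) → (∀ᶠ t in 𝓝[≥] t₀, ∃ v, HasDerivWithinAt u v (Ici t) t ∧
      LiftRel (Λ (u t).1) (gaugeFamily a b (t, u t)) v (-b (u t))) →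
      (∀ᶠ t in 𝓝[≥] t₀, ContinuousWithinAt u (Ici t₀) t) →
      ∀ᶠ t in 𝓝[≥] t₀, HasDerivWithinAt u (-moserSharp Λ a b (t, u t) (b (u t))) (Ici t) t := by
    intro u hev hu huc
    have hcurve : ContinuousWithinAt (fun t => ((t, u t) : ℝ × (E × K))) (Ici t₀) t₀ :=
      continuousWithinAt_id.prodMk (huc.self_of_nhdsWithin self_mem_Ici)
    filter_upwards [hu, hcurve.eventually hev] with t ⟨v, hv, hl⟩ ht
    have := ht.1.eq_sharp hΛ ht.2 hl
    rw [map_neg] at this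
    rw [← this]
    exact hv
  refine eventually_eq_of_ode (hgood.contDiffAt_field hb ht₀) (main hev hu huc)
    (main (by rw [← h₀]; exact hev) hw hwc) h₀ huc hwc

end Moser

/-! ### Linear algebra along the zero section. -/

section Transversality

variable {E K : Type*} [NormedAddCommGroup E] [NormedSpace ℝ E] [NormedAddCommGroup K]
  [NormedSpace ℝ K] {Λ : Submodule ℝ (E × (E →L[ℝ] ℝ))}

/-- The pairing `θ` between `K` and the characteristic subspace `Λ ∩ E` is perfect. -/
structure IsPerfect (Λ : Submodule ℝ (E × (E →L[ℝ] ℝ))) (θ : K →L[ℝ] E →L[ℝ] ℝ) : Prop where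
  left : ∀ y, (∀ v, (v, 0) ∈ Λ → θ y v = 0) → y = 0
  right : ∀ v, (v, 0) ∈ Λ → (∀ y, θ y v = 0) → v = 0

variable {θ : K →L[ℝ] E →L[ℝ] ℝ} {B : E × K →L[ℝ] E × K →L[ℝ] ℝ}

/-- For `(v, 0) ∈ Λ`, isotropy gives `η v = 0`, so evaluating `ξ` at `(v, 0)` leaves `θ X.2 v = 0`;
perfectness then applies. As `ξ` need only annihilate horizontal vectors, the lemma yields
coisotropy as well as transversality. -/
theorem IsPerfect.snd_eq_zero (h : IsPerfect Λ θ) (hΛ : IsIsotropic Λ)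
    (hB : ∀ X Y, B X Y = θ X.2 Y.1 - θ Y.2 X.1) {X : E × K} {ξ : E × K →L[ℝ] ℝ}
    (hX : LiftRel Λ B X ξ) (hξ : ∀ v, ξ (v, 0) = 0) : X.2 = 0 := by
  obtain ⟨η, hη, rfl⟩ := hX
  refine h.left _ fun v hv => ?_
  have h1 := hξ v
  have h2 := hΛ _ hη _ hv
  simp only [add_apply, ContinuousLinearMap.comp_apply, ContinuousLinearMap.coe_fst', hB,
    map_zero, zero_apply] at h1 h2
  linarith

/-- The Dirac structure `τ_B (π^*Λ)` is transverse to the tangent space along the zero section. -/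
theorem IsPerfect.transverse (h : IsPerfect Λ θ) (hΛ : IsIsotropic Λ)
    (hB : ∀ X Y, B X Y = θ X.2 Y.1 - θ Y.2 X.1) {X : E × K} (hX : LiftRel Λ B X 0) : X = 0 := by
  have h2 : X.2 = 0 := h.snd_eq_zero hΛ hB hX fun _ => rfl
  obtain ⟨η, hη, h0⟩ := hX
  have h3 : ∀ Y : E × K, η Y.1 - θ Y.2 X.1 = 0 := by
    intro Y
    have := DFunLike.congr_fun h0 Y
    simp only [add_apply, ContinuousLinearMap.comp_apply, ContinuousLinearMap.coe_fst', hB, h2,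
      map_zero, zero_apply] at this
    linarith
  have h4 : η = 0 := by
    ext v
    simpa using h3 (v, 0)
  rw [h4] at hη
  refine Prod.ext (h.right _ hη fun y => ?_) h2
  have := h3 (0, y)
  simpa using this

/-- Perfectness only sees the values on the characteristic subspace, so it survives interpolation
between pairings that agree there. -/
theorem IsPerfect.add_smul (h : IsPerfect Λ θ) {θ' : K →L[ℝ] E →L[ℝ] ℝ}
    (h0 : ∀ y v, (v, 0) ∈ Λ → θ' y v = 0) (t : ℝ) : IsPerfect Λ (θ + t • θ') := by
  have key : ∀ y v, (v, 0) ∈ Λ → (θ + t • θ') y v = θ y v := by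
    intro y v hv
    change θ y v + t * θ' y v = _
    rw [h0 y v hv, mul_zero, add_zero]
  exact ⟨fun y hy => h.left y fun v hv => by rw [← key y v hv]; exact hy v hv,
    fun v hv hy => h.right v hv fun y => by rw [← key y v hv]; exact hy y⟩

/-- The term `B (v, 0)` vanishes on horizontal vectors. Hence restricting the covector of a
horizontal element of the graph to `E` recovers its `Λ`-component: the graph pulls back to `Λ`. -/
theorem LiftRel.zero_iff {P : (E × K →L[ℝ] ℝ) →L[ℝ] E × K} (hΛ : IsIsotropic Λ)
    (hB : ∀ X Y, B X Y = θ X.2 Y.1 - θ Y.2 X.1) (hP : ∀ ξ, LiftRel Λ B (P ξ) ξ) (v : E)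
    (α : E →L[ℝ] ℝ) : (v, α) ∈ Λ ↔ ∃ ξ, P ξ = (v, 0) ∧ α = ξ ∘L .inl ℝ E K := by
  constructor
  · intro h
    refine ⟨α ∘L .fst ℝ E K + B (v, 0), ?_, ?_⟩
    · exact (LiftRel.eq_sharp hΛ (fun X Y => by rw [hB, hB]; ring) hP ⟨α, h, rfl⟩).symm
    · ext w
      simp [hB]
  · rintro ⟨ξ, hξ, rfl⟩
    obtain ⟨η, hη, h⟩ := hP ξ
    rw [hξ] at hη h
    have : ξ ∘L .inl ℝ E K = η := by
      ext w
      rw [h]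
      simp [hB]
    rw [this]
    exact hη

theorem hasFDerivAt_comp_fst {V : Type*} [NormedAddCommGroup V] [NormedSpace ℝ V] {f : E → V}
    {f' : E →L[ℝ] V} {u : E × K} (h : HasFDerivAt f f' u.1) :
    HasFDerivAt (fun u : E × K => f u.1) (f'.comp (.fst ℝ E K)) u :=
  HasFDerivAt.comp (f := Prod.fst) u h hasFDerivAt_fst

/-- The derivative of `Θ` is multiplied by the fibre coordinate, which is zero here. Only the
derivative in the fibre direction survives. -/
theorem twoForm_zero {Θ : E → K →L[ℝ] E →L[ℝ] ℝ} {x : E} (hΘ : DifferentiableAt ℝ Θ x)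
    (X Y : E × K) : twoForm (fun u : E × K => (Θ u.1 u.2) ∘L .fst ℝ E K) (x, 0) X Y =
      Θ x X.2 Y.1 - Θ x Y.2 X.1 := by
  have h1 : HasFDerivAt (fun u : E × K => Θ u.1) ((fderiv ℝ Θ x).comp (.fst ℝ E K)) (x, 0) :=
    hasFDerivAt_comp_fst (V := K →L[ℝ] E →L[ℝ] ℝ) (u := (x, (0 : K))) hΘ.hasFDerivAt
  have h2 := (h1.clm_apply (hasFDerivAt_snd (𝕜 := ℝ) (p := (x, (0 : K))))).clm_comp
    (hasFDerivAt_const (ContinuousLinearMap.fst ℝ E K) (x, (0 : K)))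
  have h3 : ∀ X Y, fderiv ℝ (fun u : E × K => (Θ u.1 u.2) ∘L .fst ℝ E K) (x, 0) X Y =
      Θ x X.2 Y.1 := by
    intro X Y
    rw [h2.fderiv]
    simp
  rw [twoForm_apply, h3, h3]

end Transversality

/-! ### Vector fields and one-forms in a chart. -/

section Charts

variable {E H : Type*} [NormedAddCommGroup E] [NormedSpace ℝ E] [TopologicalSpace H]
  {I : ModelWithCorners ℝ E H} [I.Boundaryless] {N : Type*} [TopologicalSpace N]
  [ChartedSpace H N]

variable (I) in
/-- The derivative of the chart at `p`. -/
def chartDeriv (p q : N) : TangentSpace I q →L[ℝ] E := mfderiv I 𝓘(ℝ, E) (extChartAt I p) q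

variable (I) in
/-- The derivative of the inverse of the chart at `p`. -/
def chartSymmDeriv (p : N) (u : E) : E →L[ℝ] TangentSpace I ((extChartAt I p).symm u) :=
  mfderiv 𝓘(ℝ, E) I (extChartAt I p).symm u

variable (I) in
/-- The coordinates of a vector field. -/
def vecRep (p : N) (X : ∀ q : N, TangentSpace I q) (u : E) : E :=
  chartDeriv I p _ (X ((extChartAt I p).symm u))

variable (I) in
/-- The coordinates of a one-form. -/
def formRep (p : N) (ξ : ∀ q : N, Cotangent I q) (u : E) : E →L[ℝ] ℝ :=
  ξ ((extChartAt I p).symm u) ∘L chartSymmDeriv I p u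

variable [IsManifold I ∞ N]

theorem target_mem_nhds {p : N} {u : E} (hu : u ∈ (extChartAt I p).target) :
    (extChartAt I p).target ∈ 𝓝 u := (isOpen_extChartAt_target p).mem_nhds hu

theorem mem_source_of_target {p : N} {u : E} (hu : u ∈ (extChartAt I p).target) :
    (extChartAt I p).symm u ∈ (chartAt H p).source := by
  rw [← extChartAt_source I]
  exact (extChartAt I p).map_target hu

theorem contMDiffAt_chart_symm {p : N} {u : E} (hu : u ∈ (extChartAt I p).target) :
    ContMDiffAt 𝓘(ℝ, E) I ∞ (extChartAt I p).symm u :=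
  (contMDiffOn_extChartAt_symm p).contMDiffAt (target_mem_nhds hu)

theorem contMDiffAt_chart {p : N} {u : E} (hu : u ∈ (extChartAt I p).target) :
    ContMDiffAt I 𝓘(ℝ, E) ∞ (extChartAt I p) ((extChartAt I p).symm u) :=
  contMDiffAt_extChartAt' (mem_source_of_target hu)

theorem chartDeriv_comp_chartSymmDeriv {p : N} {u : E} (hu : u ∈ (extChartAt I p).target) :
    chartDeriv I p _ ∘L chartSymmDeriv I p u = .id ℝ E := by
  have h1 := ((contMDiffAt_chart hu).mdifferentiableAt (by simp)).hasMFDerivAt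
  have h2 := ((contMDiffAt_chart_symm hu).mdifferentiableAt (by simp)).hasMFDerivAt
  have h3 := h1.comp u h2
  have h4 : HasMFDerivAt 𝓘(ℝ, E) 𝓘(ℝ, E) (id : E → E) u (.id ℝ E) := hasMFDerivAt_id u
  refine hasMFDerivAt_unique (h3.congr_of_eventuallyEq ?_) h4
  filter_upwards [target_mem_nhds hu] with w hw
  exact ((extChartAt I p).right_inv hw).symm

theorem chartSymmDeriv_comp_chartDeriv {p : N} {u : E} (hu : u ∈ (extChartAt I p).target) :
    chartSymmDeriv I p u ∘L chartDeriv I p _ =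
      .id ℝ (TangentSpace I ((extChartAt I p).symm u)) := by
  have h1 := ((contMDiffAt_chart hu).mdifferentiableAt (by simp)).hasMFDerivAt
  have h2 := ((contMDiffAt_chart_symm hu).mdifferentiableAt (by simp)).hasMFDerivAt
  have h2' : HasMFDerivAt 𝓘(ℝ, E) I (extChartAt I p).symm
      (extChartAt I p ((extChartAt I p).symm u)) (chartSymmDeriv I p u) := by
    rw [(extChartAt I p).right_inv hu]; exact h2
  have h3 := h2'.comp ((extChartAt I p).symm u) h1
  have h4 := hasMFDerivAt_id (I := I) ((extChartAt I p).symm u)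
  refine hasMFDerivAt_unique (h3.congr_of_eventuallyEq ?_) h4
  have hs : (extChartAt I p).source ∈ 𝓝 ((extChartAt I p).symm u) :=
    extChartAt_source_mem_nhds' ((extChartAt I p).map_target hu)
  filter_upwards [hs] with w hw
  exact ((extChartAt I p).left_inv hw).symm

theorem chartDeriv_chartSymmDeriv {p : N} {u : E} (hu : u ∈ (extChartAt I p).target) (v : E) :
    chartDeriv I p _ (chartSymmDeriv I p u v) = v :=
  DFunLike.congr_fun (chartDeriv_comp_chartSymmDeriv hu) v

theorem chartSymmDeriv_chartDeriv {p : N} {u : E} (hu : u ∈ (extChartAt I p).target)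
    (v : TangentSpace I ((extChartAt I p).symm u)) :
    chartSymmDeriv I p u (chartDeriv I p _ v) = v :=
  DFunLike.congr_fun (chartSymmDeriv_comp_chartDeriv hu) v

theorem contMDiffAt_iff_chart {E' : Type*} [NormedAddCommGroup E'] [NormedSpace ℝ E'] {f : N → E'}
    {p : N} {u : E} (hu : u ∈ (extChartAt I p).target) :
    ContMDiffAt I 𝓘(ℝ, E') ∞ f ((extChartAt I p).symm u) ↔
      ContDiffAt ℝ ∞ (f ∘ (extChartAt I p).symm) u := by
  rw [contMDiffAt_iff_source_of_mem_source (mem_source_of_target hu), I.range_eq_univ,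
    contMDiffWithinAt_univ, (extChartAt I p).right_inv hu, contMDiffAt_iff_contDiffAt]

theorem contDiffAt_congr {V W : Type*} [NormedAddCommGroup V] [NormedSpace ℝ V]
    [NormedAddCommGroup W] [NormedSpace ℝ W] {f g : V → W} {u : V} (h : f =ᶠ[𝓝 u] g) :
    ContDiffAt ℝ ∞ f u ↔ ContDiffAt ℝ ∞ g u :=
  ⟨fun hf => hf.congr_of_eventuallyEq h.symm, fun hg => hg.congr_of_eventuallyEq h⟩

/-- This links the bundle trivialization to the derivative of the chart, so that smoothness of
sections can be tested on coordinate representatives. -/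
theorem triv_tangent_apply {p : N} {u : E} (hu : u ∈ (extChartAt I p).target)
    (v : TangentSpace I ((extChartAt I p).symm u)) :
    (trivializationAt E (TangentSpace I) p).continuousLinearMapAt ℝ _ v = chartDeriv I p _ v :=
  DFunLike.congr_fun (TangentBundle.continuousLinearMapAt_trivializationAt (I := I) (𝕜 := ℝ)
    (mem_source_of_target hu)) v

theorem contMDiffAt_vec_iff {p : N} {u : E} (hu : u ∈ (extChartAt I p).target)
    {X : ∀ q : N, TangentSpace I q} :
    ContMDiffAt I (I.prod 𝓘(ℝ, E)) ∞ (fun q => TotalSpace.mk' E q (X q))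
      ((extChartAt I p).symm u) ↔ ContDiffAt ℝ ∞ (vecRep I p X) u := by
  have hb : (extChartAt I p).symm u ∈ (trivializationAt E (TangentSpace I) p).baseSet :=
    mem_source_of_target hu
  rw [(trivializationAt E (TangentSpace I) p).contMDiffAt_section_iff hb, contMDiffAt_iff_chart hu]
  refine contDiffAt_congr ?_
  filter_upwards [target_mem_nhds hu] with w hw
  refine Eq.trans ?_ (triv_tangent_apply hw _)
  rw [Trivialization.continuousLinearMapAt_apply]
  rw [Trivialization.coe_linearMapAt_of_mem _ (show _ ∈ _ from mem_source_of_target hw)]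
  rfl

theorem symmL_eq_chartSymmDeriv {p : N} {u : E} (hu : u ∈ (extChartAt I p).target) :
    (trivializationAt E (TangentSpace I) p).symmL ℝ ((extChartAt I p).symm u) =
      chartSymmDeriv I p u := by
  rw [TangentBundle.symmL_trivializationAt (mem_source_of_target hu), I.range_eq_univ,
    mfderivWithin_univ, (extChartAt I p).right_inv hu]
  rfl

theorem triv_cotangent_apply {p : N} {u : E} (hu : u ∈ (extChartAt I p).target)
    (ξ : Cotangent I ((extChartAt I p).symm u)) :
    (trivializationAt (E →L[ℝ] ℝ) (fun q : N => TangentSpace I q →L[ℝ] ℝ) p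
      ⟨(extChartAt I p).symm u, ξ⟩).2 = ξ ∘L chartSymmDeriv I p u := by
  change ContinuousLinearMap.inCoordinates E (TangentSpace I) ℝ (Bundle.Trivial N ℝ) p _ p _ ξ = _
  ext v
  simp only [ContinuousLinearMap.inCoordinates, ContinuousLinearMap.comp_apply]
  rw [symmL_eq_chartSymmDeriv hu]
  change (Trivialization.continuousLinearMapAt ℝ (trivializationAt ℝ (Bundle.Trivial N ℝ) p) _)
      (ξ (chartSymmDeriv I p u v)) = _
  simp
  rfl

theorem triv_cotangent_symmL {p : N} {u : E} (hu : u ∈ (extChartAt I p).target)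
    (ξ : E →L[ℝ] ℝ) :
    (trivializationAt (E →L[ℝ] ℝ) (fun q : N => TangentSpace I q →L[ℝ] ℝ) p).symmL ℝ
      ((extChartAt I p).symm u) ξ = ξ ∘L chartDeriv I p _ := by
  set e := trivializationAt (E →L[ℝ] ℝ) (fun q : N => TangentSpace I q →L[ℝ] ℝ) p
  have hb : (extChartAt I p).symm u ∈ e.baseSet := ⟨mem_source_of_target hu, mem_univ _⟩
  have h1 : e.continuousLinearMapAt ℝ ((extChartAt I p).symm u) (ξ ∘L chartDeriv I p _) = ξ := by
    rw [Trivialization.continuousLinearMapAt_apply, Trivialization.coe_linearMapAt_of_mem _ hb]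
    refine (triv_cotangent_apply hu _).trans ?_
    ext v
    exact congrArg ξ (chartDeriv_chartSymmDeriv hu v)
  have h2 := e.symmL_continuousLinearMapAt (R := ℝ) hb (ξ ∘L chartDeriv I p _)
  rw [h1] at h2
  exact h2

theorem contMDiffAt_form_iff {p : N} {u : E} (hu : u ∈ (extChartAt I p).target)
    {ξ : ∀ q : N, Cotangent I q} :
    ContMDiffAt I (I.prod 𝓘(ℝ, E →L[ℝ] ℝ)) ∞ (fun q => TotalSpace.mk' (E →L[ℝ] ℝ) q (ξ q))
      ((extChartAt I p).symm u) ↔ ContDiffAt ℝ ∞ (formRep I p ξ) u := by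
  have hb : (extChartAt I p).symm u ∈
      (trivializationAt (E →L[ℝ] ℝ) (fun q : N => TangentSpace I q →L[ℝ] ℝ) p).baseSet :=
    ⟨mem_source_of_target hu, mem_univ _⟩
  rw [Trivialization.contMDiffAt_section_iff (IB := I) (n := ∞)
    (trivializationAt (E →L[ℝ] ℝ) (fun q : N => TangentSpace I q →L[ℝ] ℝ) p) hb,
    contMDiffAt_iff_chart hu]
  refine contDiffAt_congr ?_
  filter_upwards [target_mem_nhds hu] with w hw
  exact triv_cotangent_apply hw _

end Charts

/-! ### Pullback and exterior derivative in vector spaces. -/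

section Naturality

/-- The terms with the second derivative of `g` cancel under antisymmetrization. -/
theorem twoForm_comp {F E : Type*} [NormedAddCommGroup F] [NormedSpace ℝ F] [NormedAddCommGroup E]
    [NormedSpace ℝ E] {g : F → E} {A : E → E →L[ℝ] ℝ} {u : F} (hg : ContDiffAt ℝ ∞ g u)
    (hA : DifferentiableAt ℝ A (g u)) (X Y : F) :
    twoForm (fun w => (A (g w)) ∘L fderiv ℝ g w) u X Y =
      twoForm A (g u) (fderiv ℝ g u X) (fderiv ℝ g u Y) := by
  have h1 : HasFDerivAt (fun w => A (g w)) ((fderiv ℝ A (g u)).comp (fderiv ℝ g u)) u :=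
    hA.hasFDerivAt.comp u (hg.differentiableAt (by simp)).hasFDerivAt
  have h2 : HasFDerivAt (fderiv ℝ g) (fderiv ℝ (fderiv ℝ g) u) u :=
    ((hg.fderiv_right (m := ∞) (by simp)).differentiableAt (by simp)).hasFDerivAt
  have hs : fderiv ℝ (fderiv ℝ g) u X Y = fderiv ℝ (fderiv ℝ g) u Y X :=
    (hg.isSymmSndFDerivAt (by rw [minSmoothness_of_isRCLikeNormedField]; exact WithTop.coe_le_coe.2 (le_top : (2 : ℕ∞) ≤ ⊤))).eq X Y
  have h3 := (h1.clm_comp h2).fderiv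
  have h4 : ∀ X Y, fderiv ℝ (fun w => (A (g w)) ∘L fderiv ℝ g w) u X Y =
      A (g u) (fderiv ℝ (fderiv ℝ g) u X Y) +
        fderiv ℝ A (g u) (fderiv ℝ g u X) (fderiv ℝ g u Y) := by
    intro X Y
    rw [h3]
    simp
  rw [twoForm_apply, twoForm_apply, h4, h4, hs]
  ring

theorem twoForm_congr {F : Type*} [NormedAddCommGroup F] [NormedSpace ℝ F] {a b : F → F →L[ℝ] ℝ}
    {u : F} (h : a =ᶠ[𝓝 u] b) : twoForm a u = twoForm b u := by
  rw [twoForm, twoForm, Filter.EventuallyEq.fderiv_eq h]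

end Naturality

/-! ### Exterior derivative, Lie bracket and bivectors in a chart. -/

section Charts

variable {E H : Type*} [NormedAddCommGroup E] [NormedSpace ℝ E] [TopologicalSpace H]
  {I : ModelWithCorners ℝ E H} [I.Boundaryless] {N : Type*} [TopologicalSpace N]
  [ChartedSpace H N] [IsManifold I ∞ N]

/-- The exterior derivative of a one-form commutes with pullbacks to vector spaces. -/
theorem extDerivOneForm_comp {F : Type*} [NormedAddCommGroup F] [NormedSpace ℝ F] {f : F → N}
    {u : F} (hf : ContMDiffAt 𝓘(ℝ, F) I ∞ f u) {α : ∀ q : N, Cotangent I q}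
    (hα : DifferentiableAt ℝ (formRep I (f u) α) (extChartAt I (f u) (f u))) (X Y : F) :
    extDerivOneForm α (f u) (mfderiv 𝓘(ℝ, F) I f u X) (mfderiv 𝓘(ℝ, F) I f u Y) =
      twoForm (fun w : F => (α (f w) ∘L mfderiv 𝓘(ℝ, F) I f w : F →L[ℝ] ℝ)) u X Y := by
  let φ := extChartAt I (f u)
  let g : F → E := φ ∘ f
  have hφ : ContMDiffAt I 𝓘(ℝ, E) ∞ φ (f u) := contMDiffAt_extChartAt
  have hg : ContDiffAt ℝ ∞ g u := (hφ.comp u hf).contDiffAt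
  have hev : ∀ᶠ w in 𝓝 u, MDifferentiableAt 𝓘(ℝ, F) I f w := by
    have := (contMDiffAt_iff_contMDiffAt_nhds (n := 1) (by simp)).1 (hf.of_le (by simp))
    exact this.mono fun w hw => hw.mdifferentiableAt (by simp)
  have hsrc : ∀ᶠ w in 𝓝 u, f w ∈ φ.source :=
    hf.continuousAt (extChartAt_source_mem_nhds (f u))
  let α' : N → E →L[ℝ] ℝ := α
  -- Near `u` the pulled back form is the pullback of the chart representative of `α` by `g = φ ∘
  -- f`. This reduces the claim to `twoForm_comp`.
  have key : (fun w : F => (α (f w) ∘L mfderiv 𝓘(ℝ, F) I f w : F →L[ℝ] ℝ)) =ᶠ[𝓝 u]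
      fun w => (formRep I (f u) α (g w)) ∘L fderiv ℝ g w := by
    filter_upwards [hev, hsrc, hsrc.eventually_nhds] with w hw hws hwe
    have ht : g w ∈ φ.target := φ.map_source hws
    have hinv : φ.symm (g w) = f w := φ.left_inv hws
    have hφw : MDifferentiableAt I 𝓘(ℝ, E) φ (f w) :=
      mdifferentiableAt_extChartAt (by rw [← extChartAt_source I]; exact hws)
    have hgw : HasMFDerivAt 𝓘(ℝ, F) 𝓘(ℝ, E) g w (fderiv ℝ g w) := by
      have := (hφw.comp w hw).hasMFDerivAt
      rwa [mfderiv_eq_fderiv] at this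
    have hsy : HasMFDerivAt 𝓘(ℝ, E) I φ.symm (g w) (chartSymmDeriv I (f u) (g w)) :=
      ((contMDiffAt_chart_symm ht).mdifferentiableAt (by simp)).hasMFDerivAt
    have hcomp := hsy.comp w hgw
    have hfw : HasMFDerivAt 𝓘(ℝ, F) I f w ((chartSymmDeriv I (f u) (g w)).comp (fderiv ℝ g w)) := by
      have h5 := hcomp.congr_of_eventuallyEq (f₁ := f) (by
        filter_upwards [hwe] with z hz
        exact (φ.left_inv hz).symm)
      exact h5
    have h6 : α' (φ.symm (g w)) = α' (f w) := congrArg α' hinv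
    rw [hfw.mfderiv]
    ext v
    exact DFunLike.congr_fun h6.symm _
  rw [twoForm_congr key, twoForm_comp hg hα]
  have hfu : MDifferentiableAt 𝓘(ℝ, F) I f u := hf.mdifferentiableAt (by simp)
  have hgu : fderiv ℝ g u = chartDeriv I (f u) (f u) ∘L mfderiv 𝓘(ℝ, F) I f u := by
    rw [← mfderiv_eq_fderiv]
    exact mfderiv_comp u (hφ.mdifferentiableAt (by simp)) hfu
  rw [hgu]
  rfl

/-- The exterior derivative of a one-form in any chart. -/
theorem extDerivOneForm_chart {p : N} {u : E} (hu : u ∈ (extChartAt I p).target)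
    {α : ∀ q : N, Cotangent I q}
    (hα : ContMDiffAt I (I.prod 𝓘(ℝ, E →L[ℝ] ℝ)) ∞
      (fun q => TotalSpace.mk' (E →L[ℝ] ℝ) q (α q)) ((extChartAt I p).symm u)) (X Y : E) :
    extDerivOneForm α ((extChartAt I p).symm u) (chartSymmDeriv I p u X)
      (chartSymmDeriv I p u Y) = twoForm (formRep I p α) u X Y := by
  refine extDerivOneForm_comp (contMDiffAt_chart_symm hu) ?_ X Y
  have h := mem_extChartAt_target (I := I) ((extChartAt I p).symm u)
  refine ContDiffAt.differentiableAt (n := ∞) ((contMDiffAt_form_iff h).1 ?_) (by simp)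
  rw [extChartAt_to_inv]
  exact hα

theorem mlieBracket_chart {p : N} {u : E} (hu : u ∈ (extChartAt I p).target)
    {X Y : ∀ q : N, TangentSpace I q} [CompleteSpace E]
    (hX : ContMDiffAt I (I.prod 𝓘(ℝ, E)) ∞ (fun q => TotalSpace.mk' E q (X q))
      ((extChartAt I p).symm u))
    (hY : ContMDiffAt I (I.prod 𝓘(ℝ, E)) ∞ (fun q => TotalSpace.mk' E q (Y q))
      ((extChartAt I p).symm u)) :
    chartDeriv I p _ (VectorField.mlieBracket I X Y ((extChartAt I p).symm u)) =
      VectorField.lieBracket ℝ (vecRep I p X) (vecRep I p Y) u := by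
  have hinv : ∀ w ∈ (extChartAt I p).target, ∀ v : TangentSpace I ((extChartAt I p).symm w),
      (mfderiv 𝓘(ℝ, E) I (extChartAt I p).symm w).inverse v = chartDeriv I p _ v := by
    intro w hw v
    have : (chartSymmDeriv I p w).inverse = chartDeriv I p _ :=
      ContinuousLinearMap.inverse_eq (chartSymmDeriv_comp_chartDeriv hw)
        (chartDeriv_comp_chartSymmDeriv hw)
    exact DFunLike.congr_fun this v
  have h2 : minSmoothness ℝ 2 ≤ (∞ : WithTop ℕ∞) := by
    rw [minSmoothness_of_isRCLikeNormedField]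
    exact WithTop.coe_le_coe.2 (le_top : (2 : ℕ∞) ≤ ⊤)
  have : IsManifold I (minSmoothness ℝ 2) N := IsManifold.of_le h2
  have h := VectorField.mpullback_mlieBracket (I := 𝓘(ℝ, E)) (I' := I) (n := ∞)
    (hX.mdifferentiableAt (by simp)) (hY.mdifferentiableAt (by simp)) (contMDiffAt_chart_symm hu) h2
  rw [VectorField.mpullback_apply, hinv u hu] at h
  have hvs : ∀ V W : E → E, VectorField.mlieBracket 𝓘(ℝ, E) V W u =
      VectorField.lieBracket ℝ V W u := by
    intro V W
    have h1 := congrFun (VectorField.mlieBracketWithin_univ (I := 𝓘(ℝ, E)) (V := V) (W := W)) u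
    have h2 := congrFun (VectorField.mlieBracketWithin_eq_lieBracketWithin (𝕜 := ℝ) (V := V)
      (W := W) (s := univ)) u
    have h3 := congrFun (VectorField.lieBracketWithin_univ (𝕜 := ℝ) (V := V) (W := W)) u
    exact h1.symm.trans (h2.trans h3)
  refine (h.trans (hvs _ _)).trans ?_
  refine Filter.EventuallyEq.lieBracket_vectorField_eq (𝕜 := ℝ) (E := E) (x := u) ?_ ?_
  · filter_upwards [target_mem_nhds hu] with w hw using hinv w hw _
  · filter_upwards [target_mem_nhds hu] with w hw using hinv w hw _

variable (I) in
/-- The coordinates of a bivector field. -/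
def bivRep (p : N) (P : ∀ q : N, Cotangent I q →L[ℝ] TangentSpace I q) (u : E) :
    (E →L[ℝ] ℝ) →L[ℝ] E :=
  chartDeriv I p _ ∘L P ((extChartAt I p).symm u) ∘L
    ContinuousLinearMap.precomp ℝ (chartDeriv I p ((extChartAt I p).symm u))

theorem bivRep_apply (p : N) (P : ∀ q : N, Cotangent I q →L[ℝ] TangentSpace I q) (u : E)
    (ξ : E →L[ℝ] ℝ) : bivRep I p P u ξ =
      chartDeriv I p _ (P ((extChartAt I p).symm u) (ξ ∘L chartDeriv I p _)) := rfl

theorem contMDiffAt_biv_iff {p : N} {u : E} (hu : u ∈ (extChartAt I p).target)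
    {P : ∀ q : N, Cotangent I q →L[ℝ] TangentSpace I q} :
    ContMDiffAt I (I.prod 𝓘(ℝ, (E →L[ℝ] ℝ) →L[ℝ] E)) ∞
      (fun q => TotalSpace.mk' ((E →L[ℝ] ℝ) →L[ℝ] E) q (P q))
      ((extChartAt I p).symm u) ↔ ContDiffAt ℝ ∞ (bivRep I p P) u := by
  let e := trivializationAt ((E →L[ℝ] ℝ) →L[ℝ] E)
    (fun q : N => (TangentSpace I q →L[ℝ] ℝ) →L[ℝ] TangentSpace I q) p
  have hb : (extChartAt I p).symm u ∈ e.baseSet :=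
    ⟨⟨mem_source_of_target hu, mem_univ _⟩, mem_source_of_target hu⟩
  rw [Trivialization.contMDiffAt_section_iff (IB := I) (n := ∞) e hb, contMDiffAt_iff_chart hu]
  refine contDiffAt_congr ?_
  filter_upwards [target_mem_nhds hu] with w hw
  change ContinuousLinearMap.inCoordinates (E →L[ℝ] ℝ) (fun q : N => TangentSpace I q →L[ℝ] ℝ) E
    (TangentSpace I) p ((extChartAt I p).symm w) p ((extChartAt I p).symm w) (P _) = _
  ext1 ξ
  simp only [ContinuousLinearMap.inCoordinates, ContinuousLinearMap.comp_apply]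
  rw [triv_cotangent_symmL hw, triv_tangent_apply hw]
  rfl

end Charts

/-! ### Dirac structures in a chart. -/

section LocalDirac

variable {E H : Type*} [NormedAddCommGroup E] [NormedSpace ℝ E] [TopologicalSpace H]
  {I : ModelWithCorners ℝ E H} [I.Boundaryless] {N : Type*} [TopologicalSpace N]
  [ChartedSpace H N] [IsManifold I ∞ N]

theorem mfderiv_chart {p : N} {u : E} (hu : u ∈ (extChartAt I p).target) {f : N → ℝ}
    (hf : ContMDiffAt I 𝓘(ℝ, ℝ) ∞ f ((extChartAt I p).symm u)) (v : E) :
    mfderiv I 𝓘(ℝ, ℝ) f _ (chartSymmDeriv I p u v) = fderiv ℝ (f ∘ (extChartAt I p).symm) u v := by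
  rw [← mfderiv_eq_fderiv, mfderiv_comp u (hf.mdifferentiableAt (by simp))
    ((contMDiffAt_chart_symm hu).mdifferentiableAt (by simp))]
  rfl

theorem formRep_vecRep {p : N} {u : E} (hu : u ∈ (extChartAt I p).target)
    (ξ : ∀ q : N, Cotangent I q) (X : ∀ q : N, TangentSpace I q) :
    formRep I p ξ u (vecRep I p X u) = ξ _ (X ((extChartAt I p).symm u)) :=
  congrArg (ξ _) (chartSymmDeriv_chartDeriv hu _)

variable (I) in
/-- The derivative of the inverse of the chart at `p`, on `E ⊕ E*`. -/
def pontryaginMap (p : N) (u : E) :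
    (E × (E →L[ℝ] ℝ)) →ₗ[ℝ] Pontryagin I ((extChartAt I p).symm u) :=
  LinearMap.prodMap (chartSymmDeriv I p u : E →ₗ[ℝ] TangentSpace I ((extChartAt I p).symm u))
    ((ContinuousLinearMap.precomp ℝ (chartDeriv I p ((extChartAt I p).symm u)) :
      (E →L[ℝ] ℝ) →L[ℝ] Cotangent I ((extChartAt I p).symm u)) :
      (E →L[ℝ] ℝ) →ₗ[ℝ] Cotangent I ((extChartAt I p).symm u))

theorem pontryaginMap_apply (p : N) (u : E) (a : E × (E →L[ℝ] ℝ)) :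
    pontryaginMap I p u a = (chartSymmDeriv I p u a.1, a.2 ∘L chartDeriv I p _) := rfl

theorem pontryaginMap_coords {p : N} {u : E} (hu : u ∈ (extChartAt I p).target)
    (X : TangentSpace I ((extChartAt I p).symm u)) (ξ : Cotangent I ((extChartAt I p).symm u)) :
    pontryaginMap I p u (chartDeriv I p _ X, ξ ∘L chartSymmDeriv I p u) = (X, ξ) := by
  rw [pontryaginMap_apply]
  refine Prod.ext (chartSymmDeriv_chartDeriv hu X) ?_
  ext v
  exact congrArg ξ (chartSymmDeriv_chartDeriv hu v)

theorem pontryaginMap_bijective {p : N} {u : E} (hu : u ∈ (extChartAt I p).target) :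
    Function.Bijective (pontryaginMap I p u) := by
  refine ⟨(injective_iff_map_eq_zero _).2 fun a ha => ?_, fun b => ⟨_, pontryaginMap_coords hu _ _⟩⟩
  rw [pontryaginMap_apply] at ha
  refine Prod.ext ?_ ?_
  · have := congrArg (fun z : Pontryagin I ((extChartAt I p).symm u) => chartDeriv I p _ z.1) ha
    simp only [chartDeriv_chartSymmDeriv hu] at this
    rw [this]
    exact map_zero _
  · ext v
    have := congrArg (fun z : Pontryagin I ((extChartAt I p).symm u) =>
      z.2 (chartSymmDeriv I p u v)) ha
    simp only [ContinuousLinearMap.comp_apply, chartDeriv_chartSymmDeriv hu] at this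
    exact this

/-- A Dirac structure in the chart at `p`. -/
def diracRep (L : DiracStructure I N) (p : N) (u : E) : Submodule ℝ (E × (E →L[ℝ] ℝ)) :=
  (L.fiber ((extChartAt I p).symm u)).comap (pontryaginMap I p u)

theorem mem_diracRep {L : DiracStructure I N} {p : N} {u : E} {a : E × (E →L[ℝ] ℝ)} :
    a ∈ diracRep L p u ↔ (chartSymmDeriv I p u a.1, a.2 ∘L chartDeriv I p _) ∈
      L.fiber ((extChartAt I p).symm u) := Iff.rfl

theorem coords_mem_diracRep {L : DiracStructure I N} {p : N} {u : E}
    (hu : u ∈ (extChartAt I p).target) {X : TangentSpace I ((extChartAt I p).symm u)}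
    {ξ : Cotangent I ((extChartAt I p).symm u)} :
    (chartDeriv I p _ X, ξ ∘L chartSymmDeriv I p u) ∈ diracRep L p u ↔
      (X, ξ) ∈ L.fiber ((extChartAt I p).symm u) := by
  rw [diracRep, Submodule.mem_comap, pontryaginMap_coords hu]

variable [FiniteDimensional ℝ E]

/-- Integrability of a Dirac structure in coordinates. -/
theorem courantTerm_sum (L : DiracStructure I N) {p : N} {u : E}
    (hu : u ∈ (extChartAt I p).target) {U : Fin 3 → Set N}
    {X : Fin 3 → ∀ q : N, TangentSpace I q} {ξ : Fin 3 → ∀ q : N, Cotangent I q}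
    (hU : ∀ i, IsOpen (U i)) (huU : ∀ i, (extChartAt I p).symm u ∈ U i)
    (hX : ∀ i, SmoothVectorFieldOn I (X i) (U i)) (hξ : ∀ i, SmoothOneFormOn I (ξ i) (U i))
    (hL : ∀ i, ∀ q ∈ U i, (X i q, ξ i q) ∈ L.fiber q) :
    let σ : Fin 3 → E → E × (E →L[ℝ] ℝ) := fun i y => (vecRep I p (X i) y, formRep I p (ξ i) y)
    courantTerm (σ 0) (σ 1) (σ 2) u + courantTerm (σ 1) (σ 2) (σ 0) u +
      courantTerm (σ 2) (σ 0) (σ 1) u = 0 := by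
  intro σ
  set q := (extChartAt I p).symm u
  have hXq : ∀ i, ContMDiffAt I (I.prod 𝓘(ℝ, E)) ∞ (fun q => TotalSpace.mk' E q (X i q)) q :=
    fun i => (hX i q (huU i)).contMDiffAt ((hU i).mem_nhds (huU i))
  have hξq : ∀ i, ContMDiffAt I (I.prod 𝓘(ℝ, E →L[ℝ] ℝ)) ∞
      (fun q => TotalSpace.mk' (E →L[ℝ] ℝ) q (ξ i q)) q :=
    fun i => (hξ i q (huU i)).contMDiffAt ((hU i).mem_nhds (huU i))
  let x : Fin 3 → E → E := fun i => vecRep I p (X i)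
  let a : Fin 3 → E → E →L[ℝ] ℝ := fun i => formRep I p (ξ i)
  have hx : ∀ i, ContDiffAt ℝ ∞ (x i) u := fun i => (contMDiffAt_vec_iff hu).1 (hXq i)
  have ha : ∀ i, ContDiffAt ℝ ∞ (a i) u := fun i => (contMDiffAt_form_iff hu).1 (hξq i)
  have hx' : ∀ i, HasFDerivAt (x i) (fderiv ℝ (x i) u) u := fun i =>
    ((hx i).differentiableAt (by simp)).hasFDerivAt
  have ha' : ∀ i, HasFDerivAt (a i) (fderiv ℝ (a i) u) u := fun i =>
    ((ha i).differentiableAt (by simp)).hasFDerivAt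
  have hpair : ∀ i j, HasFDerivAt (fun w => a i w (x j w))
      ((a i u).comp (fderiv ℝ (x j) u) + (fderiv ℝ (a i) u).flip (x j u)) u := fun i j =>
    (ha' i).clm_apply (hx' j)
  have hev : ∀ i, ∀ᶠ w in 𝓝 u, w ∈ (extChartAt I p).target ∧ (extChartAt I p).symm w ∈ U i :=
    fun i => by
      filter_upwards [target_mem_nhds hu, (contMDiffAt_chart_symm hu).continuousAt
        ((hU i).mem_nhds (huU i))] with w h1 h2 using ⟨h1, h2⟩
  -- The pairing of two sections vanishes identically near `u`. Its derivatives supply the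
  -- integrations by parts below.
  have hiso : ∀ i j v, fderiv ℝ (a i) u v (x j u) + a i u (fderiv ℝ (x j) u v) +
      fderiv ℝ (a j) u v (x i u) + a j u (fderiv ℝ (x i) u v) = 0 := by
    intro i j v
    have h0 : (fun w => a i w (x j w) + a j w (x i w)) =ᶠ[𝓝 u] fun _ => 0 := by
      filter_upwards [hev i, hev j] with w hi hj
      simp only [a, x, formRep_vecRep hi.1]
      exact L.isotropic _ _ (hL i _ hi.2) _ (hL j _ hj.2)
    have h1 := ((hpair i j).add (hpair j i)).unique
      ((hasFDerivAt_const (0 : ℝ) u).congr_of_eventuallyEq h0)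
    have h2 := DFunLike.congr_fun h1 v
    simp only [add_apply, ContinuousLinearMap.comp_apply, ContinuousLinearMap.flip_apply,
      zero_apply] at h2
    linarith
  -- The bracket of sections 0 and 1 lies in `L`, so it pairs to zero with section 2. In coordinates
  -- this pairing is the Courant tensor.
  have hcour := L.integrable (U 0 ∩ U 1) (X 0) (ξ 0) (X 1) (ξ 1) ((hU 0).inter (hU 1))
    ((hX 0).mono inter_subset_left) ((hξ 0).mono inter_subset_left)
    (fun q hq => hL 0 q hq.1) ((hX 1).mono inter_subset_right)
    ((hξ 1).mono inter_subset_right) (fun q hq => hL 1 q hq.2) q ⟨huU 0, huU 1⟩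
  have h3 := L.isotropic q _ hcour _ (hL 2 q (huU 2))
  have hX2 : X 2 q = chartSymmDeriv I p u (x 2 u) := (chartSymmDeriv_chartDeriv hu _).symm
  have e1 : ξ 2 q (courantVector (X 0) (X 1) q) =
      a 2 u (fderiv ℝ (x 1) u (x 0 u) - fderiv ℝ (x 0) u (x 1 u)) := by
    have h4 := mlieBracket_chart hu (hXq 0) (hXq 1)
    have h5 : courantVector (X 0) (X 1) q = chartSymmDeriv I p u
        (VectorField.lieBracket ℝ (x 0) (x 1) u) := by
      rw [← h4]
      exact (chartSymmDeriv_chartDeriv hu _).symm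
    rw [h5]
    rfl
  have e2 : ∀ i j, extDerivOneForm (ξ i) q (X j q) (X 2 q) = twoForm (a i) u (x j u) (x 2 u) := by
    intro i j
    have hXj : X j q = chartSymmDeriv I p u (x j u) := (chartSymmDeriv_chartDeriv hu _).symm
    rw [hXj, hX2]
    exact extDerivOneForm_chart hu (hξq i) _ _
  have e3 : mfderiv I 𝓘(ℝ, ℝ) (fun q => ξ 1 q (X 0 q) - ξ 0 q (X 1 q)) q (X 2 q) =
      (a 1 u (fderiv ℝ (x 0) u (x 2 u)) + fderiv ℝ (a 1) u (x 2 u) (x 0 u)) -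
      (a 0 u (fderiv ℝ (x 1) u (x 2 u)) + fderiv ℝ (a 0) u (x 2 u) (x 1 u)) := by
    have h6 : (fun q => ξ 1 q (X 0 q) - ξ 0 q (X 1 q)) ∘ (extChartAt I p).symm =ᶠ[𝓝 u]
        fun w => a 1 w (x 0 w) - a 0 w (x 1 w) := by
      filter_upwards [target_mem_nhds hu] with w hw
      simp only [a, x, formRep_vecRep hw]
      rfl
    have h7 : ContMDiffAt I 𝓘(ℝ, ℝ) ∞ (fun q => ξ 1 q (X 0 q) - ξ 0 q (X 1 q)) q := by
      rw [contMDiffAt_iff_chart hu, contDiffAt_congr h6]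
      exact ((ha 1).clm_apply (hx 0)).sub ((ha 0).clm_apply (hx 1))
    rw [hX2, mfderiv_chart hu h7, h6.fderiv_eq, ((hpair 1 0).fun_sub (hpair 0 1)).fderiv]
    rfl
  have e4 : courantCovector (X 0) (ξ 0) (X 1) (ξ 1) q (X 2 q) =
      twoForm (a 1) u (x 0 u) (x 2 u) - twoForm (a 0) u (x 1 u) (x 2 u) +
      (1 / 2 : ℝ) * ((a 1 u (fderiv ℝ (x 0) u (x 2 u)) + fderiv ℝ (a 1) u (x 2 u) (x 0 u)) -
      (a 0 u (fderiv ℝ (x 1) u (x 2 u)) + fderiv ℝ (a 0) u (x 2 u) (x 1 u))) := by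
    rw [← e3, ← e2, ← e2]
    rfl
  have h8 : courantCovector (X 0) (ξ 0) (X 1) (ξ 1) q (X 2 q) +
      ξ 2 q (courantVector (X 0) (X 1) q) = 0 := h3
  rw [e1, e4, twoForm_apply, twoForm_apply, map_sub] at h8
  have hct : ∀ i j k, courantTerm (σ i) (σ j) (σ k) u =
      fderiv ℝ (a j) u (x i u) (x k u) + a k u (fderiv ℝ (x j) u (x i u)) := by
    intro i j k
    have : fderiv ℝ (σ j) u = (fderiv ℝ (x j) u).prod (fderiv ℝ (a j) u) :=
      ((hx' j).prodMk (ha' j)).fderiv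
    rw [courantTerm, this]
    rfl
  rw [hct, hct, hct]
  -- The relation along `x 1` moves the derivatives off section 0. The one along `x 2` absorbs the
  -- half differential in the bracket.
  have i1 := hiso 0 2 (x 1 u)
  have i2 := hiso 0 1 (x 2 u)
  linarith

/-- The derivative of the chart and its transpose preserve the symmetric pairing, so isotropy and
rank carry over. Sections are coordinate representatives of sections of `L`, and `courantTerm_sum`
gives the cyclic identity. -/
theorem isDiracOn_diracRep (L : DiracStructure I N) (p : N) :
    IsDiracOn (diracRep L p) (extChartAt I p).target where
  isOpen := isOpen_extChartAt_target p
  isotropic u hu a ha b hb := by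
    have h := L.isotropic _ _ ha _ hb
    simp only [pontryaginMap_apply, ContinuousLinearMap.comp_apply,
      chartDeriv_chartSymmDeriv hu] at h
    exact h
  finrank_eq u hu := by
    let e := LinearEquiv.ofBijective _ (pontryaginMap_bijective hu)
    have h1 : diracRep L p u = (L.fiber ((extChartAt I p).symm u)).map
        (e.symm : Pontryagin I ((extChartAt I p).symm u) →ₗ[ℝ] (E × (E →L[ℝ] ℝ))) :=
      Submodule.comap_equiv_eq_map_symm e _
    rw [h1, LinearEquiv.finrank_map_eq]
    exact L.finrank_eq _
  exists_sections u hu := by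
    classical
    have hsec : ∀ a ∈ diracRep L p u, ∃ (U : Set N) (X : ∀ q : N, TangentSpace I q)
        (ξ : ∀ q : N, Cotangent I q), IsOpen U ∧ (extChartAt I p).symm u ∈ U ∧
        SmoothVectorFieldOn I X U ∧ SmoothOneFormOn I ξ U ∧ (∀ q ∈ U, (X q, ξ q) ∈ L.fiber q) ∧
        (X ((extChartAt I p).symm u), ξ ((extChartAt I p).symm u)) = pontryaginMap I p u a :=
      fun a ha => L.smooth _ _ ha
    choose! U X ξ hUo huU hX hξ hL heq using hsec
    refine ⟨fun a y => (vecRep I p (X a) y, formRep I p (ξ a) y), fun a ha => ⟨?_, ?_⟩, ?_⟩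
    · refine (pontryaginMap_bijective hu).1 ?_
      rw [← heq a ha]
      exact pontryaginMap_coords hu _ _
    · filter_upwards [target_mem_nhds hu,
        (contMDiffAt_chart_symm hu).continuousAt ((hUo a ha).mem_nhds (huU a ha))] with w hw hwU
      have hn := (hUo a ha).mem_nhds hwU
      refine ⟨((contMDiffAt_vec_iff hw).1 ((hX a ha _ hwU).contMDiffAt hn)).prodMk
        ((contMDiffAt_form_iff hw).1 ((hξ a ha _ hwU).contMDiffAt hn)), ?_⟩
      exact (coords_mem_diracRep hw).2 (hL a ha _ hwU)
    · intro a ha b hb c hc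
      have hall : ∀ i, ![a, b, c] i ∈ diracRep L p u := by
        intro i; fin_cases i
        exacts [ha, hb, hc]
      exact courantTerm_sum L hu (U := fun i => U (![a, b, c] i)) (X := fun i => X (![a, b, c] i))
        (ξ := fun i => ξ (![a, b, c] i)) (fun i => hUo _ (hall i)) (fun i => huU _ (hall i))
        (fun i => hX _ (hall i)) (fun i => hξ _ (hall i)) (fun i => hL _ (hall i))

end LocalDirac

/-! ### Inverse chart derivatives indexed by points of the manifold. -/

section ChartInv

variable {E H : Type*} [NormedAddCommGroup E] [NormedSpace ℝ E] [TopologicalSpace H]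
  {I : ModelWithCorners ℝ E H} [I.Boundaryless] {N : Type*} [TopologicalSpace N]
  [ChartedSpace H N] [IsManifold I ∞ N]

variable (I) in
/-- The inverse of the derivative of the chart at `p`. -/
def chartInv (p q : N) : E →L[ℝ] TangentSpace I q := (chartDeriv I p q).inverse

theorem chartInv_eq {p : N} {u : E} (hu : u ∈ (extChartAt I p).target) :
    chartInv I p ((extChartAt I p).symm u) = chartSymmDeriv I p u :=
  ContinuousLinearMap.inverse_eq (chartDeriv_comp_chartSymmDeriv hu)
    (chartSymmDeriv_comp_chartDeriv hu)

theorem exists_eq_chart_symm {p q : N} (hq : q ∈ (extChartAt I p).source) :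
    ∃ u ∈ (extChartAt I p).target, q = (extChartAt I p).symm u ∧ u = extChartAt I p q :=
  ⟨extChartAt I p q, (extChartAt I p).map_source hq, ((extChartAt I p).left_inv hq).symm, rfl⟩

theorem chartDeriv_chartInv {p q : N} (hq : q ∈ (extChartAt I p).source) (v : E) :
    chartDeriv I p q (chartInv I p q v) = v := by
  obtain ⟨u, hu, rfl, -⟩ := exists_eq_chart_symm hq
  rw [chartInv_eq hu, chartDeriv_chartSymmDeriv hu]

theorem chartInv_chartDeriv {p q : N} (hq : q ∈ (extChartAt I p).source) (v : TangentSpace I q) :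
    chartInv I p q (chartDeriv I p q v) = v := by
  obtain ⟨u, hu, rfl, -⟩ := exists_eq_chart_symm hq
  rw [chartInv_eq hu, chartSymmDeriv_chartDeriv hu]

theorem comp_chartInv_chartDeriv {p q : N} (hq : q ∈ (extChartAt I p).source)
    (ξ : Cotangent I q) : (ξ ∘L chartInv I p q) ∘L chartDeriv I p q = ξ :=
  ContinuousLinearMap.ext fun v => congrArg ξ (chartInv_chartDeriv hq v)

theorem comp_chartDeriv_chartInv {p q : N} (hq : q ∈ (extChartAt I p).source)
    (ξ : E →L[ℝ] ℝ) : (ξ ∘L chartDeriv I p q) ∘L chartInv I p q = ξ :=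
  ContinuousLinearMap.ext fun v => congrArg ξ (chartDeriv_chartInv hq v)

theorem mem_diracRep_iff {L : DiracStructure I N} {p q : N} (hq : q ∈ (extChartAt I p).source)
    {a : E × (E →L[ℝ] ℝ)} : a ∈ diracRep L p (extChartAt I p q) ↔
      (chartInv I p q a.1, a.2 ∘L chartDeriv I p q) ∈ L.fiber q := by
  obtain ⟨u, hu, rfl, -⟩ := exists_eq_chart_symm hq
  rw [chartInv_eq hu, (extChartAt I p).right_inv hu]
  exact mem_diracRep

theorem hasMFDerivAt_chart {p q : N} (hq : q ∈ (extChartAt I p).source) :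
    HasMFDerivAt I 𝓘(ℝ, E) (extChartAt I p) q (chartDeriv I p q) :=
  (mdifferentiableAt_extChartAt (by rw [← extChartAt_source I]; exact hq)).hasMFDerivAt

theorem hasMFDerivAt_chart_symm {p q : N} (hq : q ∈ (extChartAt I p).source) :
    HasMFDerivAt 𝓘(ℝ, E) I (extChartAt I p).symm (extChartAt I p q) (chartInv I p q) := by
  obtain ⟨u, hu, rfl, -⟩ := exists_eq_chart_symm hq
  rw [chartInv_eq hu, (extChartAt I p).right_inv hu]
  exact ((contMDiffAt_chart_symm hu).mdifferentiableAt (by simp)).hasMFDerivAt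

end ChartInv

/-! ### Charts of the total space of a vector bundle. -/

section BundleCharts

variable {E H : Type*} [NormedAddCommGroup E] [NormedSpace ℝ E]
  [TopologicalSpace H] {I : ModelWithCorners ℝ E H} [I.Boundaryless] {N : Type*}
  [TopologicalSpace N] [ChartedSpace H N] [IsManifold I ∞ N] {G : Type*} [NormedAddCommGroup G]
  [NormedSpace ℝ G] {Z : N → Type*} [TopologicalSpace (TotalSpace G Z)]
  [∀ x, AddCommMonoid (Z x)] [∀ x, Module ℝ (Z x)] [∀ x, TopologicalSpace (Z x)]
  [FiberBundle G Z] [VectorBundle ℝ G Z] [ContMDiffVectorBundle ∞ G Z I]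

/-- The fibre coordinates of an element of a bundle in the trivialization at `b`. -/
def fiberCoord (b : N) (e : TotalSpace G Z) : G := (trivializationAt G Z b e).2

theorem bundle_mem_source {p e : TotalSpace G Z} :
    e ∈ (extChartAt (I.prod 𝓘(ℝ, G)) p).source ↔
      e.proj ∈ (extChartAt I p.proj).source ∧ e.proj ∈ (trivializationAt G Z p.proj).baseSet := by
  rw [FiberBundle.extChartAt, PartialEquiv.trans_source]
  simp only [Trivialization.source_eq, PartialEquiv.prod_source, PartialEquiv.refl_source,
    mem_inter_iff, mem_preimage, mem_prod, mem_univ, and_true]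
  constructor
  · rintro ⟨h1, h2⟩
    refine ⟨?_, h1⟩
    rw [← (trivializationAt G Z p.proj).coe_fst' h1]
    exact h2
  · rintro ⟨h1, h2⟩
    refine ⟨h2, ?_⟩
    rw [← (trivializationAt G Z p.proj).coe_fst' h2] at h1
    exact h1

theorem bundle_chart_apply {p e : TotalSpace G Z}
    (he : e ∈ (extChartAt (I.prod 𝓘(ℝ, G)) p).source) :
    extChartAt (I.prod 𝓘(ℝ, G)) p e =
      (extChartAt I p.proj e.proj, fiberCoord p.proj e) := by
  rw [FiberBundle.extChartAt]
  have h := (trivializationAt G Z p.proj).coe_fst' (bundle_mem_source.1 he).2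
  change (extChartAt I p.proj (trivializationAt G Z p.proj e).1, _) = _
  rw [h]
  rfl

theorem bundle_mem_target {p : TotalSpace G Z} {u : E × G} :
    u ∈ (extChartAt (I.prod 𝓘(ℝ, G)) p).target ↔
      u.1 ∈ (extChartAt I p.proj).target ∧ (extChartAt I p.proj).symm u.1 ∈
        (trivializationAt G Z p.proj).baseSet := by
  rw [FiberBundle.extChartAt_target]
  simp

theorem mdifferentiableAt_bundle_proj (e : TotalSpace G Z) :
    MDifferentiableAt (I.prod 𝓘(ℝ, G)) I (fun e : TotalSpace G Z => e.proj) e :=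
  (contMDiffAt_proj (n := ∞) (IB := I) Z).mdifferentiableAt (by simp)

/-- The bundle projection in coordinates. -/
theorem chartDeriv_mfderiv_proj {p e : TotalSpace G Z}
    (he : e ∈ (extChartAt (I.prod 𝓘(ℝ, G)) p).source)
    (v : TangentSpace (I.prod 𝓘(ℝ, G)) e) :
    chartDeriv I p.proj e.proj
      (mfderiv (I.prod 𝓘(ℝ, G)) I (fun e : TotalSpace G Z => e.proj) e v) =
      (chartDeriv (I.prod 𝓘(ℝ, G)) p e v).1 := by
  have h1 := (hasMFDerivAt_chart (bundle_mem_source.1 he).1).comp e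
    (mdifferentiableAt_bundle_proj e).hasMFDerivAt
  have h2 := hasMFDerivAt_chart he
  have h3 : HasMFDerivAt 𝓘(ℝ, E × G) 𝓘(ℝ, E) (Prod.fst : E × G → E)
      (extChartAt (I.prod 𝓘(ℝ, G)) p e) (ContinuousLinearMap.fst ℝ E G) :=
    hasMFDerivAt_iff_hasFDerivAt.2 hasFDerivAt_fst
  have h4 := h3.comp e h2
  have h5 : (extChartAt I p.proj ∘ fun e : TotalSpace G Z => e.proj) =ᶠ[𝓝 e]
      Prod.fst ∘ extChartAt (I.prod 𝓘(ℝ, G)) p := by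
    filter_upwards [(isOpen_extChartAt_source p).mem_nhds he] with z hz
    rw [Function.comp_apply, Function.comp_apply, bundle_chart_apply hz]
  have h6 := hasMFDerivAt_unique h1 (h4.congr_of_eventuallyEq h5)
  exact DFunLike.congr_fun h6 v

theorem mfderiv_proj_eq {p e : TotalSpace G Z}
    (he : e ∈ (extChartAt (I.prod 𝓘(ℝ, G)) p).source)
    (v : TangentSpace (I.prod 𝓘(ℝ, G)) e) :
    mfderiv (I.prod 𝓘(ℝ, G)) I (fun e : TotalSpace G Z => e.proj) e v =
      chartInv I p.proj e.proj (chartDeriv (I.prod 𝓘(ℝ, G)) p e v).1 := by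
  rw [← chartDeriv_mfderiv_proj he, chartInv_chartDeriv (bundle_mem_source.1 he).1]

theorem contMDiffAt_fiberCoord {b : N} {e : TotalSpace G Z}
    (he : e.proj ∈ (trivializationAt G Z b).baseSet) :
    ContMDiffAt (I.prod 𝓘(ℝ, G)) 𝓘(ℝ, G) ∞ (fun z : TotalSpace G Z => fiberCoord b z) e :=
  (((trivializationAt G Z b).contMDiffAt_iff (IB := I) (n := ∞) (f := id) (x₀ := e)
    ((trivializationAt G Z b).mem_source.2 he)).1 contMDiffAt_id).2

end BundleCharts

/-! ### Fibre coordinates of the dual bundle. -/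

section DualBundle

variable {E H : Type*} [NormedAddCommGroup E] [NormedSpace ℝ E] [FiniteDimensional ℝ E]
  [TopologicalSpace H] {I : ModelWithCorners ℝ E H} [I.Boundaryless] {N : Type*}
  [TopologicalSpace N] [ChartedSpace H N] [IsManifold I ∞ N] {k : ℕ} {D : Subbundle I N k}

/-- The preferred trivialization was built from a chosen frame of `D`. Recovering that frame lets
fibre coordinates be read as values of the linear form on frame vectors. -/
theorem exists_isFrameOn_triv (b : N) : ∃ (U : Set N) (s : Fin k → ∀ x : N, TangentSpace I x)
    (hs : IsFrameOn D.space s U), b ∈ U ∧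
      (trivializationAt (Fin k → ℝ) D.Dual b).baseSet = U ∧
      ∀ (x : N) (hx : x ∈ U) (e : D.Dual x), fiberCoord b ⟨x, e⟩ = hs.coord hx e := by
  refine ⟨_, _, (D.exists_frame b).choose_spec.choose_spec.2,
    (D.exists_frame b).choose_spec.choose_spec.1, rfl, fun x hx e => ?_⟩
  exact congrArg Prod.snd
    ((D.exists_frame b).choose_spec.choose_spec.2.pretrivialization_apply hx e)

theorem exists_fiberCoord {b x : N} (hx : x ∈ (trivializationAt (Fin k → ℝ) D.Dual b).baseSet)
    (y : Fin k → ℝ) : ∃ e : D.Dual x, fiberCoord b ⟨x, e⟩ = y := by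
  obtain ⟨U, s, hs, -, hU, h⟩ := exists_isFrameOn_triv (D := D) b
  rw [hU] at hx
  exact ⟨(hs.coord hx).symm y, by rw [h x hx, LinearEquiv.apply_symm_apply]⟩

theorem fiberCoord_zero {b x : N} (hx : x ∈ (trivializationAt (Fin k → ℝ) D.Dual b).baseSet) :
    fiberCoord b (⟨x, 0⟩ : D.DualTotal) = 0 := by
  obtain ⟨U, s, hs, -, hU, h⟩ := exists_isFrameOn_triv (D := D) b
  rw [hU] at hx
  rw [h x hx, map_zero]

/-- The linear form on `TN` extending an element of the dual bundle by zero on `V`. -/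
def Splitting.embedForm (V : Splitting D) (e : D.DualTotal) : Cotangent I e.proj :=
  e.2.form ∘L V.proj e.proj

theorem Splitting.embedForm_apply_mem (V : Splitting D) (e : D.DualTotal)
    {v : TangentSpace I e.proj} (hv : v ∈ D.space e.proj) :
    V.embedForm e v = e.2.form ⟨v, hv⟩ := by
  change e.2.form ((D.space e.proj).projectionOnto (V.space e.proj) (V.isCompl e.proj) v) = _
  congr 1
  exact Submodule.projectionOnto_apply_left (V.isCompl e.proj) ⟨v, hv⟩

theorem Splitting.embedForm_apply_compl (V : Splitting D) (e : D.DualTotal)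
    {v : TangentSpace I e.proj} (hv : v ∈ V.space e.proj) : V.embedForm e v = 0 := by
  change e.2.form ((D.space e.proj).projectionOnto (V.space e.proj) (V.isCompl e.proj) v) = _
  rw [(Submodule.projectionOnto_apply_eq_zero_iff (V.isCompl e.proj)).2 hv, map_zero]

end DualBundle

/-! ### The embedding of the dual bundle in coordinates. -/

section Theta

theorem contDiffAt_clm_apply {G V W : Type*} [NormedAddCommGroup G] [NormedSpace ℝ G]
    [NormedAddCommGroup V] [NormedSpace ℝ V] [NormedAddCommGroup W] [NormedSpace ℝ W]
    (L : V →L[ℝ] W) {f : G → V} {g : G} (hf : ContDiffAt ℝ ∞ f g) :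
    ContDiffAt ℝ ∞ (fun z => L (f z)) g :=
  L.contDiff.contDiffAt.comp g hf

theorem contDiffAt_flip_compL {G A B C : Type*} [NormedAddCommGroup G] [NormedSpace ℝ G]
    [NormedAddCommGroup A] [NormedSpace ℝ A] [NormedAddCommGroup B] [NormedSpace ℝ B]
    [NormedAddCommGroup C] [NormedSpace ℝ C] {f : G → A →L[ℝ] B} {g : G} (hf : ContDiffAt ℝ ∞ f g)
    (T : C →L[ℝ] (B →L[ℝ] ℝ)) :
    ContDiffAt ℝ ∞ (fun z => ((ContinuousLinearMap.compL ℝ A B ℝ).flip (f z)).comp T) g := by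
  have h1 : ContDiffAt ℝ ∞ (fun z => (ContinuousLinearMap.compL ℝ A B ℝ).flip (f z)) g :=
    contDiffAt_clm_apply (V := A →L[ℝ] B) (W := (B →L[ℝ] ℝ) →L[ℝ] (A →L[ℝ] ℝ)) _ hf
  exact h1.clm_comp contDiffAt_const

/-- Linear forms with prescribed values on a smooth frame depend smoothly on the base point. -/
theorem exists_smooth_form {E : Type*} [NormedAddCommGroup E] [NormedSpace ℝ E]
    [FiniteDimensional ℝ E] {k m : ℕ} (hkm : k + m = Module.finrank ℝ E) {x₀ : E}
    {S : Fin k → E → E} {Z : Fin m → E → E} (hS : ∀ i, ∀ᶠ x in 𝓝 x₀, ContDiffAt ℝ ∞ (S i) x)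
    (hZ : ∀ j, ∀ᶠ x in 𝓝 x₀, ContDiffAt ℝ ∞ (Z j) x)
    (hli : ∀ (c : Fin k → ℝ) (d : Fin m → ℝ),
      ∑ i, c i • S i x₀ + ∑ j, d j • Z j x₀ = 0 → c = 0 ∧ d = 0) :
    ∃ Θ : E → (Fin k → ℝ) →L[ℝ] E →L[ℝ] ℝ, ∀ᶠ x in 𝓝 x₀, ContDiffAt ℝ ∞ Θ x ∧
      ∀ (y : Fin k → ℝ) (l : E →L[ℝ] ℝ), (∀ i, l (S i x) = y i) → (∀ j, l (Z j x) = 0) →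
        l = Θ x y := by
  let pr₁ : Fin k → (Fin k → ℝ) × (Fin m → ℝ) →L[ℝ] ℝ := fun i =>
    (ContinuousLinearMap.proj i).comp (.fst ℝ _ _)
  let pr₂ : Fin m → (Fin k → ℝ) × (Fin m → ℝ) →L[ℝ] ℝ := fun j =>
    (ContinuousLinearMap.proj j).comp (.snd ℝ _ _)
  let A : E → (Fin k → ℝ) × (Fin m → ℝ) →L[ℝ] E := fun x =>
    ∑ i, ContinuousLinearMap.smulRightL ℝ _ _ (pr₁ i) (S i x) +
      ∑ j, ContinuousLinearMap.smulRightL ℝ _ _ (pr₂ j) (Z j x)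
  have hA : ∀ x v, A x v = ∑ i, v.1 i • S i x + ∑ j, v.2 j • Z j x := by
    intro x v
    simp [A, pr₁, pr₂]
  have hinj : Function.Injective (A x₀) := by
    refine (injective_iff_map_eq_zero _).2 fun v hv => ?_
    rw [hA] at hv
    exact Prod.ext (hli _ _ hv).1 (hli _ _ hv).2
  obtain ⟨e₀, he₀⟩ := exists_equiv_of_injective (A x₀) hinj (by
    rw [Module.finrank_prod, Module.finrank_fin_fun, Module.finrank_fin_fun, hkm])
  have hAs : ∀ᶠ x in 𝓝 x₀, ContDiffAt ℝ ∞ A x := by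
    filter_upwards [Filter.eventually_all.2 hS, Filter.eventually_all.2 hZ] with x h1 h2
    refine ContDiffAt.add (ContDiffAt.sum fun i _ => ?_) (ContDiffAt.sum fun j _ => ?_)
    · exact (ContinuousLinearMap.contDiff _).contDiffAt.comp x (h1 i)
    · exact (ContinuousLinearMap.contDiff _).contDiffAt.comp x (h2 j)
  have hunit : ∀ᶠ x in 𝓝 x₀, A x ∈ range ((↑) :
      (((Fin k → ℝ) × (Fin m → ℝ)) ≃L[ℝ] E) → _ →L[ℝ] _) := by
    refine hAs.self_of_nhds.continuousAt.eventually_mem ?_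
    rw [← he₀]
    exact ContinuousLinearEquiv.nhds e₀
  let T : (Fin k → ℝ) →L[ℝ] ((Fin k → ℝ) × (Fin m → ℝ) →L[ℝ] ℝ) :=
    LinearMap.toContinuousLinearMap
      { toFun := fun y => ∑ i, y i • pr₁ i
        map_add' := fun y z => by simp [add_smul, Finset.sum_add_distrib]
        map_smul' := fun c y => by simp [Finset.smul_sum, mul_smul] }
  have hT : ∀ y v, T y v = ∑ i, v.1 i * y i := by
    intro y v
    change (∑ i, y i • pr₁ i) v = _
    simp [pr₁, mul_comm]
  -- The frame map `A x` is invertible near `x₀`. The form with values `y` on the `S i` and zero on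
  -- the `Z j` is the coefficient form `T y` composed with its inverse.
  refine ⟨fun x => ((ContinuousLinearMap.compL ℝ E ((Fin k → ℝ) × (Fin m → ℝ)) ℝ).flip
    (A x).inverse).comp T, ?_⟩
  filter_upwards [hAs, hunit] with x h1 ⟨e, he⟩
  constructor
  · have h5 := contDiffAt_map_inverse (𝕜 := ℝ) (n := ∞) e
    rw [he] at h5
    exact contDiffAt_flip_compL (h5.comp x h1) T
  · intro y l hl hl'
    ext v
    obtain ⟨w, rfl⟩ := e.surjective v
    have h6 : (e : (Fin k → ℝ) × (Fin m → ℝ) →L[ℝ] E) w = A x w := by rw [he]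
    change l _ = T y ((A x).inverse (e w))
    rw [← he, ContinuousLinearMap.inverse_equiv]
    change l (e w) = T y (e.symm (e w))
    rw [e.symm_apply_apply, hT]
    change l ((e : (Fin k → ℝ) × (Fin m → ℝ) →L[ℝ] E) w) = _
    rw [h6, hA, map_add, map_sum, map_sum]
    simp [hl, hl']

variable {E H : Type*} [NormedAddCommGroup E] [NormedSpace ℝ E] [FiniteDimensional ℝ E]
  [TopologicalSpace H] {I : ModelWithCorners ℝ E H} [I.Boundaryless] {N : Type*}
  [TopologicalSpace N] [ChartedSpace H N] [IsManifold I ∞ N] {k : ℕ} {D : Subbundle I N k}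

theorem eventually_contDiffAt_vecRep {b : N} {X : ∀ q : N, TangentSpace I q} {U : Set N}
    (hU : IsOpen U) (hb : b ∈ U) (hX : SmoothVectorFieldOn I X U) :
    ∀ᶠ x in 𝓝 (extChartAt I b b), ContDiffAt ℝ ∞ (vecRep I b X) x := by
  have h0 := mem_extChartAt_target (I := I) b
  have h1 : (extChartAt I b).symm (extChartAt I b b) ∈ U := by rwa [extChartAt_to_inv]
  filter_upwards [target_mem_nhds h0,
    (contMDiffAt_chart_symm h0).continuousAt (hU.mem_nhds h1)] with x hx hxU
  exact (contMDiffAt_vec_iff hx).1 ((hX _ hxU).contMDiffAt (hU.mem_nhds hxU))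

/-- The function `Θ` represents the embedding of the dual bundle given by a splitting, in the charts
at `b`. -/
structure Splitting.IsThetaOn (V : Splitting D) (b : N) (O : Set E)
    (Θ : E → (Fin k → ℝ) →L[ℝ] E →L[ℝ] ℝ) : Prop where
  isOpen : IsOpen O
  mem_target : ∀ x ∈ O, x ∈ (extChartAt I b).target
  mem_baseSet : ∀ x ∈ O, (extChartAt I b).symm x ∈
    (trivializationAt (Fin k → ℝ) D.Dual b).baseSet
  contDiffOn : ContDiffOn ℝ ∞ Θ O
  embedForm_eq : ∀ e : D.DualTotal, e.proj ∈ (extChartAt I b).source →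
    extChartAt I b e.proj ∈ O →
      V.embedForm e ∘L chartInv I b e.proj = Θ (extChartAt I b e.proj) (fiberCoord b e)

theorem Splitting.IsThetaOn.mono {V : Splitting D} {b : N} {O O' : Set E}
    {Θ : E → (Fin k → ℝ) →L[ℝ] E →L[ℝ] ℝ} (h : V.IsThetaOn b O Θ) (hO' : IsOpen O')
    (hs : O' ⊆ O) : V.IsThetaOn b O' Θ :=
  ⟨hO', fun x hx => h.mem_target x (hs hx), fun x hx => h.mem_baseSet x (hs hx),
    h.contDiffOn.mono hs, fun e he heO => h.embedForm_eq e he (hs heO)⟩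

/-- The extended form takes the fibre coordinates as values on a frame of `D` and vanishes on local
sections of `V`. Together these form a basis near `b`, so `exists_smooth_form` applies. -/
theorem Splitting.exists_isThetaOn (V : Splitting D) (b : N) :
    ∃ (O : Set E) (Θ : E → (Fin k → ℝ) →L[ℝ] E →L[ℝ] ℝ), V.IsThetaOn b O Θ ∧
      extChartAt I b b ∈ O := by
  obtain ⟨U, s, hs, hbU, hbase, hcoord⟩ := exists_isFrameOn_triv (D := D) b
  let w := Module.finBasis ℝ (V.space b)
  set m := Module.finrank ℝ (V.space b)
  -- A basis of the single fibre `V b` suffices: independence together with the frame of `D` at `b`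
  -- persists nearby.
  choose U' Z hU' hbU' hZ hZV hZb using fun j => V.smooth b (w j) (w j).2
  have hbs := mem_extChartAt_source (I := I) b
  have h0 := mem_extChartAt_target (I := I) b
  have hkm : k + m = Module.finrank ℝ E := by
    have h1 : Module.finrank ℝ (D.space b) = k := by
      rw [Module.finrank_eq_card_basis (hs.basis hbU), Fintype.card_fin]
    have h2 := Submodule.finrank_add_eq_of_isCompl (V.isCompl b)
    rw [h1] at h2
    exact h2
  have hrep : ∀ X : ∀ q : N, TangentSpace I q, vecRep I b X (extChartAt I b b) =
      chartDeriv I b b (X b) := by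
    intro X
    rw [vecRep, extChartAt_to_inv]
  obtain ⟨Θ, hΘ⟩ := exists_smooth_form hkm (x₀ := extChartAt I b b)
    (S := fun i => vecRep I b (s i)) (Z := fun j => vecRep I b (Z j))
    (fun i => eventually_contDiffAt_vecRep hs.isOpen hbU (hs.smooth i))
    (fun j => eventually_contDiffAt_vecRep (hU' j) (hbU' j) (hZ j)) (by
      intro c d hcd
      simp only [hrep] at hcd
      have h1 := congrArg (chartInv I b b) hcd
      rw [map_add, map_sum, map_sum, map_zero] at h1
      simp only [map_smul, chartInv_chartDeriv hbs, hZb] at h1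
      have h2 : ∑ i, c i • s i b ∈ D.space b :=
        Submodule.sum_mem _ fun i _ => Submodule.smul_mem _ _ (hs.mem hbU i)
      have h3 : ∑ j, d j • (w j : TangentSpace I b) ∈ V.space b :=
        Submodule.sum_mem _ fun j _ => Submodule.smul_mem _ _ (w j).2
      have h4 : ∑ i, c i • s i b = 0 := by
        refine Submodule.disjoint_def.1 (V.isCompl b).disjoint _ h2 ?_
        rw [eq_neg_of_add_eq_zero_left h1]
        exact Submodule.neg_mem _ h3
      rw [h4, zero_add] at h1
      refine ⟨funext (Fintype.linearIndependent_iff.1 (hs.linearIndependent b hbU) c h4),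
        funext (Fintype.linearIndependent_iff.1 w.linearIndependent d (Subtype.ext ?_))⟩
      simpa using h1)
  have hev : ∀ᶠ x in 𝓝 (extChartAt I b b), x ∈ (extChartAt I b).target ∧
      (extChartAt I b).symm x ∈ U ∧ ∀ j, (extChartAt I b).symm x ∈ U' j := by
    have hc := (contMDiffAt_chart_symm h0).continuousAt
    have hinv : (extChartAt I b).symm (extChartAt I b b) = b := extChartAt_to_inv b
    filter_upwards [target_mem_nhds h0, hc (hs.isOpen.mem_nhds (by rwa [hinv])),
      Filter.eventually_all.2 fun j => hc ((hU' j).mem_nhds (by rw [hinv]; exact hbU' j))]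
      with x h1 h2 h3 using ⟨h1, h2, h3⟩
  obtain ⟨O, hO, hOo, hbO⟩ := eventually_nhds_iff.1 (hΘ.and hev)
  refine ⟨O, Θ, ⟨hOo, fun x hx => (hO x hx).2.1, fun x hx => ?_,
    fun x hx => (hO x hx).1.1.contDiffWithinAt, fun e he heO => ?_⟩, hbO⟩
  · rw [hbase]; exact (hO x hx).2.2.1
  · obtain ⟨⟨-, h1⟩, -, h2, h3⟩ := hO _ heO
    rw [(extChartAt I b).left_inv he] at h2 h3
    have hval : ∀ X : ∀ q : N, TangentSpace I q,
        chartInv I b e.proj (vecRep I b X (extChartAt I b e.proj)) = X e.proj := by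
      intro X
      rw [vecRep, (extChartAt I b).left_inv he, chartInv_chartDeriv he]
    refine h1 _ _ (fun i => ?_) fun j => ?_
    · rw [ContinuousLinearMap.comp_apply, hval, V.embedForm_apply_mem e (hs.mem h2 i)]
      have h4 := congrFun (hcoord e.proj h2 e.2) i
      rw [hs.coord_apply] at h4
      refine Eq.trans ?_ h4.symm
      exact congrArg _ (Subtype.ext (hs.coe_basis h2 i).symm)
    · rw [ContinuousLinearMap.comp_apply, hval]
      exact V.embedForm_apply_compl e (hZV j _ (h3 j))

end Theta

/-! ### The canonical one-form in charts of the cotangent bundle. -/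

section Cotangent

variable {E H : Type*} [NormedAddCommGroup E] [NormedSpace ℝ E] [TopologicalSpace H]
  {I : ModelWithCorners ℝ E H} [I.Boundaryless] {N : Type*} [TopologicalSpace N]
  [ChartedSpace H N] [IsManifold I ∞ N]

theorem fiberCoord_cotangent {b q : N} (hq : q ∈ (extChartAt I b).source) (ξ : Cotangent I q) :
    fiberCoord b (⟨q, ξ⟩ : CotangentBundle I N) = ξ ∘L chartInv I b q := by
  obtain ⟨u, hu, rfl, -⟩ := exists_eq_chart_symm hq
  rw [chartInv_eq hu]
  exact triv_cotangent_apply hu ξ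

/-- The canonical one-form in a chart of the cotangent bundle is `(x, p) ↦ p ∘ fst`. -/
theorem formRep_canonicalOneForm (η : CotangentBundle I N) {w : E × (E →L[ℝ] ℝ)}
    (hw : w ∈ (extChartAt (I.prod 𝓘(ℝ, E →L[ℝ] ℝ)) η).target) :
    formRep (I.prod 𝓘(ℝ, E →L[ℝ] ℝ)) η (fun ζ : CotangentBundle I N => canonicalOneForm ζ) w =
      w.2 ∘L .fst ℝ E (E →L[ℝ] ℝ) := by
  set z : CotangentBundle I N := (extChartAt (I.prod 𝓘(ℝ, E →L[ℝ] ℝ)) η).symm w with hz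
  have hzs : z ∈ (extChartAt (I.prod 𝓘(ℝ, E →L[ℝ] ℝ)) η).source :=
    (extChartAt (I.prod 𝓘(ℝ, E →L[ℝ] ℝ)) η).map_target hw
  have h1 := bundle_chart_apply hzs
  rw [hz, (extChartAt (I.prod 𝓘(ℝ, E →L[ℝ] ℝ)) η).right_inv hw, ← hz] at h1
  have h2 : w.2 = z.2 ∘L chartInv I η.proj z.proj := by
    rw [h1]
    exact fiberCoord_cotangent (bundle_mem_source.1 hzs).1 z.2
  refine ContinuousLinearMap.ext fun v => ?_
  rw [h2]
  have h3 := mfderiv_proj_eq hzs (chartSymmDeriv (I.prod 𝓘(ℝ, E →L[ℝ] ℝ)) η w v)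
  rw [chartDeriv_chartSymmDeriv hw] at h3
  exact congrArg z.2 h3

theorem differentiableAt_formRep_canonicalOneForm (η : CotangentBundle I N) :
    DifferentiableAt ℝ (formRep (I.prod 𝓘(ℝ, E →L[ℝ] ℝ)) η
      (fun ζ : CotangentBundle I N => canonicalOneForm ζ))
      (extChartAt (I.prod 𝓘(ℝ, E →L[ℝ] ℝ)) η η) := by
  have h1 : DifferentiableAt ℝ (fun w : E × (E →L[ℝ] ℝ) => w.2 ∘L .fst ℝ E (E →L[ℝ] ℝ))
      (extChartAt (I.prod 𝓘(ℝ, E →L[ℝ] ℝ)) η η) :=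
    differentiableAt_snd.clm_comp (differentiableAt_const _)
  refine h1.congr_of_eventuallyEq ?_
  filter_upwards [target_mem_nhds (mem_extChartAt_target η)] with w hw
  exact formRep_canonicalOneForm η hw

end Cotangent

/-! ### Pullback of the canonical symplectic form to the dual bundle. -/

section DualBundle

variable {E H : Type*} [NormedAddCommGroup E] [NormedSpace ℝ E] [FiniteDimensional ℝ E]
  [TopologicalSpace H] {I : ModelWithCorners ℝ E H} [I.Boundaryless] {N : Type*}
  [TopologicalSpace N] [ChartedSpace H N] [IsManifold I ∞ N] {k : ℕ} {D : Subbundle I N k}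

/-- The part of the dual bundle over the subset of the base given by `O` in the chart at `b`. -/
def overChart (D : Subbundle I N k) (b : N) (O : Set E) : Set D.DualTotal :=
  {e | e.proj ∈ (extChartAt I b).source ∧ extChartAt I b e.proj ∈ O}

theorem isOpen_overChart {b : N} {O : Set E} (hO : IsOpen O) : IsOpen (overChart D b O) :=
  ((continuousOn_extChartAt b).isOpen_inter_preimage (isOpen_extChartAt_source b) hO).preimage
    (FiberBundle.continuous_proj (Fin k → ℝ) D.Dual)

variable {V : Splitting D} {b : N} {O : Set E} {Θ : E → (Fin k → ℝ) →L[ℝ] E →L[ℝ] ℝ}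

theorem Splitting.IsThetaOn.baseSet (h : V.IsThetaOn b O Θ) {e : D.DualTotal}
    (he : e ∈ overChart D b O) :
    e.proj ∈ (trivializationAt (Fin k → ℝ) D.Dual b).baseSet := by
  have := h.mem_baseSet _ he.2
  rwa [(extChartAt I b).left_inv he.1] at this

theorem Splitting.IsThetaOn.mem_source (h : V.IsThetaOn b O Θ) {p e : D.DualTotal}
    (hp : p.proj = b) (he : e ∈ overChart D b O) :
    e ∈ (extChartAt (I.prod 𝓘(ℝ, Fin k → ℝ)) p).source := by
  subst hp
  exact bundle_mem_source.2 ⟨he.1, h.baseSet he⟩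

theorem contMDiffAt_base_chart {b : N} {e : D.DualTotal} (he : e.proj ∈ (extChartAt I b).source) :
    ContMDiffAt (I.prod 𝓘(ℝ, Fin k → ℝ)) 𝓘(ℝ, E) ∞
      (fun z : D.DualTotal => extChartAt I b z.proj) e := by
  have h1 : ContMDiffAt I 𝓘(ℝ, E) ∞ (extChartAt I b) e.proj :=
    contMDiffAt_extChartAt' (by rw [← extChartAt_source I]; exact he)
  exact h1.comp e (contMDiffAt_proj (IB := I) D.Dual)

theorem Splitting.IsThetaOn.contMDiffAt_embed (h : V.IsThetaOn b O Θ) {e : D.DualTotal}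
    (he : e ∈ overChart D b O) :
    ContMDiffAt (I.prod 𝓘(ℝ, Fin k → ℝ)) (I.prod 𝓘(ℝ, E →L[ℝ] ℝ)) ∞ V.embed e := by
  let t := trivializationAt (E →L[ℝ] ℝ) (fun q : N => TangentSpace I q →L[ℝ] ℝ) b
  have ht : V.embed e ∈ t.source := by
    rw [t.mem_source]
    refine ⟨?_, mem_univ _⟩
    have h1 := he.1
    rw [extChartAt_source I] at h1
    exact h1
  refine (t.contMDiffAt_iff (IB := I) (n := ∞) ht).2 ⟨contMDiffAt_proj (IB := I) D.Dual, ?_⟩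
  have h1 : (fun z : D.DualTotal => (t (V.embed z)).2) =ᶠ[𝓝 e]
      fun z => Θ (extChartAt I b z.proj) (fiberCoord b z) := by
    filter_upwards [(isOpen_overChart h.isOpen).mem_nhds he] with z hz
    rw [← h.embedForm_eq z hz.1 hz.2]
    exact fiberCoord_cotangent hz.1 _
  refine ContMDiffAt.congr_of_eventuallyEq ?_ h1
  have h2 : ContMDiffAt (I.prod 𝓘(ℝ, Fin k → ℝ)) 𝓘(ℝ, (Fin k → ℝ) →L[ℝ] E →L[ℝ] ℝ) ∞
      (fun z : D.DualTotal => Θ (extChartAt I b z.proj)) e :=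
    ((h.contDiffOn.contDiffAt (h.isOpen.mem_nhds he.2)).contMDiffAt).comp e
      (contMDiffAt_base_chart he.1)
  exact h2.clm_apply (contMDiffAt_fiberCoord (h.baseSet he))

/-- The primitive of the pullback of the canonical two-form, in coordinates. -/
def thetaForm (Θ : E → (Fin k → ℝ) →L[ℝ] E →L[ℝ] ℝ) (w : E × (Fin k → ℝ)) :
    E × (Fin k → ℝ) →L[ℝ] ℝ := (Θ w.1 w.2) ∘L .fst ℝ E (Fin k → ℝ)

theorem contDiffAt_thetaForm {w : E × (Fin k → ℝ)} (h : ContDiffAt ℝ ∞ Θ w.1) :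
    ContDiffAt ℝ ∞ (thetaForm Θ) w := by
  have h1 : ContDiffAt ℝ ∞ (fun w : E × (Fin k → ℝ) => Θ w.1) w := h.comp w contDiffAt_fst
  exact (h1.clm_apply contDiffAt_snd).clm_comp contDiffAt_const

/-- Pullback commutes with the exterior derivative. The canonical one-form at `V.embed e` evaluates
`V.embedForm e` on the projected vector, so its coordinate pullback is `thetaForm Θ`. -/
theorem Splitting.IsThetaOn.pullback_canonicalTwoForm (h : V.IsThetaOn b O Θ) {p e : D.DualTotal}
    (hp : p.proj = b) (he : e ∈ overChart D b O)
    (X Y : TangentSpace (I.prod 𝓘(ℝ, Fin k → ℝ)) e) :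
    pullbackTwoForm V.embed (fun η : CotangentBundle I N => canonicalTwoForm η) e X Y =
      twoForm (thetaForm Θ) (extChartAt (I.prod 𝓘(ℝ, Fin k → ℝ)) p e)
        (chartDeriv (I.prod 𝓘(ℝ, Fin k → ℝ)) p e X)
        (chartDeriv (I.prod 𝓘(ℝ, Fin k → ℝ)) p e Y) := by
  have hes := h.mem_source hp he
  set ψ := extChartAt (I.prod 𝓘(ℝ, Fin k → ℝ)) p with hψ
  obtain ⟨u, hu, heu, -⟩ := exists_eq_chart_symm hes
  rw [← hψ] at hu heu
  have hopen : ∀ᶠ w in 𝓝 u, w ∈ ψ.target ∧ ψ.symm w ∈ overChart D b O := by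
    have h1 : ContinuousAt ψ.symm u := (contMDiffAt_chart_symm hu).continuousAt
    filter_upwards [target_mem_nhds hu, h1 ((isOpen_overChart h.isOpen).mem_nhds (heu ▸ he))]
      with w h1 h2 using ⟨h1, h2⟩
  have hemb := h.contMDiffAt_embed he
  let f : E × (Fin k → ℝ) → CotangentBundle I N := V.embed ∘ ψ.symm
  have hf : ∀ w, w ∈ ψ.target → ψ.symm w ∈ overChart D b O →
      ContMDiffAt 𝓘(ℝ, E × (Fin k → ℝ)) (I.prod 𝓘(ℝ, E →L[ℝ] ℝ)) ∞ f w := fun w hw hwO =>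
    (h.contMDiffAt_embed hwO).comp w (contMDiffAt_chart_symm hw)
  subst heu
  have key := extDerivOneForm_comp (hf u hu he)
    (α := fun ζ : CotangentBundle I N => canonicalOneForm ζ)
    (differentiableAt_formRep_canonicalOneForm (f u))
    (chartDeriv (I.prod 𝓘(ℝ, Fin k → ℝ)) p _ X) (chartDeriv (I.prod 𝓘(ℝ, Fin k → ℝ)) p _ Y)
  have hd : ∀ Z, mfderiv 𝓘(ℝ, E × (Fin k → ℝ)) (I.prod 𝓘(ℝ, E →L[ℝ] ℝ)) f u
      (chartDeriv (I.prod 𝓘(ℝ, Fin k → ℝ)) p (ψ.symm u) Z) =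
      mfderiv (I.prod 𝓘(ℝ, Fin k → ℝ)) (I.prod 𝓘(ℝ, E →L[ℝ] ℝ)) V.embed (ψ.symm u) Z := by
    intro Z
    have h1 : mfderiv 𝓘(ℝ, E × (Fin k → ℝ)) (I.prod 𝓘(ℝ, E →L[ℝ] ℝ)) f u =
        mfderiv (I.prod 𝓘(ℝ, Fin k → ℝ)) (I.prod 𝓘(ℝ, E →L[ℝ] ℝ)) V.embed (ψ.symm u) ∘L
          chartSymmDeriv (I.prod 𝓘(ℝ, Fin k → ℝ)) p u :=
      mfderiv_comp u (hemb.mdifferentiableAt (by simp))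
        ((contMDiffAt_chart_symm hu).mdifferentiableAt (by simp))
    rw [h1]
    exact congrArg _ (chartSymmDeriv_chartDeriv hu Z)
  rw [hd, hd] at key
  refine Eq.trans key ?_
  rw [ψ.right_inv hu]
  refine DFunLike.congr_fun (DFunLike.congr_fun (twoForm_congr ?_) _) _
  -- The embedding covers the identity of the base, so both projections have the same derivative on
  -- the chart. That derivative is `fst` in coordinates.
  filter_upwards [hopen] with w ⟨hw, hwO⟩
  have hws : ψ.symm w ∈ ψ.source := ψ.map_target hw
  have h1 := bundle_chart_apply (p := p) hws
  rw [← hψ, ψ.right_inv hw, hp] at h1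
  refine ContinuousLinearMap.ext fun v => ?_
  have h2 : mfderiv 𝓘(ℝ, E × (Fin k → ℝ)) I ((fun e : D.DualTotal => e.proj) ∘ ψ.symm) w =
      mfderiv (I.prod 𝓘(ℝ, Fin k → ℝ)) I (fun e : D.DualTotal => e.proj) (ψ.symm w) ∘L
        chartSymmDeriv (I.prod 𝓘(ℝ, Fin k → ℝ)) p w :=
    mfderiv_comp w (mdifferentiableAt_bundle_proj (ψ.symm w))
      ((contMDiffAt_chart_symm hw).mdifferentiableAt (by simp))
  have h3 : mfderiv 𝓘(ℝ, E × (Fin k → ℝ)) I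
      ((fun ζ : CotangentBundle I N => ζ.proj) ∘ f) w =
      mfderiv (I.prod 𝓘(ℝ, E →L[ℝ] ℝ)) I (fun ζ : CotangentBundle I N => ζ.proj) (f w) ∘L
        mfderiv 𝓘(ℝ, E × (Fin k → ℝ)) (I.prod 𝓘(ℝ, E →L[ℝ] ℝ)) f w :=
    mfderiv_comp w (mdifferentiableAt_bundle_proj (f w)) ((hf w hw hwO).mdifferentiableAt (by simp))
  have h4 := DFunLike.congr_fun (h3.symm.trans h2) v
  have h5 := mfderiv_proj_eq hws (chartSymmDeriv (I.prod 𝓘(ℝ, Fin k → ℝ)) p w v)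
  rw [chartDeriv_chartSymmDeriv hw, hp] at h5
  have h6 := DFunLike.congr_fun (h.embedForm_eq (ψ.symm w) hwO.1 hwO.2) v.1
  exact ((congrArg (V.embedForm (ψ.symm w)) (h4.trans h5)).trans h6).trans
    (congrArg (fun w' => thetaForm Θ w' v) h1).symm

end DualBundle

/-! ### The gauged pullback in coordinates, and its perfect pairing. -/

section GaugeCoordinates

variable {E H : Type*} [NormedAddCommGroup E] [NormedSpace ℝ E] [FiniteDimensional ℝ E]
  [TopologicalSpace H] {I : ModelWithCorners ℝ E H} [I.Boundaryless] {N : Type*}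
  [TopologicalSpace N] [ChartedSpace H N] [IsManifold I ∞ N] {k : ℕ}

theorem mem_gaugeTransform {J : ModelWithCorners ℝ E H}
    {B : ∀ p : N, TangentSpace J p →L[ℝ] Cotangent J p}
    {L : ∀ p : N, Submodule ℝ (Pontryagin J p)} {p : N} {X : TangentSpace J p}
    {ζ : Cotangent J p} :
    (X, ζ) ∈ gaugeTransform B L p ↔ ∃ ξ, (X, ξ) ∈ L p ∧ ζ = ξ + B p X := by
  constructor
  · rintro ⟨⟨X', ξ⟩, h, h'⟩
    obtain ⟨rfl, rfl⟩ := Prod.ext_iff.1 h'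
    exact ⟨ξ, h, rfl⟩
  · rintro ⟨ξ, h, rfl⟩
    exact ⟨(X, ξ), h, rfl⟩

/-- The Dirac structure `τ_B (π^*L)` in coordinates. -/
theorem mem_gauge_iff {L : DiracStructure I N} {D : Subbundle I N k} {p e : D.DualTotal}
    (he : e ∈ (extChartAt (I.prod 𝓘(ℝ, Fin k → ℝ)) p).source)
    {B : ∀ e : D.DualTotal, TangentSpace (I.prod 𝓘(ℝ, Fin k → ℝ)) e →L[ℝ]
      Cotangent (I.prod 𝓘(ℝ, Fin k → ℝ)) e}
    {B' : E × (Fin k → ℝ) →L[ℝ] E × (Fin k → ℝ) →L[ℝ] ℝ}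
    (hB : ∀ X Y : TangentSpace (I.prod 𝓘(ℝ, Fin k → ℝ)) e, B e X Y =
      B' (chartDeriv (I.prod 𝓘(ℝ, Fin k → ℝ)) p e X) (chartDeriv (I.prod 𝓘(ℝ, Fin k → ℝ)) p e Y))
    {X : TangentSpace (I.prod 𝓘(ℝ, Fin k → ℝ)) e} {ζ : Cotangent (I.prod 𝓘(ℝ, Fin k → ℝ)) e} :
    (X, ζ) ∈ gaugeTransform B (pullbackDirac (fun e : D.DualTotal => e.proj) L.fiber) e ↔
      LiftRel (diracRep L p.proj (extChartAt I p.proj e.proj)) B'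
        (chartDeriv (I.prod 𝓘(ℝ, Fin k → ℝ)) p e X)
        (ζ ∘L chartInv (I.prod 𝓘(ℝ, Fin k → ℝ)) p e) := by
  have heb := (bundle_mem_source.1 he).1
  rw [mem_gaugeTransform]
  constructor
  · rintro ⟨-, ⟨η, hη, rfl⟩, rfl⟩
    refine ⟨η ∘L chartInv I p.proj e.proj, ?_, ?_⟩
    · rw [mem_diracRep_iff heb, comp_chartInv_chartDeriv heb, ← mfderiv_proj_eq he]
      exact hη
    · refine ContinuousLinearMap.ext fun w => ?_
      have h1 := mfderiv_proj_eq he (chartInv (I.prod 𝓘(ℝ, Fin k → ℝ)) p e w)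
      have h2 := hB X (chartInv (I.prod 𝓘(ℝ, Fin k → ℝ)) p e w)
      rw [chartDeriv_chartInv he] at h1 h2
      exact congrArg₂ (· + ·) (congrArg η h1) h2
  · rintro ⟨η, hη, h⟩
    rw [mem_diracRep_iff heb, ← mfderiv_proj_eq he] at hη
    refine ⟨(η ∘L chartDeriv I p.proj e.proj) ∘L
      mfderiv (I.prod 𝓘(ℝ, Fin k → ℝ)) I (fun e : D.DualTotal => e.proj) e, ⟨_, hη, rfl⟩, ?_⟩
    refine ContinuousLinearMap.ext fun Y => ?_
    have h1 := DFunLike.congr_fun h (chartDeriv (I.prod 𝓘(ℝ, Fin k → ℝ)) p e Y)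
    have h2 : ζ (chartInv (I.prod 𝓘(ℝ, Fin k → ℝ)) p e
        (chartDeriv (I.prod 𝓘(ℝ, Fin k → ℝ)) p e Y)) = ζ Y :=
      congrArg ζ (chartInv_chartDeriv he Y)
    have h3 := congrArg η (chartDeriv_mfderiv_proj he Y)
    exact h2.symm.trans (h1.trans (congrArg₂ (· + ·) h3.symm (hB X Y).symm))

variable {L : DiracStructure I N} {hk : ∀ x, Module.finrank ℝ (L.char x) = k}
  {V V₀ V₁ : Splitting (L.charBundle hk)} {b : N} {O : Set E}
  {Θ Θ₀ Θ₁ : E → (Fin k → ℝ) →L[ℝ] E →L[ℝ] ℝ}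

theorem Splitting.IsThetaOn.mem_dirac_iff (h : V.IsThetaOn b O Θ)
    {p e : (L.charBundle hk).DualTotal} (hp : p.proj = b) (he : e ∈ overChart _ b O)
    {X : TangentSpace (I.prod 𝓘(ℝ, Fin k → ℝ)) e} {ζ : Cotangent (I.prod 𝓘(ℝ, Fin k → ℝ)) e} :
    (X, ζ) ∈ V.dirac e ↔
      LiftRel (diracRep L b (extChartAt (I.prod 𝓘(ℝ, Fin k → ℝ)) p e).1)
        (twoForm (thetaForm Θ) (extChartAt (I.prod 𝓘(ℝ, Fin k → ℝ)) p e))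
        (chartDeriv (I.prod 𝓘(ℝ, Fin k → ℝ)) p e X)
        (ζ ∘L chartInv (I.prod 𝓘(ℝ, Fin k → ℝ)) p e) := by
  have hs := h.mem_source hp he
  have h1 := mem_gauge_iff (L := L) hs (h.pullback_canonicalTwoForm hp he) (X := X) (ζ := ζ)
  refine h1.trans ?_
  subst hp
  rw [congrArg Prod.fst (bundle_chart_apply hs)]

theorem Splitting.IsThetaOn.apply_eq (h : V.IsThetaOn b O Θ) {x : E} (hx : x ∈ O)
    (y : Fin k → ℝ) : ∃ e : (L.charBundle hk).Dual ((extChartAt I b).symm x),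
      fiberCoord b (⟨_, e⟩ : (L.charBundle hk).DualTotal) = y ∧
      ∀ v, ∀ hv : (v, 0) ∈ diracRep L b x, Θ x y v = e.form ⟨chartSymmDeriv I b x v, hv⟩ := by
  obtain ⟨e, he⟩ := exists_fiberCoord (h.mem_baseSet x hx) y
  refine ⟨e, he, fun v hv => ?_⟩
  have hxt := h.mem_target x hx
  have h1 := h.embedForm_eq ⟨_, e⟩ ((extChartAt I b).map_target hxt)
    (by rwa [(extChartAt I b).right_inv hxt])
  rw [(extChartAt I b).right_inv hxt, he] at h1
  rw [← h1, ContinuousLinearMap.comp_apply, chartInv_eq hxt]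
  exact V.embedForm_apply_mem ⟨_, e⟩ hv

/-- The pairing of `E*` with the characteristic distribution is perfect. -/
theorem Splitting.IsThetaOn.isPerfect (h : V.IsThetaOn b O Θ) {x : E} (hx : x ∈ O) :
    IsPerfect (diracRep L b x) (Θ x) := by
  have hxt := h.mem_target x hx
  constructor
  · intro y hy
    obtain ⟨e, he, hΘ⟩ := h.apply_eq hx y
    have h0 : e.form = 0 := by
      refine ContinuousLinearMap.ext fun w => ?_
      have hw : (chartDeriv I b _ w.1, (0 : E →L[ℝ] ℝ)) ∈ diracRep L b x := by
        have := (coords_mem_diracRep (L := L) hxt (X := w.1) (ξ := 0)).2 w.2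
        rwa [ContinuousLinearMap.zero_comp] at this
      have h1 := hΘ _ hw
      rw [hy _ hw] at h1
      refine Eq.trans ?_ h1.symm
      exact congrArg e.form (Subtype.ext (chartSymmDeriv_chartDeriv hxt w.1).symm)
    have h1 : e = 0 := h0
    rw [← he, h1]
    exact fiberCoord_zero (h.mem_baseSet x hx)
  · intro v hv hy
    by_contra hne
    have hw : (⟨chartSymmDeriv I b x v, hv⟩ : L.char ((extChartAt I b).symm x)) ≠ 0 := by
      intro h0
      have h1 := congrArg (chartDeriv I b _) (congrArg Subtype.val h0)
      change chartDeriv I b _ (chartSymmDeriv I b x v) = chartDeriv I b _ 0 at h1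
      rw [chartDeriv_chartSymmDeriv hxt, map_zero] at h1
      exact hne h1
    -- A nonzero characteristic vector is detected by a linear form, hence by a point of the dual
    -- fibre.
    obtain ⟨f, hf⟩ : ∃ f : L.char ((extChartAt I b).symm x) →ₗ[ℝ] ℝ,
        f ⟨chartSymmDeriv I b x v, hv⟩ ≠ 0 := by
      by_contra! hall
      exact hw ((Module.forall_dual_apply_eq_zero_iff ℝ _).1 hall)
    let e : (L.charBundle hk).Dual ((extChartAt I b).symm x) := LinearMap.toContinuousLinearMap f
    have h1 := h.embedForm_eq ⟨_, e⟩ ((extChartAt I b).map_target hxt)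
      (by rwa [(extChartAt I b).right_inv hxt])
    rw [(extChartAt I b).right_inv hxt] at h1
    have h2 := hy (fiberCoord b (⟨_, e⟩ : (L.charBundle hk).DualTotal))
    rw [← h1, ContinuousLinearMap.comp_apply, chartInv_eq hxt] at h2
    exact hf ((V.embedForm_apply_mem ⟨_, e⟩ hv).symm.trans h2)

/-- Both embeddings extend the same linear form on the characteristic subspace, so the choice of
complement does not matter there. -/
theorem Splitting.IsThetaOn.eq_on_char (h₀ : V₀.IsThetaOn b O Θ₀) (h₁ : V₁.IsThetaOn b O Θ₁)
    {x : E} (hx : x ∈ O) (y : Fin k → ℝ) (v : E) (hv : (v, 0) ∈ diracRep L b x) :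
    Θ₀ x y v = Θ₁ x y v := by
  have hxt := h₀.mem_target x hx
  obtain ⟨e, he, hΘ⟩ := h₀.apply_eq hx y
  have h1 := h₁.embedForm_eq ⟨_, e⟩ ((extChartAt I b).map_target hxt)
    (by rwa [(extChartAt I b).right_inv hxt])
  rw [(extChartAt I b).right_inv hxt, he] at h1
  rw [hΘ v hv, ← h1, ContinuousLinearMap.comp_apply, chartInv_eq hxt]
  exact (V₁.embedForm_apply_mem ⟨_, e⟩ hv).symm

end GaugeCoordinates

/-! ### The Jacobi identity for functions from that for constant covectors. -/

section Jacobi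

theorem hasFDerivAt_pairing {F V W : Type*} [NormedAddCommGroup F] [NormedSpace ℝ F]
    [NormedAddCommGroup V] [NormedSpace ℝ V] [NormedAddCommGroup W] [NormedSpace ℝ W]
    {A : F → V →L[ℝ] ℝ} {P : F → W →L[ℝ] V} {B : F → W} {A' : F →L[ℝ] V →L[ℝ] ℝ}
    {P' : F →L[ℝ] W →L[ℝ] V} {B' : F →L[ℝ] W} {u : F} (hA : HasFDerivAt A A' u)
    (hP : HasFDerivAt P P' u) (hB : HasFDerivAt B B' u) (X : F) :
    fderiv ℝ (fun w => A w (P w (B w))) u X =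
      A' X (P u (B u)) + A u (P' X (B u)) + A u (P u (B' X)) := by
  rw [(hA.clm_apply (hP.clm_apply hB)).fderiv]
  simp only [add_apply, ContinuousLinearMap.comp_apply, ContinuousLinearMap.flip_apply, map_add]
  ring

variable {F : Type*} [NormedAddCommGroup F] [NormedSpace ℝ F]

/-- The terms with Hessians cancel in pairs, by skewness of `P` and symmetry of second derivatives.
The cyclic sum in the derivative of `P` remains. -/
theorem jacobi_of_fderiv {P : F → (F →L[ℝ] ℝ) →L[ℝ] F} {u : F} (hP : DifferentiableAt ℝ P u)
    (hsk : ∀ ξ η : F →L[ℝ] ℝ, η (P u ξ) = -ξ (P u η))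
    (hj : ∀ ξ₁ ξ₂ ξ₃ : F →L[ℝ] ℝ, ξ₃ (fderiv ℝ P u (P u ξ₁) ξ₂) + ξ₁ (fderiv ℝ P u (P u ξ₂) ξ₃) +
      ξ₂ (fderiv ℝ P u (P u ξ₃) ξ₁) = 0)
    {f g h : F → ℝ} (hf : ContDiffAt ℝ ∞ f u) (hg : ContDiffAt ℝ ∞ g u)
    (hh : ContDiffAt ℝ ∞ h u) :
    fderiv ℝ (fun w => fderiv ℝ h w (P w (fderiv ℝ g w))) u (P u (fderiv ℝ f u)) +
      fderiv ℝ (fun w => fderiv ℝ f w (P w (fderiv ℝ h w))) u (P u (fderiv ℝ g u)) +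
      fderiv ℝ (fun w => fderiv ℝ g w (P w (fderiv ℝ f w))) u (P u (fderiv ℝ h u)) = 0 := by
  have hd : ∀ {q : F → ℝ}, ContDiffAt ℝ ∞ q u →
      HasFDerivAt (fderiv ℝ q) (fderiv ℝ (fderiv ℝ q) u) u := fun hq =>
    ((hq.fderiv_right (m := ∞) (by simp)).differentiableAt (by simp)).hasFDerivAt
  have hs : ∀ {q : F → ℝ}, ContDiffAt ℝ ∞ q u → ∀ X Y,
      fderiv ℝ (fderiv ℝ q) u X Y = fderiv ℝ (fderiv ℝ q) u Y X := fun hq X Y =>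
    (hq.isSymmSndFDerivAt (by
      rw [minSmoothness_of_isRCLikeNormedField]
      exact WithTop.coe_le_coe.2 (le_top : (2 : ℕ∞) ≤ ⊤))) X Y
  rw [hasFDerivAt_pairing (V := F) (W := F →L[ℝ] ℝ) (hd hh) hP.hasFDerivAt (hd hg),
    hasFDerivAt_pairing (V := F) (W := F →L[ℝ] ℝ) (hd hf) hP.hasFDerivAt (hd hh),
    hasFDerivAt_pairing (V := F) (W := F →L[ℝ] ℝ) (hd hg) hP.hasFDerivAt (hd hf)]
  have h1 := hj (fderiv ℝ f u) (fderiv ℝ g u) (fderiv ℝ h u)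
  rw [hsk (fderiv ℝ (fderiv ℝ g) u (P u (fderiv ℝ f u))),
    hsk (fderiv ℝ (fderiv ℝ h) u (P u (fderiv ℝ g u))),
    hsk (fderiv ℝ (fderiv ℝ f) u (P u (fderiv ℝ h u))),
    hs hg (P u (fderiv ℝ f u)), hs hh (P u (fderiv ℝ g u)), hs hf (P u (fderiv ℝ h u))]
  linarith

end Jacobi

/-! ### Poisson brackets in a chart. -/

section BracketChart

variable {E H : Type*} [NormedAddCommGroup E] [NormedSpace ℝ E] [TopologicalSpace H]
  {I : ModelWithCorners ℝ E H} [I.Boundaryless] {N : Type*} [TopologicalSpace N]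
  [ChartedSpace H N] [IsManifold I ∞ N] {P : ∀ q : N, Cotangent I q →L[ℝ] TangentSpace I q}

theorem poissonBracket_chart {p : N} {w : E} (hw : w ∈ (extChartAt I p).target) {f g : N → ℝ}
    (hf : ContMDiffAt I 𝓘(ℝ, ℝ) ∞ f ((extChartAt I p).symm w))
    (hg : ContMDiffAt I 𝓘(ℝ, ℝ) ∞ g ((extChartAt I p).symm w)) :
    poissonBracket P f g ((extChartAt I p).symm w) =
      fderiv ℝ (g ∘ (extChartAt I p).symm) w
        (bivRep I p P w (fderiv ℝ (f ∘ (extChartAt I p).symm) w)) := by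
  have h1 : fderiv ℝ (f ∘ (extChartAt I p).symm) w ∘L chartDeriv I p _ =
      differential (I := I) f ((extChartAt I p).symm w) := by
    refine ContinuousLinearMap.ext fun v => ?_
    have h2 := mfderiv_chart hw hf (chartDeriv I p _ v)
    rw [chartSymmDeriv_chartDeriv hw] at h2
    exact h2.symm
  rw [bivRep_apply, h1, ← mfderiv_chart hw hg, chartSymmDeriv_chartDeriv hw]
  rfl

theorem jacobi_of_bivRep {p : N} {u : E} (hu : u ∈ (extChartAt I p).target)
    (hP : ContDiffAt ℝ ∞ (bivRep I p P) u)
    (hsk : ∀ ξ η : E →L[ℝ] ℝ, η (bivRep I p P u ξ) = -ξ (bivRep I p P u η))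
    (hj : ∀ ξ₁ ξ₂ ξ₃ : E →L[ℝ] ℝ, ξ₃ (fderiv ℝ (bivRep I p P) u (bivRep I p P u ξ₁) ξ₂) +
      ξ₁ (fderiv ℝ (bivRep I p P) u (bivRep I p P u ξ₂) ξ₃) +
      ξ₂ (fderiv ℝ (bivRep I p P) u (bivRep I p P u ξ₃) ξ₁) = 0)
    {U : Set N} (hU : IsOpen U) (huU : (extChartAt I p).symm u ∈ U) {f g h : N → ℝ}
    (hf : ContMDiffOn I 𝓘(ℝ, ℝ) ∞ f U) (hg : ContMDiffOn I 𝓘(ℝ, ℝ) ∞ g U)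
    (hh : ContMDiffOn I 𝓘(ℝ, ℝ) ∞ h U) :
    poissonBracket P f (poissonBracket P g h) ((extChartAt I p).symm u) +
      poissonBracket P g (poissonBracket P h f) ((extChartAt I p).symm u) +
      poissonBracket P h (poissonBracket P f g) ((extChartAt I p).symm u) = 0 := by
  have hev : ∀ᶠ w in 𝓝 u, w ∈ (extChartAt I p).target ∧ (extChartAt I p).symm w ∈ U := by
    filter_upwards [target_mem_nhds hu,
      (contMDiffAt_chart_symm hu).continuousAt (hU.mem_nhds huU)] with w h1 h2 using ⟨h1, h2⟩
  have hat : ∀ {q : N → ℝ}, ContMDiffOn I 𝓘(ℝ, ℝ) ∞ q U → ∀ {w : E},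
      (extChartAt I p).symm w ∈ U → ContMDiffAt I 𝓘(ℝ, ℝ) ∞ q ((extChartAt I p).symm w) :=
    fun {_} hq {_} hw => (hq _ hw).contMDiffAt (hU.mem_nhds hw)
  have hbr : ∀ {q r : N → ℝ}, ContMDiffOn I 𝓘(ℝ, ℝ) ∞ q U → ContMDiffOn I 𝓘(ℝ, ℝ) ∞ r U →
      poissonBracket P q r ∘ (extChartAt I p).symm =ᶠ[𝓝 u]
        fun w => fderiv ℝ (r ∘ (extChartAt I p).symm) w
          (bivRep I p P w (fderiv ℝ (q ∘ (extChartAt I p).symm) w)) := by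
    intro q r hq hr
    filter_upwards [hev] with w hw
    exact poissonBracket_chart hw.1 (hat hq hw.2) (hat hr hw.2)
  have hcd : ∀ {q : N → ℝ}, ContMDiffOn I 𝓘(ℝ, ℝ) ∞ q U →
      ContDiffAt ℝ ∞ (q ∘ (extChartAt I p).symm) u := fun hq =>
    (contMDiffAt_iff_chart hu).1 (hat hq huU)
  have hbs : ∀ {q r : N → ℝ}, ContMDiffOn I 𝓘(ℝ, ℝ) ∞ q U → ContMDiffOn I 𝓘(ℝ, ℝ) ∞ r U →
      ContMDiffAt I 𝓘(ℝ, ℝ) ∞ (poissonBracket P q r) ((extChartAt I p).symm u) := by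
    intro q r hq hr
    rw [contMDiffAt_iff_chart hu, contDiffAt_congr (hbr hq hr)]
    exact ((hcd hr).fderiv_right (m := ∞) (by simp)).clm_apply
      (hP.clm_apply ((hcd hq).fderiv_right (m := ∞) (by simp)))
  rw [poissonBracket_chart hu (hat hf huU) (hbs hg hh),
    poissonBracket_chart hu (hat hg huU) (hbs hh hf),
    poissonBracket_chart hu (hat hh huU) (hbs hf hg), (hbr hg hh).fderiv_eq,
    (hbr hh hf).fderiv_eq, (hbr hf hg).fderiv_eq]
  exact jacobi_of_fderiv (hP.differentiableAt (by simp)) hsk hj (hcd hf) (hcd hg) (hcd hh)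

end BracketChart

/-! ### The Poisson structure on the domain of transversality. -/

section PoissonNeighborhood

variable {E H : Type*} [NormedAddCommGroup E] [NormedSpace ℝ E] [FiniteDimensional ℝ E]
  [TopologicalSpace H] {I : ModelWithCorners ℝ E H} [I.Boundaryless] {N : Type*}
  [TopologicalSpace N] [ChartedSpace H N] [IsManifold I ∞ N] {k : ℕ}

theorem fst_eq_of_mem_target {D : Subbundle I N k} {p : D.DualTotal} {w : E × (Fin k → ℝ)}
    (hw : w ∈ (extChartAt (I.prod 𝓘(ℝ, Fin k → ℝ)) p).target) :
    extChartAt I p.proj ((extChartAt (I.prod 𝓘(ℝ, Fin k → ℝ)) p).symm w).proj = w.1 := by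
  have h1 := bundle_chart_apply ((extChartAt (I.prod 𝓘(ℝ, Fin k → ℝ)) p).map_target hw)
  rw [(extChartAt (I.prod 𝓘(ℝ, Fin k → ℝ)) p).right_inv hw] at h1
  exact (congrArg Prod.fst h1).symm

theorem overChart_symm_mem {D : Subbundle I N k} {p : D.DualTotal} {O : Set E}
    {w : E × (Fin k → ℝ)} (hw : w ∈ (extChartAt (I.prod 𝓘(ℝ, Fin k → ℝ)) p).target) :
    (extChartAt (I.prod 𝓘(ℝ, Fin k → ℝ)) p).symm w ∈ overChart D p.proj O ↔ w.1 ∈ O := by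
  rw [overChart, mem_ofPred_eq, fst_eq_of_mem_target hw]
  exact and_iff_right
    (bundle_mem_source.1 ((extChartAt (I.prod 𝓘(ℝ, Fin k → ℝ)) p).map_target hw)).1

variable {L : DiracStructure I N} {hk : ∀ x, Module.finrank ℝ (L.char x) = k}
  {V : Splitting (L.charBundle hk)} {p : (L.charBundle hk).DualTotal} {O : Set E}
  {Θ : E → (Fin k → ℝ) →L[ℝ] E →L[ℝ] ℝ}

theorem Splitting.IsThetaOn.isIsotropic (h : V.IsThetaOn p.proj O Θ) {x : E} (hx : x ∈ O) :
    IsIsotropic (diracRep L p.proj x) :=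
  (isDiracOn_diracRep L p.proj).isotropic x (h.mem_target x hx)

theorem Splitting.IsThetaOn.mem_target_iff (h : V.IsThetaOn p.proj O Θ) {w : E × (Fin k → ℝ)}
    (hw : w.1 ∈ O) : w ∈ (extChartAt (I.prod 𝓘(ℝ, Fin k → ℝ)) p).target :=
  bundle_mem_target.2 ⟨h.mem_target _ hw, h.mem_baseSet _ hw⟩

/-- The Dirac structure defined by a splitting, in coordinates. -/
theorem Splitting.IsThetaOn.mem_dirac_symm_iff (h : V.IsThetaOn p.proj O Θ)
    {w : E × (Fin k → ℝ)} (hw : w.1 ∈ O)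
    {X : TangentSpace (I.prod 𝓘(ℝ, Fin k → ℝ))
      ((extChartAt (I.prod 𝓘(ℝ, Fin k → ℝ)) p).symm w)}
    {ζ : Cotangent (I.prod 𝓘(ℝ, Fin k → ℝ))
      ((extChartAt (I.prod 𝓘(ℝ, Fin k → ℝ)) p).symm w)} :
    (X, ζ) ∈ V.dirac _ ↔ LiftRel (diracRep L p.proj w.1) (twoForm (thetaForm Θ) w)
      (chartDeriv (I.prod 𝓘(ℝ, Fin k → ℝ)) p _ X)
      (ζ ∘L chartSymmDeriv (I.prod 𝓘(ℝ, Fin k → ℝ)) p w) := by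
  have hwt := h.mem_target_iff hw
  rw [h.mem_dirac_iff rfl ((overChart_symm_mem hwt).2 hw),
    (extChartAt (I.prod 𝓘(ℝ, Fin k → ℝ)) p).right_inv hwt, chartInv_eq hwt]

theorem Splitting.IsThetaOn.transverse_iff (h : V.IsThetaOn p.proj O Θ)
    {w : E × (Fin k → ℝ)} (hw : w.1 ∈ O) :
    (∀ X, (X, 0) ∈ V.dirac ((extChartAt (I.prod 𝓘(ℝ, Fin k → ℝ)) p).symm w) → X = 0) ↔
      ∀ X, LiftRel (diracRep L p.proj w.1) (twoForm (thetaForm Θ) w) X 0 → X = 0 := by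
  have hwt := h.mem_target_iff hw
  constructor
  · intro h1 X hX
    have h2 := h1 (chartSymmDeriv (I.prod 𝓘(ℝ, Fin k → ℝ)) p w X) (by
      rw [h.mem_dirac_symm_iff hw, chartDeriv_chartSymmDeriv hwt, ContinuousLinearMap.zero_comp]
      exact hX)
    rw [← chartDeriv_chartSymmDeriv hwt X, h2, map_zero]
  · intro h1 X hX
    rw [h.mem_dirac_symm_iff hw, ContinuousLinearMap.zero_comp] at hX
    rw [← chartSymmDeriv_chartDeriv hwt X, h1 _ hX, map_zero]

theorem Splitting.IsThetaOn.eventually_liftSharp (h : V.IsThetaOn p.proj O Θ)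
    {u : E × (Fin k → ℝ)} (hu : u.1 ∈ O)
    (htr : ∀ X, LiftRel (diracRep L p.proj u.1) (twoForm (thetaForm Θ) u) X 0 → X = 0) :
    ∀ᶠ w in 𝓝 u, w.1 ∈ O ∧
      ContDiffAt ℝ ∞ (fun w : E × (Fin k → ℝ) =>
        liftSharp (diracRep L p.proj w.1) (twoForm (thetaForm Θ) w)) w ∧
      ∀ ξ, LiftRel (diracRep L p.proj w.1) (twoForm (thetaForm Θ) w)
        (liftSharp (diracRep L p.proj w.1) (twoForm (thetaForm Θ) w) ξ) ξ := by
  have hO : ∀ᶠ w : E × (Fin k → ℝ) in 𝓝 u, w.1 ∈ O :=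
    continuousAt_fst (h.isOpen.mem_nhds hu)
  filter_upwards [hO, (isDiracOn_diracRep L p.proj).eventually_liftSharp (g₀ := u) (q := Prod.fst)
    (h.mem_target _ hu) (Filter.Eventually.of_forall fun w => contDiffAt_fst)
    (hO.mono fun w hw => contDiffAt_twoForm
      (contDiffAt_thetaForm (h.contDiffOn.contDiffAt (h.isOpen.mem_nhds hw))))
    (fun w => twoForm_skew _ w) htr] with w h1 h2 using ⟨h1, h2⟩

theorem Splitting.IsThetaOn.liftRel_bivRep (h : V.IsThetaOn p.proj O Θ)
    {P : ∀ e : (L.charBundle hk).DualTotal, Cotangent (I.prod 𝓘(ℝ, Fin k → ℝ)) e →L[ℝ]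
      TangentSpace (I.prod 𝓘(ℝ, Fin k → ℝ)) e} {w : E × (Fin k → ℝ)} (hw : w.1 ∈ O)
    (hP : ∀ ξ, (P ((extChartAt (I.prod 𝓘(ℝ, Fin k → ℝ)) p).symm w) ξ, ξ) ∈ V.dirac _)
    (ξ : E × (Fin k → ℝ) →L[ℝ] ℝ) :
    LiftRel (diracRep L p.proj w.1) (twoForm (thetaForm Θ) w)
      (bivRep (I.prod 𝓘(ℝ, Fin k → ℝ)) p P w ξ) ξ := by
  have hwt := h.mem_target_iff hw
  have h1 := (h.mem_dirac_symm_iff hw).1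
    (hP (ξ ∘L chartDeriv (I.prod 𝓘(ℝ, Fin k → ℝ)) p _))
  have h2 : (ξ ∘L chartDeriv (I.prod 𝓘(ℝ, Fin k → ℝ)) p
      ((extChartAt (I.prod 𝓘(ℝ, Fin k → ℝ)) p).symm w)) ∘L
      chartSymmDeriv (I.prod 𝓘(ℝ, Fin k → ℝ)) p w = ξ :=
    ContinuousLinearMap.ext fun v => congrArg ξ (chartDeriv_chartSymmDeriv hwt v)
  rw [h2] at h1
  exact h1

/-- The points where the Dirac structure defined by a splitting is the graph of a bivector. -/
def Splitting.poissonDomain (V : Splitting (L.charBundle hk)) : Set (L.charBundle hk).DualTotal :=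
  {e | ∀ X, (X, 0) ∈ V.dirac e → X = 0}

open Classical in
/-- The bivector whose graph is the Dirac structure defined by a splitting. -/
def Splitting.sharp (V : Splitting (L.charBundle hk)) (e : (L.charBundle hk).DualTotal) :
    Cotangent (I.prod 𝓘(ℝ, Fin k → ℝ)) e →L[ℝ] TangentSpace (I.prod 𝓘(ℝ, Fin k → ℝ)) e :=
  if h : ∃ P : Cotangent (I.prod 𝓘(ℝ, Fin k → ℝ)) e →L[ℝ]
    TangentSpace (I.prod 𝓘(ℝ, Fin k → ℝ)) e, ∀ ξ, (P ξ, ξ) ∈ V.dirac e then h.choose else 0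

theorem exists_coords (V : Splitting (L.charBundle hk)) (e : (L.charBundle hk).DualTotal) :
    ∃ O Θ, V.IsThetaOn e.proj O Θ ∧
      (extChartAt (I.prod 𝓘(ℝ, Fin k → ℝ)) e e).1 ∈ O ∧
      (extChartAt (I.prod 𝓘(ℝ, Fin k → ℝ)) e).symm
        (extChartAt (I.prod 𝓘(ℝ, Fin k → ℝ)) e e) = e := by
  obtain ⟨O, Θ, h, hO⟩ := V.exists_isThetaOn e.proj
  refine ⟨O, Θ, h, ?_, extChartAt_to_inv e⟩
  rw [bundle_chart_apply (mem_extChartAt_source e)]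
  exact hO

theorem Splitting.sharp_mem {e : (L.charBundle hk).DualTotal} (he : e ∈ V.poissonDomain)
    (ξ : Cotangent (I.prod 𝓘(ℝ, Fin k → ℝ)) e) : (V.sharp e ξ, ξ) ∈ V.dirac e := by
  have hex : ∃ P : Cotangent (I.prod 𝓘(ℝ, Fin k → ℝ)) e →L[ℝ]
      TangentSpace (I.prod 𝓘(ℝ, Fin k → ℝ)) e, ∀ ξ, (P ξ, ξ) ∈ V.dirac e := by
    obtain ⟨O, Θ, h, hO, hinv⟩ := exists_coords V e
    have hes := mem_extChartAt_source (I := I.prod 𝓘(ℝ, Fin k → ℝ)) e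
    have htr := (h.transverse_iff hO).1 (by rw [hinv]; exact he)
    have hS := (h.eventually_liftSharp hO htr).self_of_nhds.2.2
    have hO' := hO
    rw [bundle_chart_apply hes] at hO'
    set u := extChartAt (I.prod 𝓘(ℝ, Fin k → ℝ)) e e
    generalize liftSharp (diracRep L e.proj u.1) (twoForm (thetaForm Θ) u) = S at hS
    refine ⟨chartInv (I.prod 𝓘(ℝ, Fin k → ℝ)) e e ∘L S ∘L
      ContinuousLinearMap.precomp ℝ (chartInv (I.prod 𝓘(ℝ, Fin k → ℝ)) e e), fun ξ => ?_⟩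
    rw [h.mem_dirac_iff (p := e) rfl ⟨(bundle_mem_source.1 hes).1, hO'⟩]
    have h1 := hS (ξ ∘L chartInv (I.prod 𝓘(ℝ, Fin k → ℝ)) e e)
    rw [← chartDeriv_chartInv hes (S _)] at h1
    exact h1
  rw [Splitting.sharp, dif_pos hex]
  exact hex.choose_spec ξ

/-- Transversality at one point gives bivectors at nearby points. Where a bivector exists,
uniqueness forces the vector over the zero covector to vanish. -/
theorem Splitting.isOpen_poissonDomain : IsOpen V.poissonDomain := by
  refine isOpen_iff_mem_nhds.2 fun e he => ?_
  obtain ⟨O, Θ, h, hO, hinv⟩ := exists_coords V e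
  have htr := (h.transverse_iff hO).1 (by rw [hinv]; exact he)
  have hc : ContinuousAt (extChartAt (I.prod 𝓘(ℝ, Fin k → ℝ)) e) e :=
    continuousAt_extChartAt e
  filter_upwards [hc.eventually (h.eventually_liftSharp hO htr),
    extChartAt_source_mem_nhds (I := I.prod 𝓘(ℝ, Fin k → ℝ)) e] with z hz hzs
  have h1 := (h.transverse_iff hz.1).2 fun X hX => by
    rw [LiftRel.eq_sharp (h.isIsotropic hz.1) (twoForm_skew _ _) hz.2.2 hX, map_zero]
  rw [(extChartAt (I.prod 𝓘(ℝ, Fin k → ℝ)) e).left_inv hzs] at h1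
  exact h1

/-- The pointwise choice of `V.sharp` does no harm: by uniqueness its representative in a chart is
the smooth `liftSharp`. The Jacobi identity is then the local one. -/
theorem Splitting.isPoissonOn_sharp : IsPoissonOn V.sharp V.poissonDomain := by
  have hloc : ∀ e ∈ V.poissonDomain, ∃ O Θ, V.IsThetaOn e.proj O Θ ∧
      (extChartAt (I.prod 𝓘(ℝ, Fin k → ℝ)) e e).1 ∈ O ∧
      (extChartAt (I.prod 𝓘(ℝ, Fin k → ℝ)) e).symm
        (extChartAt (I.prod 𝓘(ℝ, Fin k → ℝ)) e e) = e ∧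
      (∀ᶠ w in 𝓝 (extChartAt (I.prod 𝓘(ℝ, Fin k → ℝ)) e e),
        ∀ ξ, LiftRel (diracRep L e.proj w.1) (twoForm (thetaForm Θ) w)
          (bivRep (I.prod 𝓘(ℝ, Fin k → ℝ)) e V.sharp w ξ) ξ) ∧
      ContDiffAt ℝ ∞ (bivRep (I.prod 𝓘(ℝ, Fin k → ℝ)) e V.sharp)
        (extChartAt (I.prod 𝓘(ℝ, Fin k → ℝ)) e e) := by
    intro e he
    obtain ⟨O, Θ, h, hO, hinv⟩ := exists_coords V e
    have htr := (h.transverse_iff hO).1 (by rw [hinv]; exact he)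
    have hev := h.eventually_liftSharp hO htr
    have hdom : ∀ᶠ w in 𝓝 (extChartAt (I.prod 𝓘(ℝ, Fin k → ℝ)) e e),
        (extChartAt (I.prod 𝓘(ℝ, Fin k → ℝ)) e).symm w ∈ V.poissonDomain :=
      (contMDiffAt_chart_symm (mem_extChartAt_target (I := I.prod 𝓘(ℝ, Fin k → ℝ)) e)).continuousAt
        (V.isOpen_poissonDomain.mem_nhds (by rwa [hinv]))
    have hlift : ∀ᶠ w in 𝓝 (extChartAt (I.prod 𝓘(ℝ, Fin k → ℝ)) e e),
        ∀ ξ, LiftRel (diracRep L e.proj w.1) (twoForm (thetaForm Θ) w)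
          (bivRep (I.prod 𝓘(ℝ, Fin k → ℝ)) e V.sharp w ξ) ξ := by
      filter_upwards [hev, hdom] with w hw hwd
      exact h.liftRel_bivRep hw.1 fun ξ => V.sharp_mem hwd ξ
    refine ⟨O, Θ, h, hO, hinv, hlift, ?_⟩
    refine hev.self_of_nhds.2.1.congr_of_eventuallyEq ?_
    filter_upwards [hev, hlift] with w hw hwl
    exact (liftSharp_eq (h.isIsotropic hw.1) (twoForm_skew _ w) hwl).symm
  refine ⟨V.isOpen_poissonDomain, fun e he ξ η => ?_, fun e he => ?_, fun f g h hf hg hh e he => ?_⟩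
  · obtain ⟨O, Θ, h, hO, hinv, hlift, -⟩ := hloc e he
    have h1 := LiftRel.skew (h.isIsotropic hO) (twoForm_skew _ _) hlift.self_of_nhds
      (ξ ∘L chartInv (I.prod 𝓘(ℝ, Fin k → ℝ)) e e) (η ∘L chartInv (I.prod 𝓘(ℝ, Fin k → ℝ)) e e)
    have hes := mem_extChartAt_source (I := I.prod 𝓘(ℝ, Fin k → ℝ)) e
    have h2 : ∀ ξ η : Cotangent (I.prod 𝓘(ℝ, Fin k → ℝ)) e,
        (η ∘L chartInv (I.prod 𝓘(ℝ, Fin k → ℝ)) e e)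
          (bivRep (I.prod 𝓘(ℝ, Fin k → ℝ)) e V.sharp
            (extChartAt (I.prod 𝓘(ℝ, Fin k → ℝ)) e e)
            (ξ ∘L chartInv (I.prod 𝓘(ℝ, Fin k → ℝ)) e e)) = η (V.sharp e ξ) := by
      intro ξ η
      rw [bivRep_apply, hinv, comp_chartInv_chartDeriv hes, ContinuousLinearMap.comp_apply,
        chartInv_chartDeriv hes]
    rw [h2, h2] at h1
    exact h1
  · obtain ⟨O, Θ, h, hO, hinv, hlift, hcd⟩ := hloc e he
    have h1 := (contMDiffAt_biv_iff (mem_extChartAt_target e)).2 hcd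
    rw [hinv] at h1
    exact h1.contMDiffWithinAt
  · obtain ⟨O, Θ, hΘ, hO, hinv, hlift, hcd⟩ := hloc e he
    have h1 := jacobi_of_bivRep (mem_extChartAt_target e) hcd
      (LiftRel.skew (hΘ.isIsotropic hO) (twoForm_skew _ _) hlift.self_of_nhds)
      (jacobi_of_liftRel (Λ := diracRep L e.proj)
        (Filter.mem_of_superset (hΘ.isOpen.mem_nhds hO) fun y hy => hΘ.isIsotropic hy)
        ((isDiracOn_diracRep L e.proj).exists_sections _ (hΘ.mem_target _ hO))
        (contDiffAt_thetaForm (hΘ.contDiffOn.contDiffAt (hΘ.isOpen.mem_nhds hO)))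
        (hcd.differentiableAt (by simp)) hlift)
      V.isOpen_poissonDomain (by rwa [hinv]) hf hg hh
    rw [hinv] at h1
    exact h1

theorem Splitting.bivectorGraph_sharp {e : (L.charBundle hk).DualTotal}
    (he : e ∈ V.poissonDomain) : bivectorGraph V.sharp e = V.dirac e := by
  apply le_antisymm
  · rintro _ ⟨ξ, rfl⟩
    exact V.sharp_mem he ξ
  · rintro ⟨X, ζ⟩ h
    refine ⟨ζ, Prod.ext ?_ rfl⟩
    have h1 := Submodule.sub_mem _ h (V.sharp_mem he ζ)
    rw [Prod.mk_sub_mk, sub_self] at h1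
    exact (sub_eq_zero.1 (he _ h1)).symm

end PoissonNeighborhood

/-! ### The zero section as a smooth embedding. -/

section ZeroSection

variable {E H : Type*} [NormedAddCommGroup E] [NormedSpace ℝ E] [FiniteDimensional ℝ E]
  [TopologicalSpace H] {I : ModelWithCorners ℝ E H} [I.Boundaryless] {N : Type*}
  [TopologicalSpace N] [ChartedSpace H N] [IsManifold I ∞ N] {k : ℕ} {D : Subbundle I N k}

theorem contMDiff_zero : ContMDiff I (I.prod 𝓘(ℝ, Fin k → ℝ)) ∞
    (zeroSection (Fin k → ℝ) D.Dual) := Bundle.contMDiff_zeroSection ℝ D.Dual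

theorem zeroSection_mem_source {p : D.DualTotal} {x : N}
    (hx : x ∈ (extChartAt I p.proj).source)
    (hx' : x ∈ (trivializationAt (Fin k → ℝ) D.Dual p.proj).baseSet) :
    zeroSection (Fin k → ℝ) D.Dual x ∈ (extChartAt (I.prod 𝓘(ℝ, Fin k → ℝ)) p).source :=
  bundle_mem_source.2 ⟨hx, hx'⟩

theorem chart_zeroSection {p : D.DualTotal} {x : N}
    (hx : x ∈ (extChartAt I p.proj).source)
    (hx' : x ∈ (trivializationAt (Fin k → ℝ) D.Dual p.proj).baseSet) :
    extChartAt (I.prod 𝓘(ℝ, Fin k → ℝ)) p (zeroSection (Fin k → ℝ) D.Dual x) =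
      (extChartAt I p.proj x, 0) :=
  (bundle_chart_apply (zeroSection_mem_source hx hx')).trans (Prod.ext rfl (fiberCoord_zero hx'))

theorem chartDeriv_mfderiv_zeroSection {p : D.DualTotal} {x : N}
    (hx : x ∈ (extChartAt I p.proj).source)
    (hx' : x ∈ (trivializationAt (Fin k → ℝ) D.Dual p.proj).baseSet) (v : TangentSpace I x) :
    chartDeriv (I.prod 𝓘(ℝ, Fin k → ℝ)) p (zeroSection (Fin k → ℝ) D.Dual x)
      (mfderiv I (I.prod 𝓘(ℝ, Fin k → ℝ)) (zeroSection (Fin k → ℝ) D.Dual) x v) =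
      (chartDeriv I p.proj x v, 0) := by
  have h1 := (hasMFDerivAt_chart (zeroSection_mem_source hx hx')).comp x
    ((contMDiff_zero (D := D) x).mdifferentiableAt (by simp)).hasMFDerivAt
  have h2 : HasMFDerivAt 𝓘(ℝ, E) 𝓘(ℝ, E × (Fin k → ℝ))
      (ContinuousLinearMap.inl ℝ E (Fin k → ℝ)) (extChartAt I p.proj x)
      (ContinuousLinearMap.inl ℝ E (Fin k → ℝ)) :=
    hasMFDerivAt_iff_hasFDerivAt.2 (ContinuousLinearMap.hasFDerivAt _)
  have h3 := h2.comp x (hasMFDerivAt_chart hx)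
  refine DFunLike.congr_fun (hasMFDerivAt_unique (h1.congr_of_eventuallyEq ?_) h3) v
  filter_upwards [(isOpen_extChartAt_source p.proj).mem_nhds hx,
    (trivializationAt (Fin k → ℝ) D.Dual p.proj).open_baseSet.mem_nhds hx'] with z hz hz'
  exact (chart_zeroSection hz hz').symm

/-- In bundle charts the map is `x ↦ (x, 0)`, which gives the immersion. The bundle projection is a
continuous left inverse, which gives the topological embedding. -/
theorem isSmoothEmbedding_zeroSection :
    IsSmoothEmbedding I (I.prod 𝓘(ℝ, Fin k → ℝ)) ∞ (zeroSection (Fin k → ℝ) D.Dual) := by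
  refine ⟨IsImmersionOfComplement.isImmersion (F := Fin k → ℝ) fun x => ?_, ?_⟩
  · let p := zeroSection (Fin k → ℝ) D.Dual x
    let S := (trivializationAt (Fin k → ℝ) D.Dual x).baseSet
    have hS : IsOpen S := (trivializationAt (Fin k → ℝ) D.Dual x).open_baseSet
    -- The chart of the base is restricted to the base set of the trivialization, so that the zero
    -- section maps it into the domain of the bundle chart.
    refine IsImmersionAtOfComplement.mk_of_charts (ContinuousLinearEquiv.refl ℝ _)
      ((chartAt H x).restr S) (chartAt (ModelProd H (Fin k → ℝ)) p) ?_
      (mem_chart_source _ p) ?_ (IsManifold.chart_mem_maximalAtlas p) ?_ ?_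
    · exact ⟨mem_chart_source H x, by
        rw [hS.interior_eq]; exact FiberBundle.mem_baseSet_trivializationAt' x⟩
    · exact restr_mem_maximalAtlas (contDiffGroupoid ∞ I) (IsManifold.chart_mem_maximalAtlas x) hS
    · rintro z ⟨hz, hz'⟩
      rw [← extChartAt_source I] at hz
      have h1 := zeroSection_mem_source (p := p) hz (interior_subset hz')
      rwa [extChartAt_source] at h1
    · intro w hw
      have hz := (((chartAt H x).restr S).extend I).map_target hw
      have hz2 := (((chartAt H x).restr S).extend I).right_inv hw
      rw [OpenPartialHomeomorph.extend_source] at hz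
      have hz1 : (((chartAt H x).restr S).extend I).symm w ∈ (extChartAt I x).source := by
        rw [extChartAt_source]; exact hz.1
      exact (chart_zeroSection (p := p) hz1 (interior_subset hz.2)).trans (Prod.ext hz2 rfl)
  · exact Function.LeftInverse.isEmbedding (f := fun e : D.DualTotal => e.proj) (fun x => rfl)
      (FiberBundle.continuous_proj (Fin k → ℝ) D.Dual) contMDiff_zero.continuous

end ZeroSection

/-! ### The zero section is coisotropic and inherits the Dirac structure. -/

section Coisotropic

variable {E H : Type*} [NormedAddCommGroup E] [NormedSpace ℝ E] [FiniteDimensional ℝ E]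
  [TopologicalSpace H] {I : ModelWithCorners ℝ E H} [I.Boundaryless] {N : Type*}
  [TopologicalSpace N] [ChartedSpace H N] [IsManifold I ∞ N] {k : ℕ}
  {L : DiracStructure I N} {hk : ∀ x, Module.finrank ℝ (L.char x) = k}
  {V : Splitting (L.charBundle hk)}

theorem Splitting.IsThetaOn.twoForm_zeroSection {O : Set E} {b : N}
    {Θ : E → (Fin k → ℝ) →L[ℝ] E →L[ℝ] ℝ} (h : V.IsThetaOn b O Θ) {x : E} (hx : x ∈ O)
    (X Y : E × (Fin k → ℝ)) :
    twoForm (thetaForm Θ) (x, 0) X Y = Θ x X.2 Y.1 - Θ x Y.2 X.1 :=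
  twoForm_zero ((h.contDiffOn.contDiffAt (h.isOpen.mem_nhds hx)).differentiableAt (by simp)) X Y

variable (V) in
theorem exists_coords_zeroSection (x : N) :
    ∃ O Θ, V.IsThetaOn x O Θ ∧ extChartAt I x x ∈ O ∧
      extChartAt (I.prod 𝓘(ℝ, Fin k → ℝ)) (zeroSection (Fin k → ℝ) (L.charBundle hk).Dual x)
        (zeroSection (Fin k → ℝ) (L.charBundle hk).Dual x) = (extChartAt I x x, 0) ∧
      (extChartAt (I.prod 𝓘(ℝ, Fin k → ℝ))
        (zeroSection (Fin k → ℝ) (L.charBundle hk).Dual x)).symm (extChartAt I x x, 0) =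
        zeroSection (Fin k → ℝ) (L.charBundle hk).Dual x := by
  obtain ⟨O, Θ, h, hO⟩ := V.exists_isThetaOn x
  have h1 := chart_zeroSection (D := L.charBundle hk)
    (p := zeroSection (Fin k → ℝ) (L.charBundle hk).Dual x)
    (mem_extChartAt_source (I := I) x) (FiberBundle.mem_baseSet_trivializationAt' x)
  refine ⟨O, Θ, h, hO, h1, ?_⟩
  have h2 := extChartAt_to_inv (I := I.prod 𝓘(ℝ, Fin k → ℝ))
    (zeroSection (Fin k → ℝ) (L.charBundle hk).Dual x)
  rwa [h1] at h2

theorem Splitting.zeroSection_mem_poissonDomain (x : N) :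
    zeroSection (Fin k → ℝ) (L.charBundle hk).Dual x ∈ V.poissonDomain := by
  obtain ⟨O, Θ, h, hO, -, hinv⟩ := exists_coords_zeroSection V x
  have h1 := (h.transverse_iff (p := zeroSection (Fin k → ℝ) (L.charBundle hk).Dual x)
    (w := (extChartAt I x x, 0)) hO).2
    fun X hX => (h.isPerfect hO).transverse
      (h.isIsotropic (p := zeroSection (Fin k → ℝ) (L.charBundle hk).Dual x) hO)
      (h.twoForm_zeroSection hO) hX
  rw [hinv] at h1
  exact h1

theorem Splitting.isPoissonNeighborhood : V.IsPoissonNeighborhood V.poissonDomain V.sharp :=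
  ⟨V.zeroSection_mem_poissonDomain, V.isPoissonOn_sharp, fun _ he => V.bivectorGraph_sharp he⟩

theorem Splitting.isCoisotropicEmbedding :
    IsCoisotropicEmbedding (zeroSection (Fin k → ℝ) (L.charBundle hk).Dual) L.fiber V.sharp
      V.poissonDomain := by
  refine ⟨isSmoothEmbedding_zeroSection, V.zeroSection_mem_poissonDomain, fun x => ?_,
    fun x => ?_⟩
  all_goals
    obtain ⟨O, Θ, h, hO, hψ, hinv⟩ := exists_coords_zeroSection V x
    have hx := mem_extChartAt_source (I := I) x
    have hx' := FiberBundle.mem_baseSet_trivializationAt' (F := Fin k → ℝ)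
      (E := (L.charBundle hk).Dual) x
    have hdz : ∀ v, chartDeriv (I.prod 𝓘(ℝ, Fin k → ℝ)) _ _ (mfderiv I
        (I.prod 𝓘(ℝ, Fin k → ℝ)) (zeroSection (Fin k → ℝ) (L.charBundle hk).Dual) x v) =
        (chartDeriv I x x v, 0) := chartDeriv_mfderiv_zeroSection (D := L.charBundle hk)
      (p := zeroSection (Fin k → ℝ) (L.charBundle hk).Dual x) hx hx'
    set p := zeroSection (Fin k → ℝ) (L.charBundle hk).Dual x with hp
    have hps := mem_extChartAt_source (I := I.prod 𝓘(ℝ, Fin k → ℝ)) p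
    have hlift := h.liftRel_bivRep (p := p) (P := V.sharp) (w := (extChartAt I x x, 0)) hO
      (by rw [hinv]; exact V.sharp_mem (V.zeroSection_mem_poissonDomain x))
    have hiso := h.isIsotropic (p := p) hO
    have hbiv : ∀ ζ, bivRep (I.prod 𝓘(ℝ, Fin k → ℝ)) p V.sharp (extChartAt I x x, 0) ζ =
        chartDeriv (I.prod 𝓘(ℝ, Fin k → ℝ)) p p
          (V.sharp p (ζ ∘L chartDeriv (I.prod 𝓘(ℝ, Fin k → ℝ)) p p)) := by
      intro ζ
      rw [bivRep_apply, hinv]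
  · intro ξ hξ
    have h1 := hlift (ξ ∘L chartInv (I.prod 𝓘(ℝ, Fin k → ℝ)) p p)
    rw [hbiv, comp_chartInv_chartDeriv hps] at h1
    -- A conormal covector annihilates the horizontal directions in the chart. The perfect pairing
    -- then makes its Hamiltonian vector horizontal, hence tangent to the zero section.
    have h2 := (h.isPerfect hO).snd_eq_zero hiso (h.twoForm_zeroSection hO) h1 fun v => by
      have h3 := hdz (chartInv I x x v)
      rw [chartDeriv_chartInv hx] at h3
      rw [← h3]
      exact (congrArg ξ (chartInv_chartDeriv hps _)).trans (hξ _)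
    refine ⟨chartInv I x x (chartDeriv (I.prod 𝓘(ℝ, Fin k → ℝ)) p p (V.sharp p ξ)).1, ?_⟩
    have h4 := hdz (chartInv I x x (chartDeriv (I.prod 𝓘(ℝ, Fin k → ℝ)) p p (V.sharp p ξ)).1)
    rw [chartDeriv_chartInv hx] at h4
    have h5 : ((chartDeriv (I.prod 𝓘(ℝ, Fin k → ℝ)) p p (V.sharp p ξ)).1, (0 : Fin k → ℝ)) =
      chartDeriv (I.prod 𝓘(ℝ, Fin k → ℝ)) p p (V.sharp p ξ) := Prod.ext rfl h2.symm
    exact (chartInv_chartDeriv hps _).symm.trans ((congrArg _ (h4.trans h5)).trans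
      (chartInv_chartDeriv hps _))
  · ext ⟨X, α⟩
    -- This is the pullback statement in coordinates; the rest translates both sides.
    have h1 := LiftRel.zero_iff hiso (h.twoForm_zeroSection hO) hlift (chartDeriv I x x X)
      (α ∘L chartInv I x x)
    have h2 := mem_diracRep_iff (L := L) hx (a := (chartDeriv I x x X, α ∘L chartInv I x x))
    rw [chartInv_chartDeriv hx, comp_chartInv_chartDeriv hx] at h2
    refine Iff.trans ?_ (h1.symm.trans h2)
    constructor
    · rintro ⟨η, ⟨ζ, hζ⟩, hα⟩
      obtain ⟨hζ1, rfl⟩ := Prod.ext_iff.1 hζ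
      refine ⟨ζ ∘L chartInv (I.prod 𝓘(ℝ, Fin k → ℝ)) p p, ?_, ?_⟩
      · rw [hbiv, comp_chartInv_chartDeriv hps]
        exact (congrArg _ hζ1).trans (hdz X)
      · change α = _ at hα
        refine ContinuousLinearMap.ext fun v => ?_
        have h3 := hdz (chartInv I x x v)
        rw [chartDeriv_chartInv hx] at h3
        rw [hα]
        refine (congrArg ζ (chartInv_chartDeriv hps _)).symm.trans ?_
        exact congrArg (fun z => ζ (chartInv (I.prod 𝓘(ℝ, Fin k → ℝ)) p p z)) h3
    · rintro ⟨ζ, hζ, hα⟩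
      rw [hbiv] at hζ
      refine ⟨ζ ∘L chartDeriv (I.prod 𝓘(ℝ, Fin k → ℝ)) p p, ⟨_, Prod.ext ?_ rfl⟩, ?_⟩
      · refine (chartInv_chartDeriv hps _).symm.trans ((congrArg _ (hζ.trans (hdz X).symm)).trans
          (chartInv_chartDeriv hps _))
      · refine ContinuousLinearMap.ext fun v => ?_
        have h3 := DFunLike.congr_fun hα (chartDeriv I x x v)
        refine (congrArg α (chartInv_chartDeriv hx v)).symm.trans (h3.trans ?_)
        exact congrArg ζ (hdz v).symm

end Coisotropic

/-! ### Chart-free integral curves of the Moser field. -/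

section MoserCurves

variable {E : Type} {H : Type*} [NormedAddCommGroup E] [NormedSpace ℝ E] [FiniteDimensional ℝ E]
  [TopologicalSpace H] {I : ModelWithCorners ℝ E H} [I.Boundaryless] {N : Type*}
  [TopologicalSpace N] [ChartedSpace H N] [IsManifold I ∞ N] {k : ℕ}

/-- The linear map from the line with a given velocity. -/
def tangentLine {q : N} (v : TangentSpace I q) : ℝ →L[ℝ] TangentSpace I q :=
  (ContinuousLinearMap.id ℝ ℝ).smulRight v

theorem hasDerivWithinAt_chart {p : N} {γ : ℝ → N} {S : Set ℝ} {t : ℝ}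
    (hp : γ t ∈ (extChartAt I p).source) {v : TangentSpace I (γ t)}
    (h : HasMFDerivWithinAt 𝓘(ℝ, ℝ) I γ S t (tangentLine v)) :
    HasDerivWithinAt (fun s => extChartAt I p (γ s)) (chartDeriv I p (γ t) v) S t := by
  have h1 := (hasMFDerivAt_chart hp).comp_hasMFDerivWithinAt t h
  have h2 : HasFDerivWithinAt (fun s => extChartAt I p (γ s))
      (chartDeriv I p (γ t) ∘L tangentLine v : ℝ →L[ℝ] E) S t :=
    hasMFDerivWithinAt_iff_hasFDerivWithinAt.1 h1
  refine h2.hasDerivWithinAt.congr_deriv ?_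
  exact congrArg (chartDeriv I p (γ t)) (one_smul ℝ v)

theorem hasMFDerivWithinAt_chart_symm {p : N} {u : ℝ → E} {S : Set ℝ} {t : ℝ} {v : E}
    (hp : u t ∈ (extChartAt I p).target) (h : HasDerivWithinAt u v S t) :
    HasMFDerivWithinAt 𝓘(ℝ, ℝ) I (fun s => (extChartAt I p).symm (u s)) S t
      (tangentLine (chartSymmDeriv I p (u t) v)) := by
  have h1 := ((contMDiffAt_chart_symm hp).mdifferentiableAt (by simp)).hasMFDerivAt
  have h2 := h1.comp_hasMFDerivWithinAt t
    (hasMFDerivWithinAt_iff_hasFDerivWithinAt.2 h.hasFDerivWithinAt)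
  refine h2.congr_mfderiv ?_
  refine ContinuousLinearMap.ext fun c : ℝ => ?_
  exact map_smul (chartSymmDeriv I p (u t)) c v

variable {L : DiracStructure I N} {hk : ∀ x, Module.finrank ℝ (L.char x) = k}

/-- The interpolation between the Dirac structures defined by two splittings. -/
def moserDirac (V₀ V₁ : Splitting (L.charBundle hk)) (t : ℝ) (e : (L.charBundle hk).DualTotal) :
    Submodule ℝ (Pontryagin (I.prod 𝓘(ℝ, Fin k → ℝ)) e) :=
  gaugeTransform (fun e =>
      pullbackTwoForm V₀.embed (fun η : CotangentBundle I N => canonicalTwoForm η) e +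
      t • (pullbackTwoForm V₁.embed (fun η : CotangentBundle I N => canonicalTwoForm η) e -
        pullbackTwoForm V₀.embed (fun η : CotangentBundle I N => canonicalTwoForm η) e))
    (pullbackDirac (fun e : (L.charBundle hk).DualTotal => e.proj) L.fiber) e

/-- The difference of the primitives of the two-forms defined by two splittings. -/
def moserForm (V₀ V₁ : Splitting (L.charBundle hk)) (e : (L.charBundle hk).DualTotal) :
    Cotangent (I.prod 𝓘(ℝ, Fin k → ℝ)) e :=
  (V₁.embedForm e - V₀.embedForm e) ∘L
    mfderiv (I.prod 𝓘(ℝ, Fin k → ℝ)) I (fun e : (L.charBundle hk).DualTotal => e.proj) e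

/-- The integral curves of the time-dependent vector field of Moser's argument. -/
def IsMoserCurve (V₀ V₁ : Splitting (L.charBundle hk)) (γ : ℝ → (L.charBundle hk).DualTotal) :
    Prop :=
  ∀ t ∈ Icc (0 : ℝ) 1, (∀ X, (X, 0) ∈ moserDirac V₀ V₁ t (γ t) → X = 0) ∧
    ∃ v : TangentSpace (I.prod 𝓘(ℝ, Fin k → ℝ)) (γ t),
      HasMFDerivWithinAt 𝓘(ℝ, ℝ) (I.prod 𝓘(ℝ, Fin k → ℝ)) γ (Icc 0 1) t
        (tangentLine v) ∧
      (v, -moserForm V₀ V₁ (γ t)) ∈ moserDirac V₀ V₁ t (γ t)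

variable {V₀ V₁ : Splitting (L.charBundle hk)} {p : (L.charBundle hk).DualTotal} {O : Set E}
  {Θ₀ Θ₁ : E → (Fin k → ℝ) →L[ℝ] E →L[ℝ] ℝ}

theorem twoForm_sub {F : Type*} [NormedAddCommGroup F] [NormedSpace ℝ F] {a b : F → F →L[ℝ] ℝ}
    {u : F} (ha : DifferentiableAt ℝ a u) (hb : DifferentiableAt ℝ b u) (X Y : F) :
    twoForm (a - b) u X Y = twoForm a u X Y - twoForm b u X Y := by
  rw [twoForm_apply, twoForm_apply, twoForm_apply, fderiv_sub ha hb]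
  simp only [sub_apply]
  ring

theorem Splitting.IsThetaOn.contDiffAt_thetaForm {V : Splitting (L.charBundle hk)} {b : N}
    (h : V.IsThetaOn b O Θ₀) {w : E × (Fin k → ℝ)} (hw : w.1 ∈ O) :
    ContDiffAt ℝ ∞ (thetaForm Θ₀) w :=
  DiracGeometry.contDiffAt_thetaForm (h.contDiffOn.contDiffAt (h.isOpen.mem_nhds hw))

theorem gaugeFamily_theta (h₀ : V₀.IsThetaOn p.proj O Θ₀) (h₁ : V₁.IsThetaOn p.proj O Θ₁)
    {w : E × (Fin k → ℝ)} (hw : w.1 ∈ O) (t : ℝ) (X Y : E × (Fin k → ℝ)) :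
    gaugeFamily (thetaForm Θ₀) (thetaForm Θ₁ - thetaForm Θ₀) (t, w) X Y =
      twoForm (thetaForm Θ₀) w X Y +
        t * (twoForm (thetaForm Θ₁) w X Y - twoForm (thetaForm Θ₀) w X Y) := by
  rw [← twoForm_sub ((h₁.contDiffAt_thetaForm hw).differentiableAt (by simp))
    ((h₀.contDiffAt_thetaForm hw).differentiableAt (by simp))]
  rfl

theorem mem_moserDirac_iff (h₀ : V₀.IsThetaOn p.proj O Θ₀) (h₁ : V₁.IsThetaOn p.proj O Θ₁)
    {e : (L.charBundle hk).DualTotal} (he : e ∈ overChart _ p.proj O) {t : ℝ}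
    {X : TangentSpace (I.prod 𝓘(ℝ, Fin k → ℝ)) e} {ζ : Cotangent (I.prod 𝓘(ℝ, Fin k → ℝ)) e} :
    (X, ζ) ∈ moserDirac V₀ V₁ t e ↔
      LiftRel (diracRep L p.proj (extChartAt (I.prod 𝓘(ℝ, Fin k → ℝ)) p e).1)
        (gaugeFamily (thetaForm Θ₀) (thetaForm Θ₁ - thetaForm Θ₀)
          (t, extChartAt (I.prod 𝓘(ℝ, Fin k → ℝ)) p e))
        (chartDeriv (I.prod 𝓘(ℝ, Fin k → ℝ)) p e X)
        (ζ ∘L chartInv (I.prod 𝓘(ℝ, Fin k → ℝ)) p e) := by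
  have hs := h₀.mem_source rfl he
  have h2 := congrArg Prod.fst (bundle_chart_apply hs)
  have hw : (extChartAt (I.prod 𝓘(ℝ, Fin k → ℝ)) p e).1 ∈ O := by rw [h2]; exact he.2
  refine (mem_gauge_iff (L := L) hs (B' := gaugeFamily (thetaForm Θ₀)
    (thetaForm Θ₁ - thetaForm Θ₀) (t, extChartAt (I.prod 𝓘(ℝ, Fin k → ℝ)) p e))
    fun X Y => ?_).trans ?_
  · rw [gaugeFamily_theta h₀ h₁ hw, ← h₀.pullback_canonicalTwoForm rfl he,
      ← h₁.pullback_canonicalTwoForm rfl he]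
    rfl
  · rw [h2]

theorem moserForm_comp_chartInv (h₀ : V₀.IsThetaOn p.proj O Θ₀) (h₁ : V₁.IsThetaOn p.proj O Θ₁)
    {e : (L.charBundle hk).DualTotal} (he : e ∈ overChart _ p.proj O) :
    moserForm V₀ V₁ e ∘L chartInv (I.prod 𝓘(ℝ, Fin k → ℝ)) p e =
      (thetaForm Θ₁ - thetaForm Θ₀) (extChartAt (I.prod 𝓘(ℝ, Fin k → ℝ)) p e) := by
  have hs := h₀.mem_source rfl he
  refine ContinuousLinearMap.ext fun v => ?_
  have h3 := mfderiv_proj_eq hs (chartInv (I.prod 𝓘(ℝ, Fin k → ℝ)) p e v)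
  rw [chartDeriv_chartInv hs] at h3
  have e₀ := DFunLike.congr_fun (h₀.embedForm_eq e he.1 he.2) v.1
  have e₁ := DFunLike.congr_fun (h₁.embedForm_eq e he.1 he.2) v.1
  rw [bundle_chart_apply hs]
  exact (congrArg (V₁.embedForm e - V₀.embedForm e) h3).trans (congrArg₂ (· - ·) e₁ e₀)

theorem moserDirac_transverse_iff (h₀ : V₀.IsThetaOn p.proj O Θ₀)
    (h₁ : V₁.IsThetaOn p.proj O Θ₁) {e : (L.charBundle hk).DualTotal}
    (he : e ∈ overChart _ p.proj O) {t : ℝ} :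
    (∀ X, (X, 0) ∈ moserDirac V₀ V₁ t e → X = 0) ↔
      ∀ X, LiftRel (diracRep L p.proj (extChartAt (I.prod 𝓘(ℝ, Fin k → ℝ)) p e).1)
        (gaugeFamily (thetaForm Θ₀) (thetaForm Θ₁ - thetaForm Θ₀)
          (t, extChartAt (I.prod 𝓘(ℝ, Fin k → ℝ)) p e)) X 0 → X = 0 := by
  have hs := h₀.mem_source rfl he
  constructor
  · intro h X hX
    have h2 := h (chartInv (I.prod 𝓘(ℝ, Fin k → ℝ)) p e X) (by
      rw [mem_moserDirac_iff h₀ h₁ he, chartDeriv_chartInv hs, ContinuousLinearMap.zero_comp]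
      exact hX)
    rw [← chartDeriv_chartInv hs X, h2, map_zero]
  · intro h X hX
    rw [mem_moserDirac_iff h₀ h₁ he, ContinuousLinearMap.zero_comp] at hX
    rw [← chartInv_chartDeriv hs X, h _ hX, map_zero]

variable (V₀ V₁) in
theorem exists_isThetaOn₂ (b : N) : ∃ O Θ₀ Θ₁, V₀.IsThetaOn b O Θ₀ ∧ V₁.IsThetaOn b O Θ₁ ∧
    extChartAt I b b ∈ O := by
  obtain ⟨O₀, Θ₀, h₀, hO₀⟩ := V₀.exists_isThetaOn b
  obtain ⟨O₁, Θ₁, h₁, hO₁⟩ := V₁.exists_isThetaOn b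
  exact ⟨O₀ ∩ O₁, Θ₀, Θ₁, h₀.mono (h₀.isOpen.inter h₁.isOpen) inter_subset_left,
    h₁.mono (h₀.isOpen.inter h₁.isOpen) inter_subset_right, hO₀, hO₁⟩

/-! ### Uniqueness, reversal and constant curves -/

theorem IsMoserCurve.continuousOn {γ : ℝ → (L.charBundle hk).DualTotal}
    (h : IsMoserCurve V₀ V₁ γ) : ContinuousOn γ (Icc 0 1) := fun t ht => by
  obtain ⟨-, v, hv, -⟩ := h t ht
  exact hv.continuousWithinAt

/-- This puts a curve into the form required by `eventually_eq_of_moser`. Continuity keeps it in the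
chart for a short time, and derivatives within `[0, 1]` become right derivatives before time one. -/
theorem IsMoserCurve.eventually_chart {γ : ℝ → (L.charBundle hk).DualTotal}
    (h : IsMoserCurve V₀ V₁ γ) (h₀ : V₀.IsThetaOn p.proj O Θ₀) (h₁ : V₁.IsThetaOn p.proj O Θ₁)
    {t₀ : ℝ} (ht₀ : t₀ ∈ Ico (0 : ℝ) 1) (hγ : γ t₀ ∈ overChart _ p.proj O) :
    (∀ᶠ t in 𝓝[≥] t₀, ∃ v, HasDerivWithinAt
      (fun s => extChartAt (I.prod 𝓘(ℝ, Fin k → ℝ)) p (γ s)) v (Ici t) t ∧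
      LiftRel (diracRep L p.proj (extChartAt (I.prod 𝓘(ℝ, Fin k → ℝ)) p (γ t)).1)
        (gaugeFamily (thetaForm Θ₀) (thetaForm Θ₁ - thetaForm Θ₀)
          (t, extChartAt (I.prod 𝓘(ℝ, Fin k → ℝ)) p (γ t))) v
        (-(thetaForm Θ₁ - thetaForm Θ₀) (extChartAt (I.prod 𝓘(ℝ, Fin k → ℝ)) p (γ t)))) ∧
    (∀ᶠ t in 𝓝[≥] t₀, ContinuousWithinAt
      (fun s => extChartAt (I.prod 𝓘(ℝ, Fin k → ℝ)) p (γ s)) (Ici t₀) t) ∧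
    ∀ᶠ t in 𝓝[≥] t₀, γ t ∈ overChart _ p.proj O := by
  have hmem : ∀ {s t : ℝ}, 0 ≤ s → t < 1 → Icc (0 : ℝ) 1 ∈ 𝓝[Ici s] t := fun {s t} hs ht =>
    mem_nhdsWithin.2 ⟨Iio 1, isOpen_Iio, ht, fun r hr => ⟨hs.trans hr.2, hr.1.le⟩⟩
  have hev : ∀ᶠ t in 𝓝[≥] t₀, t ∈ Ico (0 : ℝ) 1 ∧ γ t ∈ overChart _ p.proj O := by
    have hc := (h.continuousOn t₀ ⟨ht₀.1, ht₀.2.le⟩).mono_of_mem_nhdsWithin (hmem ht₀.1 ht₀.2)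
    filter_upwards [hc ((isOpen_overChart h₀.isOpen).mem_nhds hγ),
      mem_nhdsWithin_of_mem_nhds (isOpen_Iio.mem_nhds ht₀.2), self_mem_nhdsWithin]
      with t h1 h2 h3 using ⟨⟨ht₀.1.trans h3, h2⟩, h1⟩
  have hder : ∀ t, t ∈ Ico (0 : ℝ) 1 → γ t ∈ overChart _ p.proj O →
      ∃ v, HasDerivWithinAt (fun s => extChartAt (I.prod 𝓘(ℝ, Fin k → ℝ)) p (γ s)) v (Icc 0 1) t ∧
        LiftRel (diracRep L p.proj (extChartAt (I.prod 𝓘(ℝ, Fin k → ℝ)) p (γ t)).1)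
        (gaugeFamily (thetaForm Θ₀) (thetaForm Θ₁ - thetaForm Θ₀)
          (t, extChartAt (I.prod 𝓘(ℝ, Fin k → ℝ)) p (γ t))) v
        (-(thetaForm Θ₁ - thetaForm Θ₀) (extChartAt (I.prod 𝓘(ℝ, Fin k → ℝ)) p (γ t))) := by
    intro t ht hγt
    obtain ⟨-, v, hv, hvD⟩ := h t ⟨ht.1, ht.2.le⟩
    refine ⟨_, hasDerivWithinAt_chart (h₀.mem_source rfl hγt) hv, ?_⟩
    have h1 := (mem_moserDirac_iff h₀ h₁ hγt).1 hvD
    rw [ContinuousLinearMap.neg_comp, moserForm_comp_chartInv h₀ h₁ hγt] at h1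
    exact h1
  refine ⟨?_, ?_, hev.mono fun t ht => ht.2⟩
  · filter_upwards [hev] with t ht
    obtain ⟨v, hv, hl⟩ := hder t ht.1 ht.2
    exact ⟨v, hv.mono_of_mem_nhdsWithin (hmem ht.1.1 ht.1.2), hl⟩
  · filter_upwards [hev] with t ht
    obtain ⟨v, hv, -⟩ := hder t ht.1 ht.2
    exact hv.continuousWithinAt.mono_of_mem_nhdsWithin (hmem ht₀.1 ht.1.2)

theorem isDiracOn_theta (h₀ : V₀.IsThetaOn p.proj O Θ₀) : IsDiracOn (diracRep L p.proj) O :=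
  (isDiracOn_diracRep L p.proj).mono h₀.isOpen h₀.mem_target

/-- The coincidence set in `[0, 1]` is closed by the Hausdorff property and extends to the right of
each of its points before time one, by local uniqueness. The transversality built into the curves
determines the velocity. -/
theorem IsMoserCurve.eqOn [T2Space (L.charBundle hk).DualTotal]
    {γ δ : ℝ → (L.charBundle hk).DualTotal} (hγ : IsMoserCurve V₀ V₁ γ)
    (hδ : IsMoserCurve V₀ V₁ δ) (h : γ 0 = δ 0) : ∀ t ∈ Icc (0 : ℝ) 1, γ t = δ t := by
  have hcl : IsClosed ({t | γ t = δ t} ∩ Icc (0 : ℝ) 1) := by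
    rw [inter_comm]
    exact (hγ.continuousOn.prodMk hδ.continuousOn).preimage_isClosed_of_isClosed isClosed_Icc
      isClosed_diagonal
  refine hcl.Icc_subset_of_forall_mem_nhdsWithin h fun t₀ ht₀ => ?_
  obtain ⟨heq, ht₀⟩ := ht₀
  have heq : γ t₀ = δ t₀ := heq
  obtain ⟨O, Θ₀, Θ₁, h₀, h₁, hO⟩ := exists_isThetaOn₂ V₀ V₁ (γ t₀).proj
  have hγO : γ t₀ ∈ overChart _ (γ t₀).proj O := ⟨mem_extChartAt_source _, hO⟩
  have hδO : δ t₀ ∈ overChart _ (γ t₀).proj O := heq ▸ hγO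
  obtain ⟨a1, a2, a3⟩ := hγ.eventually_chart h₀ h₁ ht₀ hγO
  obtain ⟨b1, b2, b3⟩ := hδ.eventually_chart h₀ h₁ ht₀ hδO
  have hO' : (extChartAt (I.prod 𝓘(ℝ, Fin k → ℝ)) (γ t₀) (γ t₀)).1 ∈ O := by
    rw [bundle_chart_apply (mem_extChartAt_source _)]; exact hO
  have key := eventually_eq_of_moser (isDiracOn_theta h₀) (a := thetaForm Θ₀)
    (b := thetaForm Θ₁ - thetaForm Θ₀)
    (fun u hu => h₀.contDiffAt_thetaForm hu)
    (fun u hu => (h₁.contDiffAt_thetaForm hu).sub (h₀.contDiffAt_thetaForm hu))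
    (u := fun s => extChartAt (I.prod 𝓘(ℝ, Fin k → ℝ)) (γ t₀) (γ s))
    (w := fun s => extChartAt (I.prod 𝓘(ℝ, Fin k → ℝ)) (γ t₀) (δ s))
    hO' ((moserDirac_transverse_iff h₀ h₁ hγO).1 (hγ t₀ ⟨ht₀.1, ht₀.2.le⟩).1) a1 b1
    (congrArg _ heq) a2 b2
  filter_upwards [key, a3.filter_mono (nhdsWithin_mono _ Ioi_subset_Ici_self),
    b3.filter_mono (nhdsWithin_mono _ Ioi_subset_Ici_self)] with t h1 h2 h3
  exact (extChartAt (I.prod 𝓘(ℝ, Fin k → ℝ)) (γ t₀)).injOn (h₀.mem_source rfl h2)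
    (h₀.mem_source rfl h3) h1

theorem moserDirac_swap (t : ℝ) (e : (L.charBundle hk).DualTotal) :
    moserDirac V₁ V₀ t e = moserDirac V₀ V₁ (1 - t) e := by
  rw [moserDirac, moserDirac]
  congr 1
  funext e
  module

theorem moserForm_swap (e : (L.charBundle hk).DualTotal) :
    moserForm V₁ V₀ e = -moserForm V₀ V₁ e := by
  rw [moserForm, moserForm, ← ContinuousLinearMap.neg_comp, neg_sub]

/-- Exchanging the splittings reverses the interpolation and changes the sign of the difference of
primitives. That sign is the one produced by reversing time. -/
theorem IsMoserCurve.reverse {γ : ℝ → (L.charBundle hk).DualTotal} (h : IsMoserCurve V₀ V₁ γ) :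
    IsMoserCurve V₁ V₀ fun t => γ (1 - t) := by
  intro t ht
  have ht' : 1 - t ∈ Icc (0 : ℝ) 1 := ⟨sub_nonneg.2 ht.2, sub_le_self 1 ht.1⟩
  obtain ⟨htr, v, hv, hvD⟩ := h (1 - t) ht'
  rw [moserDirac_swap, moserForm_swap]
  refine ⟨htr, -v, ?_, ?_⟩
  · have h1 : HasDerivWithinAt (fun s : ℝ => 1 - s) (-1) (Icc 0 1) t :=
      (hasDerivWithinAt_id t _).const_sub 1
    have h2 := hv.comp t (hasMFDerivWithinAt_iff_hasFDerivWithinAt.2 h1.hasFDerivWithinAt)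
      (fun s hs => ⟨sub_nonneg.2 hs.2, sub_le_self 1 hs.1⟩)
    refine h2.congr_mfderiv ?_
    refine ContinuousLinearMap.ext fun c : ℝ => ?_
    change (c • (-1 : ℝ)) • v = c • (-v)
    rw [smul_eq_mul, mul_smul, neg_one_smul]
  · have h3 := Submodule.neg_mem _ hvD
    exact h3

end MoserCurves

/-! ### Moser's argument on the total space near one point of the zero section. -/

section LocalEquivalence

variable {E : Type} {H : Type*} [NormedAddCommGroup E] [NormedSpace ℝ E] [FiniteDimensional ℝ E]
  [TopologicalSpace H] {I : ModelWithCorners ℝ E H} [I.Boundaryless] {N : Type*}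
  [TopologicalSpace N] [ChartedSpace H N] [IsManifold I ∞ N] {k : ℕ}

theorem t2Space_totalSpace {G : Type*} {Z : N → Type*} [TopologicalSpace G]
    [TopologicalSpace (TotalSpace G Z)] [∀ x, TopologicalSpace (Z x)] [FiberBundle G Z]
    [T2Space G] [T2Space N] : T2Space (TotalSpace G Z) := by
  refine ⟨fun a b hab => ?_⟩
  have hc := FiberBundle.continuous_proj G Z
  by_cases hp : a.proj = b.proj
  · let e := trivializationAt G Z a.proj
    have ha : a ∈ e.source := FiberBundle.mem_trivializationAt_proj_source
    have hb : b ∈ e.source := by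
      rw [e.mem_source, ← hp]
      exact FiberBundle.mem_baseSet_trivializationAt' a.proj
    have hne : e a ≠ e b := fun h => hab (e.injOn ha hb h)
    have hne2 : (e a).2 ≠ (e b).2 := fun h =>
      hne (Prod.ext (by rw [e.coe_fst ha, e.coe_fst hb, hp]) h)
    obtain ⟨u, v, hu, hv, hau, hbv, huv⟩ := t2_separation hne2
    have ho : ∀ {s : Set G}, IsOpen s → IsOpen (e.source ∩ (fun z => (e z).2) ⁻¹' s) := fun hs =>
      (continuous_snd.comp_continuousOn e.continuousOn).isOpen_inter_preimage e.open_source hs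
    exact ⟨_, _, ho hu, ho hv, ⟨ha, hau⟩, ⟨hb, hbv⟩,
      Disjoint.mono inter_subset_right inter_subset_right (huv.preimage _)⟩
  · obtain ⟨u, v, hu, hv, hau, hbv, huv⟩ := t2_separation hp
    exact ⟨_, _, hu.preimage hc, hv.preimage hc, hau, hbv, huv.preimage _⟩

variable {L : DiracStructure I N} {hk : ∀ x, Module.finrank ℝ (L.char x) = k}
  {V₀ V₁ : Splitting (L.charBundle hk)}

theorem Splitting.IsThetaOn.liftRel_of_mem {V : Splitting (L.charBundle hk)}
    {p e : (L.charBundle hk).DualTotal} {O : Set E} {Θ : E → (Fin k → ℝ) →L[ℝ] E →L[ℝ] ℝ}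
    (h : V.IsThetaOn p.proj O Θ) (he : e ∈ overChart _ p.proj O)
    {P : Cotangent (I.prod 𝓘(ℝ, Fin k → ℝ)) e →L[ℝ] TangentSpace (I.prod 𝓘(ℝ, Fin k → ℝ)) e}
    (hP : ∀ ξ, (P ξ, ξ) ∈ V.dirac e) (ζ : E × (Fin k → ℝ) →L[ℝ] ℝ) :
    LiftRel (diracRep L p.proj (extChartAt (I.prod 𝓘(ℝ, Fin k → ℝ)) p e).1)
      (twoForm (thetaForm Θ) (extChartAt (I.prod 𝓘(ℝ, Fin k → ℝ)) p e))
      ((chartDeriv (I.prod 𝓘(ℝ, Fin k → ℝ)) p e ∘L P ∘L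
        ContinuousLinearMap.precomp ℝ (chartDeriv (I.prod 𝓘(ℝ, Fin k → ℝ)) p e)) ζ) ζ := by
  have h1 := (h.mem_dirac_iff rfl he).1 (hP (ζ ∘L chartDeriv (I.prod 𝓘(ℝ, Fin k → ℝ)) p e))
  rw [comp_chartDeriv_chartInv (h.mem_source rfl he)] at h1
  exact h1

/-- Along the zero section the interpolated pairing is `Θ₀ + t (Θ₁ - Θ₀)`. The correction vanishes
on the characteristic subspace, so the pairing stays perfect for every real `t`. -/
theorem moser_transverse_zeroSection {x : N} {O : Set E}
    {Θ₀ Θ₁ : E → (Fin k → ℝ) →L[ℝ] E →L[ℝ] ℝ} (h₀ : V₀.IsThetaOn x O Θ₀)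
    (h₁ : V₁.IsThetaOn x O Θ₁) {y : E} (hy : y ∈ O) (t : ℝ) {X : E × (Fin k → ℝ)}
    (hX : LiftRel (diracRep L x y)
      (gaugeFamily (thetaForm Θ₀) (thetaForm Θ₁ - thetaForm Θ₀) (t, (y, 0))) X 0) : X = 0 := by
  have hp : IsPerfect (diracRep L x y) (Θ₀ y + t • (Θ₁ y - Θ₀ y)) :=
    (h₀.isPerfect hy).add_smul (fun z v hv => sub_eq_zero.2 (h₀.eq_on_char h₁ hy z v hv).symm) t
  refine hp.transverse ((isDiracOn_diracRep L x).isotropic y (h₀.mem_target y hy))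
    (fun X Y => ?_) hX
  rw [gaugeFamily_theta (p := zeroSection (Fin k → ℝ) (L.charBundle hk).Dual x) h₀ h₁
    (w := (y, 0)) hy, h₀.twoForm_zeroSection hy, h₁.twoForm_zeroSection hy]
  change _ = (Θ₀ y X.2 Y.1 + t * (Θ₁ y X.2 Y.1 - Θ₀ y X.2 Y.1)) -
    (Θ₀ y Y.2 X.1 + t * (Θ₁ y Y.2 X.1 - Θ₀ y Y.2 X.1))
  ring

theorem moserForm_zeroSection (x : N) :
    moserForm V₀ V₁ (zeroSection (Fin k → ℝ) (L.charBundle hk).Dual x) = 0 := by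
  have h : ∀ V : Splitting (L.charBundle hk),
      V.embedForm (zeroSection (Fin k → ℝ) (L.charBundle hk).Dual x) = 0 := fun V =>
    ContinuousLinearMap.zero_comp _
  rw [moserForm, h, h, sub_zero, ContinuousLinearMap.zero_comp]

theorem isMoserCurve_zeroSection (x : N) :
    IsMoserCurve V₀ V₁ fun _ => zeroSection (Fin k → ℝ) (L.charBundle hk).Dual x := by
  intro t ht
  set p := zeroSection (Fin k → ℝ) (L.charBundle hk).Dual x with hp
  refine ⟨?_, 0, ?_, ?_⟩
  · obtain ⟨O, Θ₀, Θ₁, h₀, h₁, hO⟩ := exists_isThetaOn₂ V₀ V₁ x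
    refine (moserDirac_transverse_iff (p := p) h₀ h₁ ⟨mem_extChartAt_source _, hO⟩).2
      fun X hX => ?_
    rw [chart_zeroSection (p := p) (mem_extChartAt_source (I := I) x)
      (FiberBundle.mem_baseSet_trivializationAt' x)] at hX
    exact moser_transverse_zeroSection h₀ h₁ hO t hX
  · refine (hasMFDerivWithinAt_const p _ t).congr_mfderiv ?_
    refine ContinuousLinearMap.ext fun c : ℝ => ?_
    exact (smul_zero c).symm
  · rw [moserForm_zeroSection, neg_zero]
    exact Submodule.zero_mem _

/-- Moser's argument near a point of the zero section. -/
theorem exists_local_equivalence (V₀ V₁ : Splitting (L.charBundle hk)) (x : N) :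
    ∃ (S : Set (L.charBundle hk).DualTotal)
      (F : (L.charBundle hk).DualTotal → (L.charBundle hk).DualTotal), IsOpen S ∧
      zeroSection (Fin k → ℝ) (L.charBundle hk).Dual x ∈ S ∧ ∀ e ∈ S,
      ContMDiffAt (I.prod 𝓘(ℝ, Fin k → ℝ)) (I.prod 𝓘(ℝ, Fin k → ℝ)) ∞ F e ∧
      (∃ γ, IsMoserCurve V₀ V₁ γ ∧ γ 0 = e ∧ γ 1 = F e) ∧
      ∀ (P₀ : Cotangent (I.prod 𝓘(ℝ, Fin k → ℝ)) e →L[ℝ]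
          TangentSpace (I.prod 𝓘(ℝ, Fin k → ℝ)) e)
        (P₁ : Cotangent (I.prod 𝓘(ℝ, Fin k → ℝ)) (F e) →L[ℝ]
          TangentSpace (I.prod 𝓘(ℝ, Fin k → ℝ)) (F e)),
        (∀ ξ, (P₀ ξ, ξ) ∈ V₀.dirac e) → (∀ ξ, (P₁ ξ, ξ) ∈ V₁.dirac (F e)) → ∀ ξ,
        mfderiv (I.prod 𝓘(ℝ, Fin k → ℝ)) (I.prod 𝓘(ℝ, Fin k → ℝ)) F e
          (P₀ (ξ ∘L mfderiv (I.prod 𝓘(ℝ, Fin k → ℝ)) (I.prod 𝓘(ℝ, Fin k → ℝ)) F e)) = P₁ ξ := by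
  obtain ⟨O, Θ₀, Θ₁, h₀, h₁, hO⟩ := exists_isThetaOn₂ V₀ V₁ x
  set p := zeroSection (Fin k → ℝ) (L.charBundle hk).Dual x with hp
  have h₀ : V₀.IsThetaOn p.proj O Θ₀ := h₀
  have h₁ : V₁.IsThetaOn p.proj O Θ₁ := h₁
  have hψp : extChartAt (I.prod 𝓘(ℝ, Fin k → ℝ)) p p = (extChartAt I x x, 0) :=
    chart_zeroSection (p := p) (mem_extChartAt_source (I := I) x)
      (FiberBundle.mem_baseSet_trivializationAt' x)
  -- The difference `thetaForm Θ₁ - thetaForm Θ₀` is linear in the fibre coordinate, so it vanishes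
  -- at the base point. No further confinement of the trajectories is needed.
  obtain ⟨M, Φ, A, hM, hpM, hΦ, hflow⟩ := exists_local_moser (isDiracOn_theta h₀)
    (a := thetaForm Θ₀) (b := thetaForm Θ₁ - thetaForm Θ₀)
    (fun u hu => h₀.contDiffAt_thetaForm hu)
    (fun u hu => (h₁.contDiffAt_thetaForm hu).sub (h₀.contDiffAt_thetaForm hu))
    (u₀ := (extChartAt I x x, 0)) hO (by
      refine ContinuousLinearMap.ext fun v => ?_
      change Θ₁ _ 0 v.1 - Θ₀ _ 0 v.1 = 0
      rw [map_zero, map_zero, zero_apply, sub_zero])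
    (fun t ht X hX => moser_transverse_zeroSection h₀ h₁ hO t hX) isOpen_univ (mem_univ _)
  set ψ := extChartAt (I.prod 𝓘(ℝ, Fin k → ℝ)) p with hψ
  refine ⟨ψ.source ∩ ψ ⁻¹' M, fun e => ψ.symm (Φ 1 (ψ e)),
    (continuousOn_extChartAt p).isOpen_inter_preimage (isOpen_extChartAt_source p) hM,
    ⟨mem_extChartAt_source p, by rw [mem_preimage, hψp]; exact hpM⟩, ?_⟩
  rintro e ⟨hes, heM⟩
  obtain ⟨hΦ0, hA, hcurve, hP⟩ := hflow _ heM
  have h01 : (1 : ℝ) ∈ Icc (0 : ℝ) 1 := ⟨zero_le_one, le_rfl⟩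
  have hcO : ∀ t ∈ Icc (0 : ℝ) 1, Φ t (ψ e) ∈ ψ.target := fun t ht =>
    h₀.mem_target_iff (hcurve t ht).1
  have hcC : ∀ t ∈ Icc (0 : ℝ) 1, ψ.symm (Φ t (ψ e)) ∈ overChart _ p.proj O := fun t ht =>
    (overChart_symm_mem (hcO t ht)).2 (hcurve t ht).1
  have hr : ∀ t ∈ Icc (0 : ℝ) 1, ψ (ψ.symm (Φ t (ψ e))) = Φ t (ψ e) := fun t ht =>
    ψ.right_inv (hcO t ht)
  refine ⟨?_, ⟨fun t => ψ.symm (Φ t (ψ e)), fun t ht => ⟨?_, ?_⟩, ?_, rfl⟩, ?_⟩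
  · exact (contMDiffAt_chart_symm (hcO 1 h01)).comp e
      (((hΦ.contDiffAt (hM.mem_nhds heM)).contMDiffAt).comp e
        (contMDiffAt_extChartAt' (by rw [← extChartAt_source (I.prod 𝓘(ℝ, Fin k → ℝ))]; exact hes)))
  · refine (moserDirac_transverse_iff h₀ h₁ (hcC t ht)).2 ?_
    rw [hr t ht]
    exact (hcurve t ht).2.2.1
  · obtain ⟨v, hv, hl⟩ := (hcurve t ht).2.2.2
    refine ⟨_, hasMFDerivWithinAt_chart_symm (hcO t ht) hv, ?_⟩
    rw [mem_moserDirac_iff h₀ h₁ (hcC t ht), ContinuousLinearMap.neg_comp,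
      moserForm_comp_chartInv h₀ h₁ (hcC t ht), hr t ht, chartDeriv_chartSymmDeriv (hcO t ht)]
    exact hl
  · change ψ.symm (Φ 0 (ψ e)) = e
    rw [hΦ0]
    exact ψ.left_inv hes
  · intro P₀ P₁ hP₀ hP₁ ξ
    let F : (L.charBundle hk).DualTotal → (L.charBundle hk).DualTotal :=
      fun e => ψ.symm (Φ 1 (ψ e))
    have heC : e ∈ overChart _ p.proj O := by
      have := hcC 0 ⟨le_rfl, zero_le_one⟩
      rw [hΦ0] at this
      have h2 : ψ.symm (ψ e) = e := ψ.left_inv hes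
      rwa [h2] at this
    have hFs : F e ∈ ψ.source := ψ.map_target (hcO 1 h01)
    have hψF : ψ (F e) = Φ 1 (ψ e) := hr 1 h01
    have hd : HasMFDerivAt (I.prod 𝓘(ℝ, Fin k → ℝ)) (I.prod 𝓘(ℝ, Fin k → ℝ)) F e
        (chartInv (I.prod 𝓘(ℝ, Fin k → ℝ)) p (F e) ∘L A (ψ e) ∘L
          chartDeriv (I.prod 𝓘(ℝ, Fin k → ℝ)) p e) := by
      have h2 : HasMFDerivAt 𝓘(ℝ, E × (Fin k → ℝ)) 𝓘(ℝ, E × (Fin k → ℝ)) (Φ 1) (ψ e) (A (ψ e)) :=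
        hasMFDerivAt_iff_hasFDerivAt.2 hA
      have h3 := hasMFDerivAt_chart_symm hFs
      have h3' : HasMFDerivAt 𝓘(ℝ, E × (Fin k → ℝ)) (I.prod 𝓘(ℝ, Fin k → ℝ)) ψ.symm (Φ 1 (ψ e))
          (chartInv (I.prod 𝓘(ℝ, Fin k → ℝ)) p (F e)) := by
        rw [← hψF]; exact h3
      exact h3'.comp e (h2.comp e (hasMFDerivAt_chart hes))
    have hd' : mfderiv (I.prod 𝓘(ℝ, Fin k → ℝ)) (I.prod 𝓘(ℝ, Fin k → ℝ))
        (fun e : (L.charBundle hk).DualTotal => ψ.symm (Φ 1 (ψ e))) e =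
        chartInv (I.prod 𝓘(ℝ, Fin k → ℝ)) p (F e) ∘L A (ψ e) ∘L
          chartDeriv (I.prod 𝓘(ℝ, Fin k → ℝ)) p e := hd.mfderiv
    have hw₀ : (ψ e).1 ∈ O := by
      rw [hψ, bundle_chart_apply hes]; exact heC.2
    -- At times zero and one the interpolated two-form is that of `V₀` and of `V₁`, so the given
    -- bivectors are the endpoints of the Moser family.
    have key := hP _ _ (fun ζ => by
        have hl := h₀.liftRel_of_mem heC hP₀ ζ
        have hg : gaugeFamily (thetaForm Θ₀) (thetaForm Θ₁ - thetaForm Θ₀) (0, ψ e) =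
            twoForm (thetaForm Θ₀) (ψ e) :=
          ContinuousLinearMap.ext fun X => ContinuousLinearMap.ext fun Y => by
            rw [gaugeFamily_theta h₀ h₁ hw₀]; ring
        rw [hg]
        exact hl)
      (fun ζ => by
        have hl := h₁.liftRel_of_mem (hcC 1 h01) hP₁ ζ
        have hg : gaugeFamily (thetaForm Θ₀) (thetaForm Θ₁ - thetaForm Θ₀) (1, Φ 1 (ψ e)) =
            twoForm (thetaForm Θ₁) (Φ 1 (ψ e)) :=
          ContinuousLinearMap.ext fun X => ContinuousLinearMap.ext fun Y => by
            rw [gaugeFamily_theta h₀ h₁ (hcurve 1 h01).1]; ring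
        rw [hg]
        rw [hr 1 h01] at hl
        exact hl) (ξ ∘L chartInv (I.prod 𝓘(ℝ, Fin k → ℝ)) p (F e))
    have hFξ := comp_chartInv_chartDeriv hFs ξ
    rw [hd']
    have h5 := congrArg (chartInv (I.prod 𝓘(ℝ, Fin k → ℝ)) p (F e)) key
    refine Eq.trans h5 ?_
    refine (chartInv_chartDeriv hFs _).trans ?_
    exact congrArg P₁ hFξ

end LocalEquivalence

/-! ### Gluing of the time-one maps to a diffeomorphism of neighbourhoods. -/

section Equivalence

variable {E : Type} {H : Type*} [NormedAddCommGroup E] [NormedSpace ℝ E] [FiniteDimensional ℝ E]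
  [TopologicalSpace H] {I : ModelWithCorners ℝ E H} [I.Boundaryless] {N : Type*}
  [TopologicalSpace N] [ChartedSpace H N] [IsManifold I ∞ N] {k : ℕ}
  {L : DiracStructure I N} {hk : ∀ x, Module.finrank ℝ (L.char x) = k}

/-- The value of each local map at `e` is the endpoint of the unique Moser curve from `e`. The local
maps therefore agree on overlaps. -/
theorem exists_neighborhood_map [T2Space (L.charBundle hk).DualTotal]
    (V₀ V₁ : Splitting (L.charBundle hk)) :
    ∃ (S : Set (L.charBundle hk).DualTotal)
      (F : (L.charBundle hk).DualTotal → (L.charBundle hk).DualTotal), IsOpen S ∧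
      (∀ x, zeroSection (Fin k → ℝ) (L.charBundle hk).Dual x ∈ S) ∧ ∀ e ∈ S,
      ContMDiffAt (I.prod 𝓘(ℝ, Fin k → ℝ)) (I.prod 𝓘(ℝ, Fin k → ℝ)) ∞ F e ∧
      (∃ γ, IsMoserCurve V₀ V₁ γ ∧ γ 0 = e ∧ γ 1 = F e) ∧
      ∀ P₀ P₁ : ∀ e : (L.charBundle hk).DualTotal, Cotangent (I.prod 𝓘(ℝ, Fin k → ℝ)) e →L[ℝ]
          TangentSpace (I.prod 𝓘(ℝ, Fin k → ℝ)) e,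
        (∀ ξ, (P₀ e ξ, ξ) ∈ V₀.dirac e) → (∀ ξ, (P₁ (F e) ξ, ξ) ∈ V₁.dirac (F e)) → ∀ ξ,
        mfderiv (I.prod 𝓘(ℝ, Fin k → ℝ)) (I.prod 𝓘(ℝ, Fin k → ℝ)) F e
          (P₀ e (ξ ∘L mfderiv (I.prod 𝓘(ℝ, Fin k → ℝ)) (I.prod 𝓘(ℝ, Fin k → ℝ)) F e)) =
          P₁ (F e) ξ := by
  classical
  choose S F hS hzero h using exists_local_equivalence V₀ V₁
  let G : (L.charBundle hk).DualTotal → (L.charBundle hk).DualTotal := fun e =>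
    if he : ∃ x, e ∈ S x then F he.choose e else e
  have hG : ∀ x, ∀ e ∈ S x, G e = F x e := by
    intro x e he
    have hex : ∃ x, e ∈ S x := ⟨x, he⟩
    obtain ⟨-, ⟨γ, hγ, hγ0, hγ1⟩, -⟩ := h hex.choose e hex.choose_spec
    obtain ⟨-, ⟨δ, hδ, hδ0, hδ1⟩, -⟩ := h x e he
    rw [show G e = F hex.choose e from dif_pos hex, ← hγ1, ← hδ1]
    exact hγ.eqOn hδ (hγ0.trans hδ0.symm) 1 ⟨zero_le_one, le_rfl⟩
  refine ⟨⋃ x, S x, G, isOpen_iUnion hS, fun x => mem_iUnion.2 ⟨x, hzero x⟩, fun e he => ?_⟩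
  obtain ⟨x, hx⟩ := mem_iUnion.1 he
  have hGe := hG x e hx
  have hev : G =ᶠ[𝓝 e] F x := by
    filter_upwards [(hS x).mem_nhds hx] with z hz using hG x z hz
  obtain ⟨h1, ⟨γ, hγ, hγ0, hγ1⟩, h3⟩ := h x e hx
  refine ⟨h1.congr_of_eventuallyEq hev, ⟨γ, hγ, hγ0, hγ1.trans hGe.symm⟩, ?_⟩
  intro P₀ P₁ hP₀ hP₁ ξ
  have h4 := h3 (P₀ e) (P₁ (F x e)) hP₀ (by rw [← hGe]; exact hP₁) ξ
  -- All tangent spaces are copies of the model space. Viewing `P₁` as a non-dependent function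
  -- allows rewriting along `G e = F x e`.
  let Q : (L.charBundle hk).DualTotal →
    (E × (Fin k → ℝ) →L[ℝ] ℝ) →L[ℝ] E × (Fin k → ℝ) := P₁
  have hQ : Q (G e) = Q (F x e) := congrArg Q hGe
  let A : E × (Fin k → ℝ) →L[ℝ] E × (Fin k → ℝ) :=
    mfderiv (I.prod 𝓘(ℝ, Fin k → ℝ)) (I.prod 𝓘(ℝ, Fin k → ℝ)) G e
  let B : E × (Fin k → ℝ) →L[ℝ] E × (Fin k → ℝ) :=
    mfderiv (I.prod 𝓘(ℝ, Fin k → ℝ)) (I.prod 𝓘(ℝ, Fin k → ℝ)) (F x) e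
  have hA : A = B := hev.mfderiv_eq
  let R : (E × (Fin k → ℝ) →L[ℝ] ℝ) →L[ℝ] E × (Fin k → ℝ) := P₀ e
  let ζ : E × (Fin k → ℝ) →L[ℝ] ℝ := ξ
  change A (R (ζ ∘L A)) = Q (G e) ζ
  rw [hA, hQ]
  exact h4

/-- The Poisson structures given by two splittings are isomorphic near the zero section. -/
theorem exists_partialDiffeomorph [T2Space N] (V₀ V₁ : Splitting (L.charBundle hk))
    {U₀ U₁ : Set (L.charBundle hk).DualTotal}
    {P₀ P₁ : ∀ e : (L.charBundle hk).DualTotal, Cotangent (I.prod 𝓘(ℝ, Fin k → ℝ)) e →L[ℝ]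
      TangentSpace (I.prod 𝓘(ℝ, Fin k → ℝ)) e}
    (h₀ : V₀.IsPoissonNeighborhood U₀ P₀) (h₁ : V₁.IsPoissonNeighborhood U₁ P₁) :
    ∃ φ : PartialDiffeomorph (I.prod 𝓘(ℝ, Fin k → ℝ)) (I.prod 𝓘(ℝ, Fin k → ℝ))
        (L.charBundle hk).DualTotal (L.charBundle hk).DualTotal ∞,
      φ.source ⊆ U₀ ∧ φ.target ⊆ U₁ ∧
      (∀ x, zeroSection (Fin k → ℝ) (L.charBundle hk).Dual x ∈ φ.source ∧
        φ (zeroSection (Fin k → ℝ) (L.charBundle hk).Dual x) =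
          zeroSection (Fin k → ℝ) (L.charBundle hk).Dual x) ∧
      ∀ e ∈ φ.source, ∀ ξ : Cotangent (I.prod 𝓘(ℝ, Fin k → ℝ)) (φ e),
        mfderiv (I.prod 𝓘(ℝ, Fin k → ℝ)) (I.prod 𝓘(ℝ, Fin k → ℝ)) φ e
          (P₀ e (ξ ∘L mfderiv (I.prod 𝓘(ℝ, Fin k → ℝ)) (I.prod 𝓘(ℝ, Fin k → ℝ)) φ e)) =
        P₁ (φ e) ξ := by
  have : T2Space (L.charBundle hk).DualTotal := t2Space_totalSpace
  -- A curve followed by its reversal returns to the start, so the map for the exchanged splittings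
  -- is a left inverse. No separate injectivity argument is needed.
  have key : ∀ (V₀ V₁ : Splitting (L.charBundle hk))
      (F G : (L.charBundle hk).DualTotal → (L.charBundle hk).DualTotal)
      (e : (L.charBundle hk).DualTotal),
      (∃ γ, IsMoserCurve V₀ V₁ γ ∧ γ 0 = e ∧ γ 1 = F e) →
      (∃ γ, IsMoserCurve V₁ V₀ γ ∧ γ 0 = F e ∧ γ 1 = G (F e)) → G (F e) = e := by
    rintro V₀ V₁ F G e ⟨γ, hγ, hγ0, hγ1⟩ ⟨δ, hδ, hδ0, hδ1⟩
    have h := hδ.eqOn hγ.reverse (by rw [hδ0, sub_zero, hγ1]) 1 ⟨zero_le_one, le_rfl⟩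
    rwa [hδ1, sub_self, hγ0] at h
  have hfix : ∀ (V₀ V₁ : Splitting (L.charBundle hk))
      (F : (L.charBundle hk).DualTotal → (L.charBundle hk).DualTotal) (x : N),
      (∃ γ, IsMoserCurve V₀ V₁ γ ∧ γ 0 = zeroSection (Fin k → ℝ) (L.charBundle hk).Dual x ∧
        γ 1 = F (zeroSection (Fin k → ℝ) (L.charBundle hk).Dual x)) →
      F (zeroSection (Fin k → ℝ) (L.charBundle hk).Dual x) =
        zeroSection (Fin k → ℝ) (L.charBundle hk).Dual x := by
    rintro V₀ V₁ F x ⟨γ, hγ, hγ0, hγ1⟩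
    rw [← hγ1]
    exact hγ.eqOn (isMoserCurve_zeroSection x) hγ0 1 ⟨zero_le_one, le_rfl⟩
  obtain ⟨S, F, hS, hSz, hF⟩ := exists_neighborhood_map V₀ V₁
  obtain ⟨T, G, hT, hTz, hG⟩ := exists_neighborhood_map V₁ V₀
  have hcF : ContinuousOn F S := fun e he => (hF e he).1.continuousAt.continuousWithinAt
  have hcG : ContinuousOn G T := fun e he => (hG e he).1.continuousAt.continuousWithinAt
  have hU₀ := h₀.isPoissonOn.isOpen
  have hU₁ := h₁.isPoissonOn.isOpen
  have hGF : ∀ e ∈ S, F e ∈ T → G (F e) = e := fun e he he' =>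
    key V₀ V₁ F G e (hF e he).2.1 (hG _ he').2.1
  have hFG : ∀ e ∈ T, G e ∈ S → F (G e) = e := fun e he he' =>
    key V₁ V₀ G F e (hG e he).2.1 (hF _ he').2.1
  have hFz := fun x => hfix V₀ V₁ F x (hF _ (hSz x)).2.1
  let φ : PartialDiffeomorph (I.prod 𝓘(ℝ, Fin k → ℝ)) (I.prod 𝓘(ℝ, Fin k → ℝ))
      (L.charBundle hk).DualTotal (L.charBundle hk).DualTotal ∞ :=
    { toFun := F
      invFun := G
      -- Source and target are cut down symmetrically, so that both compositions are defined and the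
      -- two maps exchange them.
      source := (S ∩ F ⁻¹' (T ∩ U₁)) ∩ U₀
      target := (T ∩ G ⁻¹' (S ∩ U₀)) ∩ U₁
      map_source' := by
        rintro e ⟨⟨hS, hT, hU⟩, hU'⟩
        refine ⟨⟨hT, ?_⟩, hU⟩
        rw [mem_preimage, hGF e hS hT]
        exact ⟨hS, hU'⟩
      map_target' := by
        rintro e ⟨⟨hT, hS, hU⟩, hU'⟩
        refine ⟨⟨hS, ?_⟩, hU⟩
        rw [mem_preimage, hFG e hT hS]
        exact ⟨hT, hU'⟩
      left_inv' := fun e he => hGF e he.1.1 he.1.2.1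
      right_inv' := fun e he => hFG e he.1.1 he.1.2.1
      open_source := (hcF.isOpen_inter_preimage hS (hT.inter hU₁)).inter hU₀
      open_target := (hcG.isOpen_inter_preimage hT (hS.inter hU₀)).inter hU₁
      contMDiffOn_toFun := fun e he => (hF e he.1.1).1.contMDiffWithinAt
      contMDiffOn_invFun := fun e he => (hG e he.1.1).1.contMDiffWithinAt }
  refine ⟨φ, fun e he => he.2, fun e he => he.2, fun x => ⟨⟨⟨hSz x, ?_⟩, h₀.zero_mem x⟩, hFz x⟩,
    fun e he ξ => ?_⟩
  · rw [mem_preimage, hFz x]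
    exact ⟨hTz x, h₁.zero_mem x⟩
  · refine (hF e he.1.1).2.2 P₀ P₁ (fun ζ => ?_) (fun ζ => ?_) ξ
    · rw [← h₀.graph_eq e he.2]
      exact ⟨ζ, rfl⟩
    · rw [← h₁.graph_eq _ he.1.2.2]
      exact ⟨ζ, rfl⟩

end Equivalence

/-! ### Existence of complementary distributions. -/

section ExistsSplitting

variable {E H : Type*} [NormedAddCommGroup E] [NormedSpace ℝ E]
  [TopologicalSpace H] {I : ModelWithCorners ℝ E H} [I.Boundaryless] {N : Type*}
  [TopologicalSpace N] [ChartedSpace H N] [IsManifold I ∞ N] {k : ℕ}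

theorem contMDiffAt_endo_iff {p : N} {u : E} (hu : u ∈ (extChartAt I p).target)
    {Q : ∀ q : N, TangentSpace I q →L[ℝ] TangentSpace I q} :
    ContMDiffAt I (I.prod 𝓘(ℝ, E →L[ℝ] E)) ∞ (fun q => TotalSpace.mk' (E →L[ℝ] E) q (Q q))
      ((extChartAt I p).symm u) ↔ ContDiffAt ℝ ∞ (fun w => chartDeriv I p _ ∘L
        Q ((extChartAt I p).symm w) ∘L chartSymmDeriv I p w) u := by
  let e := trivializationAt (E →L[ℝ] E)
    (fun q : N => TangentSpace I q →L[ℝ] TangentSpace I q) p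
  have hb : (extChartAt I p).symm u ∈ e.baseSet :=
    ⟨mem_source_of_target hu, mem_source_of_target hu⟩
  rw [Trivialization.contMDiffAt_section_iff (IB := I) (n := ∞) e hb, contMDiffAt_iff_chart hu]
  refine contDiffAt_congr ?_
  filter_upwards [target_mem_nhds hu] with w hw
  change ContinuousLinearMap.inCoordinates E (TangentSpace I) E
    (TangentSpace I) p ((extChartAt I p).symm w) p ((extChartAt I p).symm w) (Q _) = _
  refine ContinuousLinearMap.ext fun v => ?_
  simp only [ContinuousLinearMap.inCoordinates, ContinuousLinearMap.comp_apply]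
  rw [symmL_eq_chartSymmDeriv hw]
  exact triv_tangent_apply hw _

/-- Smooth linear projections onto the span of a smooth frame. -/
theorem exists_smooth_projection [FiniteDimensional ℝ E] {x₀ : E} {S : Fin k → E → E}
    (hS : ∀ i, ∀ᶠ x in 𝓝 x₀, ContDiffAt ℝ ∞ (S i) x)
    (hli : LinearIndependent ℝ fun i => S i x₀) :
    ∃ Q : E → E →L[ℝ] E, ∀ᶠ x in 𝓝 x₀, ContDiffAt ℝ ∞ Q x ∧
      (∀ v, Q x v ∈ Submodule.span ℝ (range fun i => S i x)) ∧ ∀ i, Q x (S i x) = S i x := by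
  let A : E → (Fin k → ℝ) →L[ℝ] E := fun x =>
    ∑ i, ContinuousLinearMap.smulRightL ℝ (Fin k → ℝ) E (ContinuousLinearMap.proj i) (S i x)
  have hA : ∀ x v, A x v = ∑ i, v i • S i x := by
    intro x v
    simp [A]
  have hAs : ∀ᶠ x in 𝓝 x₀, ContDiffAt ℝ ∞ A x := by
    filter_upwards [Filter.eventually_all.2 hS] with x h1
    exact ContDiffAt.sum fun i _ => (ContinuousLinearMap.contDiff _).contDiffAt.comp x (h1 i)
  have hinj : Function.Injective (A x₀) := by
    refine (injective_iff_map_eq_zero _).2 fun v hv => ?_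
    rw [hA] at hv
    exact funext (Fintype.linearIndependent_iff.1 hli v hv)
  obtain ⟨T, hT⟩ : ∃ T : E →L[ℝ] (Fin k → ℝ), T ∘L A x₀ = ContinuousLinearMap.id ℝ _ := by
    obtain ⟨T, hT⟩ := LinearMap.exists_leftInverse_of_injective
      (A x₀ : (Fin k → ℝ) →ₗ[ℝ] E) (LinearMap.ker_eq_bot.2 hinj)
    exact ⟨LinearMap.toContinuousLinearMap T, ContinuousLinearMap.ext fun v =>
      LinearMap.congr_fun hT v⟩
  let R : E → (Fin k → ℝ) →L[ℝ] (Fin k → ℝ) := fun x => T ∘L A x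
  have hRs : ∀ {x}, ContDiffAt ℝ ∞ A x → ContDiffAt ℝ ∞ R x := fun h =>
    contDiffAt_const.clm_comp h
  have hunit : ∀ᶠ x in 𝓝 x₀, IsUnit (R x) := by
    have h1 : {B : (Fin k → ℝ) →L[ℝ] (Fin k → ℝ) | IsUnit B} ∈ 𝓝 (R x₀) := by
      rw [show R x₀ = 1 from hT]; exact Units.isOpen.mem_nhds isUnit_one
    exact (hRs hAs.self_of_nhds).continuousAt h1
  -- With `T` a left inverse of the frame map at `x₀`, the operator `A (T A)⁻¹ T` is a projection
  -- onto the range of `A` wherever `T A` is invertible.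
  refine ⟨fun x => A x ∘L Ring.inverse (R x) ∘L T, ?_⟩
  filter_upwards [hAs, hunit] with x hx hu
  refine ⟨?_, fun v => ?_, fun i => ?_⟩
  · have h1 : ContDiffAt ℝ ∞ (fun x => Ring.inverse (R x)) x := by
      obtain ⟨q, hq⟩ := hu
      have h : ContDiffAt ℝ ∞ Ring.inverse (R x) := by
        rw [← hq]; exact contDiffAt_ringInverse ℝ q
      exact h.comp x (hRs hx)
    exact hx.clm_comp (h1.clm_comp contDiffAt_const)
  · change A x _ ∈ _
    rw [hA]
    exact Submodule.sum_mem _ fun i _ => Submodule.smul_mem _ _ (Submodule.subset_span ⟨i, rfl⟩)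
  · have h1 : S i x = A x (Pi.single i 1) := by
      rw [hA]
      simp [Pi.single_apply]
    change A x (Ring.inverse (R x) (T (S i x))) = _
    rw [h1]
    exact congrArg (A x) (DFunLike.congr_fun (Ring.inverse_mul_cancel (R x) hu) (Pi.single i 1))

variable [FiniteDimensional ℝ E]

theorem Subbundle.exists_local_projection (D : Subbundle I N k) (b : N) :
    ∃ U ∈ 𝓝 b, ∃ Q : ∀ q : N, TangentSpace I q →L[ℝ] TangentSpace I q,
      ContMDiffOn I (I.prod 𝓘(ℝ, E →L[ℝ] E)) ∞ (fun q => TotalSpace.mk' (E →L[ℝ] E) q (Q q)) U ∧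
      ∀ q ∈ U, (∀ v, Q q v ∈ D.space q) ∧ ∀ v ∈ D.space q, Q q v = v := by
  obtain ⟨U, s, hbU, hs⟩ := D.exists_frame b
  have hbs := mem_extChartAt_source (I := I) b
  obtain ⟨Q, hQ⟩ := exists_smooth_projection (x₀ := extChartAt I b b)
    (S := fun i => vecRep I b (s i))
    (fun i => eventually_contDiffAt_vecRep hs.isOpen hbU (hs.smooth i)) (by
      have h1 := (hs.linearIndependent b hbU).map' (chartDeriv I b b : TangentSpace I b →ₗ[ℝ] E)
        (LinearMap.ker_eq_bot.2 fun v w hvw => by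
          have := congrArg (chartInv I b b) hvw
          exact (chartInv_chartDeriv hbs v).symm.trans (this.trans (chartInv_chartDeriv hbs w)))
      have h2 : (fun i => vecRep I b (s i) (extChartAt I b b)) =
          fun i => chartDeriv I b b (s i b) := by
        funext i
        rw [vecRep, extChartAt_to_inv]
      rw [h2]
      exact h1)
  obtain ⟨O, hO, hOo, hbO⟩ := eventually_nhds_iff.1 hQ
  let W := ((extChartAt I b).source ∩ extChartAt I b ⁻¹' O) ∩ U
  have hW : IsOpen W := ((continuousOn_extChartAt b).isOpen_inter_preimage
    (isOpen_extChartAt_source b) hOo).inter hs.isOpen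
  refine ⟨W, hW.mem_nhds ⟨⟨hbs, hbO⟩, hbU⟩, fun q => chartInv I b q ∘L Q (extChartAt I b q) ∘L
    chartDeriv I b q, fun q hq => ?_, fun q hq => ?_⟩
  · obtain ⟨u, hu, rfl, hqu⟩ := exists_eq_chart_symm hq.1.1
    refine ((contMDiffAt_endo_iff hu).2 ?_).contMDiffWithinAt
    have huO : u ∈ O := by rw [hqu]; exact hq.1.2
    refine (hO u huO).1.congr_of_eventuallyEq ?_
    filter_upwards [target_mem_nhds hu] with w hw
    refine ContinuousLinearMap.ext fun v => ?_
    change chartDeriv I b _ (chartInv I b _ (Q (extChartAt I b ((extChartAt I b).symm w))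
      (chartDeriv I b _ (chartSymmDeriv I b w v)))) = _
    rw [chartDeriv_chartSymmDeriv hw, chartInv_eq hw, chartDeriv_chartSymmDeriv hw,
      (extChartAt I b).right_inv hw]
  · obtain ⟨-, h1, h2⟩ := hO _ hq.1.2
    have hval : ∀ i, vecRep I b (s i) (extChartAt I b q) = chartDeriv I b q (s i q) := by
      intro i
      rw [vecRep, (extChartAt I b).left_inv hq.1.1]
    constructor
    · intro v
      have h3 := h1 (chartDeriv I b q v)
      simp only [hval] at h3
      rw [← hs.span_eq q hq.2]
      have h4 := Submodule.mem_map_of_mem (f := (chartInv I b q : E →ₗ[ℝ] TangentSpace I q)) h3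
      rw [Submodule.map_span, ← range_comp] at h4
      have h5 : ((chartInv I b q : E →ₗ[ℝ] TangentSpace I q) ∘ fun i => chartDeriv I b q (s i q)) =
          fun i => s i q := funext fun i => chartInv_chartDeriv hq.1.1 _
      rw [h5] at h4
      exact h4
    · intro v hv
      rw [← hs.span_eq q hq.2] at hv
      induction hv using Submodule.span_induction with
      | mem v hv =>
        obtain ⟨i, rfl⟩ := hv
        have h3 := h2 i
        rw [hval] at h3
        exact (congrArg (chartInv I b q) h3).trans (chartInv_chartDeriv hq.1.1 _)
      | zero => exact map_zero _
      | add v w _ _ h3 h4 => exact (map_add _ v w).trans (congrArg₂ (· + ·) h3 h4)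
      | smul c v _ h3 => exact (map_smul _ c v).trans (congrArg (c • ·) h3)

/-- Every subbundle of the tangent bundle has a complement. -/
theorem Subbundle.exists_splitting [T2Space N] [SigmaCompactSpace N] (D : Subbundle I N k) :
    Nonempty (Splitting D) := by
  let t : ∀ q : N, Set (TangentSpace I q →L[ℝ] TangentSpace I q) := fun q =>
    {Q | (∀ v, Q v ∈ D.space q) ∧ ∀ v ∈ D.space q, Q v = v}
  -- Taking values in `D` and being the identity on `D` are preserved by convex combinations, so a
  -- partition of unity produces a global smooth projection.
  have ht : ∀ q, Convex ℝ (t q) := by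
    rintro q A hA B hB a c - - hac
    refine ⟨fun v => ?_, fun v hv => ?_⟩
    · exact Submodule.add_mem _ (Submodule.smul_mem _ a (hA.1 v)) (Submodule.smul_mem _ c (hB.1 v))
    · change a • A v + c • B v = v
      rw [hA.2 v hv, hB.2 v hv, ← add_smul, hac, one_smul]
  obtain ⟨Q, hQ⟩ := exists_contMDiffSection_forall_mem_convex_of_local I (n := ⊤)
    (F_fiber := E →L[ℝ] E) (fun q : N => TangentSpace I q →L[ℝ] TangentSpace I q) t ht
    D.exists_local_projection
  refine ⟨⟨fun q => LinearMap.ker (Q q : TangentSpace I q →ₗ[ℝ] TangentSpace I q), fun q => ?_,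
    fun b v hv => ?_⟩⟩
  · constructor
    · refine Submodule.disjoint_def.2 fun v hv hv' => ?_
      rw [← (hQ q).2 v hv]
      exact hv'
    · refine codisjoint_iff.2 (eq_top_iff.2 fun v _ => ?_)
      refine Submodule.mem_sup.2 ⟨Q q v, (hQ q).1 v, v - Q q v, ?_, add_sub_cancel _ _⟩
      refine LinearMap.mem_ker.2 ?_
      change Q q (v - Q q v) = 0
      rw [map_sub, (hQ q).2 _ ((hQ q).1 v), sub_self]
  · let Z : ∀ q : N, TangentSpace I q := fun q => chartInv I b q (chartDeriv I b b v)
    have hZ : SmoothVectorFieldOn I Z (extChartAt I b).source := by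
      intro q hq
      obtain ⟨u, hu, rfl, -⟩ := exists_eq_chart_symm hq
      refine ((contMDiffAt_vec_iff hu).2 ?_).contMDiffWithinAt
      refine (contDiffAt_const (c := chartDeriv I b b v)).congr_of_eventuallyEq ?_
      filter_upwards [target_mem_nhds hu] with w hw
      exact chartDeriv_chartInv ((extChartAt I b).map_target hw) _
    have hQZ : SmoothVectorFieldOn I (fun q => Q q (Z q)) (extChartAt I b).source :=
      ContMDiffOn.clm_bundle_apply (E₁ := TangentSpace I) (E₂ := TangentSpace I)
        (Q.contMDiff.contMDiffOn) hZ
    refine ⟨(extChartAt I b).source, fun q => Z q - Q q (Z q), isOpen_extChartAt_source b,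
      mem_extChartAt_source b, ?_, fun q _ => ?_, ?_⟩
    · exact ContMDiffOn.sub_section hZ hQZ
    · refine LinearMap.mem_ker.2 ?_
      change Q q (Z q - Q q (Z q)) = 0
      rw [map_sub, (hQ q).2 _ ((hQ q).1 _), sub_self]
    · have h1 : Z b = v := chartInv_chartDeriv (mem_extChartAt_source b) v
      have h2 : Q b v = 0 := hv
      change Z b - Q b (Z b) = v
      rw [h1, h2, sub_zero]

end ExistsSplitting

end DiracGeometry

end

theorem mainTheorem7 {n k : ℕ} {M : Type*} [TopologicalSpace M] [T2Space M]
    [SecondCountableTopology M] [ChartedSpace (EuclideanSpace ℝ (Fin n)) M]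
    [IsManifold (𝓡 n) ∞ M] (L : DiracStructure (𝓡 n) M)
    (hk : ∀ x, Module.finrank ℝ (L.char x) = k) :
    Nonempty (Splitting (L.charBundle hk)) ∧
    (∀ V : Splitting (L.charBundle hk), ∃ U P, V.IsPoissonNeighborhood U P ∧
      IsCoisotropicEmbedding (zeroSection (Fin k → ℝ) (L.charBundle hk).Dual) L.fiber P U) ∧
    ∀ (V₀ V₁ : Splitting (L.charBundle hk)) (U₀ U₁ : Set (L.charBundle hk).DualTotal)
      (P₀ P₁ : ∀ e : (L.charBundle hk).DualTotal, Cotangent ((𝓡 n).prod 𝓘(ℝ, Fin k → ℝ)) e →L[ℝ]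
        TangentSpace ((𝓡 n).prod 𝓘(ℝ, Fin k → ℝ)) e),
      V₀.IsPoissonNeighborhood U₀ P₀ → V₁.IsPoissonNeighborhood U₁ P₁ →
      ∃ φ : PartialDiffeomorph ((𝓡 n).prod 𝓘(ℝ, Fin k → ℝ)) ((𝓡 n).prod 𝓘(ℝ, Fin k → ℝ))
          (L.charBundle hk).DualTotal (L.charBundle hk).DualTotal ∞,
        φ.source ⊆ U₀ ∧ φ.target ⊆ U₁ ∧
        (∀ x, zeroSection (Fin k → ℝ) (L.charBundle hk).Dual x ∈ φ.source ∧
          φ (zeroSection (Fin k → ℝ) (L.charBundle hk).Dual x) =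
            zeroSection (Fin k → ℝ) (L.charBundle hk).Dual x) ∧
        ∀ e ∈ φ.source, ∀ ξ : Cotangent ((𝓡 n).prod 𝓘(ℝ, Fin k → ℝ)) (φ e),
          mfderiv ((𝓡 n).prod 𝓘(ℝ, Fin k → ℝ)) ((𝓡 n).prod 𝓘(ℝ, Fin k → ℝ)) φ e
            (P₀ e (ξ ∘L mfderiv ((𝓡 n).prod 𝓘(ℝ, Fin k → ℝ)) ((𝓡 n).prod 𝓘(ℝ, Fin k → ℝ)) φ e)) =
          P₁ (φ e) ξ := by
  -- Local compactness and second countability give the σ-compactness needed for partitions of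
  -- unity.
  have : LocallyCompactSpace M := ChartedSpace.locallyCompactSpace (EuclideanSpace ℝ (Fin n)) M
  exact ⟨(L.charBundle hk).exists_splitting,
    fun V => ⟨V.poissonDomain, V.sharp, V.isPoissonNeighborhood, V.isCoisotropicEmbedding⟩,
    fun V₀ V₁ _ _ _ _ h₀ h₁ => exists_partialDiffeomorph V₀ V₁ h₀ h₁⟩
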